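/- **Setting.** Let $\mathcal T_2$ be the regular (trivalent) planar tree with a marked central vertex, and $\partial\mathcal T_2$ its space of ends. The ends are ordered as follows: number the three edges at the central vertex in the cyclic order of the plane, then compare lexicographically (left before right); this induces the cyclic order of the plane on $\partial \mathcal T_2$. For a finite dyadic subtree $\alpha\subset\mathcal T_2$ containing the central vertex and its three edges, each leaf of $\alpha$ is the root of an infinite rooted dyadic tree. * The Neretin (spheromorphism) group $\mathcal N$ consists of the bijections of $\partial\mathcal T_2$ given by symbols $(\alpha_1,\alpha_0,q_\sigma)$: a bijection $\sigma$ from the leaves of $\alpha_0$ to the leaves of $\alpha_1$, together with an isomorphism of the rooted tree below each leaf $i$ of $\alpha_0$ onto the rooted tree below the leaf $\sigma(i)$ of $\alpha_1$. * Thompson's group $\mathcal T\subset\mathcal N$ consists of the elements that have a symbol in which all these isomorphisms are planar (left to left, right to right) and $\sigma$ is cyclic, i.e. maps the leaves of $\alpha_0$, taken in the cyclic order of the plane, to the leaves of $\alpha_1$ in their cyclic order. The orientation-reversing involution $Inv\in\mathcal N$ reverses the order of the three edges at the central vertex and exchanges left and right at every other vertex. $Out(\mathcal T)$ is the group of automorphisms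 of $\mathcal T$ modulo inner automorphisms. * The cyclic tower $\overline{\mathcal M}_{0,3\cdot 2^\infty}(\mathbb R)=\varinjlim_n \overline{\mathcal M}_{0,3\cdot 2^n}(\mathbb R)$ of moduli spaces of stable real genus zero curves (each marked point being replaced by a new component carrying two marked points when passing from $n$ to $n+1$) is a regular cell complex. Its cells, the strata $\mathcal M(T(\tau))$, are labelled by planar unrooted trees $T$ with inner vertices of valence at least $3$, whose leaves are labelled bijectively, via $\tau$, by the leaves of a finite dyadic tree $\alpha$ as above (the uniform tree with $3\cdot2^n$ leaves for a stratum of $\overline{\mathcal M}_{0,3\cdot 2^n}(\mathbb R)$). Labels are taken up to reflection of the whole tree $T$, up to reflection of either of the two parts into which an inner edge cuts $T$, and up to expansion of a leaf of $T$ together with the corresponding leaf of $\alpha$ by two new edges. A stratum lies in the closure of another one iff, for suitable labels, the tree of the latter is obtained from the tree of the former by contracting inner edges. * $g\in\mathcal N$ acts on the tower cellularly: expand the label of a stratum until $g=[(\alpha_1,\alpha,q_\sigma)]$ with $\alpha$ the tree whose leaves label $T$; then $g\cdot\mathcal M(T(\tau))=\mathcal M(T(\sigma\circ\tau))$, where the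 labels are now the leaves of $\alpha_1$. * The distinguished infinite associahedron $K_\infty$ is the subcomplex formed by the strata having a label $T(\tau)$ in which $\tau$ is cyclic, i.e. the leaves of $T$, in the cyclic order of the plane, carry the leaves of $\alpha$ in the cyclic order of the plane. **Theorem.** $Out(\mathcal T)$ is cyclic of order two, generated by the class of the automorphism $t\mapsto Inv\, t\, Inv^{-1}$ of $\mathcal T$, and the stabilizer of $K_\infty$ under the action of $\mathcal N$ on the cyclic tower $\overline{\mathcal M}_{0,3\cdot 2^\infty}(\mathbb R)$ is the semidirect product $Out(\mathcal T)\ltimes\mathcal T$. More precisely, there are a homomorphism $\psi: Out(\mathcal T)\to Aut(\mathcal T)$ that is a section of the projection $Aut(\mathcal T)\to Out(\mathcal T)$, and an isomorphism from $\mathcal T\rtimes_\psi Out(\mathcal T)$ onto the stabilizer of $K_\infty$ in $\mathcal N$ which is the inclusion $\mathcal T\subset\mathcal N$ on $\mathcal T$ and maps the generator of $Out(\mathcal T)$ to $Inv$, so that this generator acts on $\mathcal T$ through $\psi$ as conjugation by $Inv$. -/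

import Mathlib

open scoped Pointwise

namespace CyclicTower

/-! ### The boundary of the regular dyadic tree -/

/-- The boundary `∂𝒯₂` of the regular (trivalent) planar dyadic tree with a marked central vertex.
The three edges at the central vertex, in the cyclic order of the plane, are numbered by `Fin 3`;
after the first edge, an end turns left (`false`) or right (`true`) at each further vertex. -/
abbrev Bdry : Type := Fin 3 × (ℕ → Bool)

/-- The ends `x` and `y` share the first edge and the `n` turns after it, i.e. they both lie
beyond the edge that `x` crosses at depth `n`. -/
def Agree (x y : Bdry) (n : ℕ) : Prop := x.1 = y.1 ∧ ∀ k < n, x.2 k = y.2 k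

/-- The cone of the edge which `x` crosses at depth `n`: all the ends beyond this edge. -/
def cone (x : Bdry) (n : ℕ) : Set Bdry := {y | Agree x y n}

/-- The two halves of a cone: the left one (`b = false`) and the right one (`b = true`). -/
def half (x : Bdry) (n : ℕ) (b : Bool) : Set Bdry := {y | Agree x y n ∧ y.2 n = b}

/-- The planar (lexicographic) order of ends, counted from the first end beyond the first edge
at the central vertex. -/
def PlanarLT (x y : Bdry) : Prop :=
  x.1 < y.1 ∨ (x.1 = y.1 ∧ ∃ k, (∀ j < k, x.2 j = y.2 j) ∧ x.2 k = false ∧ y.2 k = true)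

/-- The set `U` of ends lies entirely before `V` in the planar order. -/
def Before (U V : Set Bdry) : Prop := ∀ x ∈ U, ∀ y ∈ V, PlanarLT x y

/-- `l` enumerates (in some order) the leaves of a finite dyadic subtree that contains the central
vertex and all three edges at it. A leaf is identified with its cone; lists of cones arising from
such trees are exactly the lists of pairwise disjoint cones that cover the boundary. -/
structure IsLeafList (l : List (Set Bdry)) : Prop where
  isCone : ∀ U ∈ l, ∃ x n, U = cone x n
  disj : l.Pairwise Disjoint
  cover : ∀ x, ∃ U ∈ l, x ∈ U

/-- The list of leaves `l` runs through the plane in its cyclic order, starting anywhere. -/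
def IsCyclicList (l : List (Set Bdry)) : Prop :=
  ∃ l', List.IsRotated l l' ∧ l'.Pairwise Before

/-! ### The Neretin group -/

/-- `g` carries the cone of `x` at depth `n` to the cone of `g x` at depth `m`, and does so through
an isomorphism of the two rooted dyadic trees below (not necessarily a planar one): two ends
of the first cone are in the same cone `k` levels below iff their images are. -/
def IsTreeIsoAt (g : Equiv.Perm Bdry) (x : Bdry) (n m : ℕ) : Prop :=
  ∀ y z, Agree x y n → ∀ k, (Agree y z (n + k) ↔ Agree (g y) (g z) (m + k))

lemma Agree.refl (x : Bdry) (n : ℕ) : Agree x x n := ⟨rfl, fun _ _ => rfl⟩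

lemma Agree.symm {x y : Bdry} {n : ℕ} (h : Agree x y n) : Agree y x n :=
  ⟨h.1.symm, fun k hk => (h.2 k hk).symm⟩

lemma Agree.trans {x y z : Bdry} {n : ℕ} (h : Agree x y n) (h' : Agree y z n) : Agree x z n :=
  ⟨h.1.trans h'.1, fun k hk => (h.2 k hk).trans (h'.2 k hk)⟩

lemma Agree.mono {x y : Bdry} {n m : ℕ} (h : Agree x y n) (hm : m ≤ n) : Agree x y m :=
  ⟨h.1, fun k hk => h.2 k (lt_of_lt_of_le hk hm)⟩

lemma IsTreeIsoAt.shift {g : Equiv.Perm Bdry} {x : Bdry} {n m : ℕ} (h : IsTreeIsoAt g x n m)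
    (j : ℕ) : IsTreeIsoAt g x (n + j) (m + j) := by
  intro y z hy k
  have := h y z (hy.mono (by omega)) (j + k)
  rwa [← add_assoc, ← add_assoc] at this

lemma IsTreeIsoAt.mem {g : Equiv.Perm Bdry} {x : Bdry} {n m : ℕ} (h : IsTreeIsoAt g x n m)
    (z : Bdry) : Agree x z n ↔ Agree (g x) (g z) m := by
  simpa using h x z (Agree.refl x n) 0

lemma IsTreeIsoAt.comp {g h : Equiv.Perm Bdry} {x : Bdry} {n m p : ℕ}
    (hg : IsTreeIsoAt g x n m) (hh : IsTreeIsoAt h (g x) m p) : IsTreeIsoAt (h * g) x n p := by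
  intro y z hy k
  rw [hg y z hy k]
  exact hh (g y) (g z) ((hg.mem y).1 hy) k

lemma IsTreeIsoAt.inv {g : Equiv.Perm Bdry} {x : Bdry} {n m : ℕ} (h : IsTreeIsoAt g x n m) :
    IsTreeIsoAt g⁻¹ (g x) m n := by
  intro y z hy k
  have hy' : Agree x (g⁻¹ y) n := (h.mem _).2 (by simpa using hy)
  simpa using (h (g⁻¹ y) (g⁻¹ z) hy' k).symm

lemma IsTreeIsoAt.congr {g : Equiv.Perm Bdry} {x x' : Bdry} {n m : ℕ} (h : IsTreeIsoAt g x n m)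
    (hx : Agree x x' n) : IsTreeIsoAt g x' n m :=
  fun y z hy k => h y z (hx.trans hy) k

/-- The end that agrees with `i` and a given finite sequence of turns and then turns left. -/
def leftEnd (n : ℕ) (p : Fin 3 × (Fin n → Bool)) : Bdry :=
  (p.1, fun k => if h : k < n then p.2 ⟨k, h⟩ else false)

lemma agree_leftEnd (x : Bdry) (n : ℕ) : Agree x (leftEnd n (x.1, fun k => x.2 k)) n :=
  ⟨rfl, fun k hk => by simp [leftEnd, hk]⟩

/-- A property of cones at depth `n` and bounds: finitely many cones at each depth. -/
lemma exists_bound (n : ℕ) (P : Bdry → ℕ → Prop)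
    (hP : ∀ x x' m, Agree x x' n → P x m → P x' m) (h : ∀ x, ∃ m, P x m) :
    ∃ M, ∀ x, ∃ m ≤ M, P x m := by
  choose f hf using h
  refine ⟨Finset.univ.sup (fun p => f (leftEnd n p)), fun x => ?_⟩
  refine ⟨f (leftEnd n (x.1, fun k => x.2 k)), ?_, ?_⟩
  · exact Finset.le_sup (f := fun p => f (leftEnd n p)) (Finset.mem_univ _)
  · exact hP _ _ _ (agree_leftEnd x n).symm (hf _)

/-- The Neretin group `𝒩` (spheromorphisms), as a group of transformations of the boundary:
`g` is given by a symbol whose source tree is the uniform tree with `3 * 2 ^ n` leaves, each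
subtree below a leaf of which is carried isomorphically onto the subtree below a leaf of another
finite tree. -/
def Neretin : Subgroup (Equiv.Perm Bdry) where
  carrier := {g | ∃ n, ∀ x, ∃ m, IsTreeIsoAt g x n m}
  one_mem' := ⟨0, fun _ => ⟨0, fun _ _ _ _ => Iff.rfl⟩⟩
  mul_mem' := by
    rintro h g ⟨n', hh⟩ ⟨n, hg⟩
    refine ⟨n + n', fun x => ?_⟩
    obtain ⟨m, hm⟩ := hg x
    obtain ⟨m', hm'⟩ := hh (g x)
    refine ⟨m' + m, (hm.shift n').comp ?_⟩
    have := hm'.shift m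
    rwa [add_comm n' m] at this
  inv_mem' := by
    rintro g ⟨n, hg⟩
    obtain ⟨M, hM⟩ := exists_bound n (IsTreeIsoAt g · n ·) (fun x x' m hx h => h.congr hx) hg
    refine ⟨M, fun y => ?_⟩
    obtain ⟨m, hm, h⟩ := hM (g⁻¹ y)
    refine ⟨n + (M - m), ?_⟩
    have := h.inv.shift (M - m)
    rw [Nat.add_sub_cancel' hm] at this
    simpa using this

/-- The orientation-reversing involution: it reverses the cyclic order of the leaves of every
uniform tree, i.e. it exchanges left and right everywhere. -/
def invPerm : Equiv.Perm Bdry where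
  toFun x := (Fin.rev x.1, fun k => !(x.2 k))
  invFun x := (Fin.rev x.1, fun k => !(x.2 k))
  left_inv x := by simp
  right_inv x := by simp

/-- The orientation-reversing involution as an element of `𝒩`. -/
def inversion : Neretin := ⟨invPerm, 0, fun x => ⟨0, fun y z _ k => by
  simp [Agree, invPerm]⟩⟩

/-! ### Thompson's group -/

/-- `g` carries the leaf `U` to the leaf `V` through the planar isomorphism of the two rooted
dyadic trees below (lefts to lefts and rights to rights). -/
def IsPlanarOn (g : Equiv.Perm Bdry) (U V : Set Bdry) : Prop :=
  ∃ x n m, U = cone x n ∧ V = cone (g x) m ∧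
    ∀ y ∈ U, g y ∈ V ∧ ∀ k, (g y).2 (m + k) = y.2 (n + k)

/-- `g` is represented by a symbol `(α₁, α₀, σ)` with `σ` cyclic: `l₀` lists the leaves of `α₀`
from the first to the last one in the planar order, and `l₁` lists the leaves of `α₁` in the cyclic
order of the plane, starting at the image of the first leaf of `α₀`. -/
def IsThompsonT (g : Equiv.Perm Bdry) : Prop :=
  ∃ l₀ l₁, IsLeafList l₀ ∧ l₀.Pairwise Before ∧ IsLeafList l₁ ∧ IsCyclicList l₁ ∧
    List.Forall₂ (IsPlanarOn g) l₀ l₁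

lemma PlanarLT.irrefl (x : Bdry) : ¬ PlanarLT x x := by
  rintro (h | ⟨_, k, _, h1, h2⟩)
  · exact lt_irrefl _ h
  · simp_all

lemma PlanarLT.trans {x y z : Bdry} (h : PlanarLT x y) (h' : PlanarLT y z) : PlanarLT x z := by
  rcases h with h | ⟨h, k, hk, h1, h2⟩ <;> rcases h' with h' | ⟨h', l, hl, h1', h2'⟩
  · exact Or.inl (h.trans h')
  · exact Or.inl (h' ▸ h)
  · exact Or.inl (h ▸ h')
  · refine Or.inr ⟨h.trans h', ?_⟩
    rcases lt_trichotomy k l with hkl | hkl | hkl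
    · exact ⟨k, fun j hj => (hk j hj).trans (hl j (hj.trans hkl)), h1, (hl k hkl) ▸ h2⟩
    · subst hkl
      simp_all
    · exact ⟨l, fun j hj => (hk j (hj.trans hkl)).trans (hl j hj), (hk l hkl).trans h1', h2'⟩

lemma PlanarLT.total {x y : Bdry} (h : x ≠ y) : PlanarLT x y ∨ PlanarLT y x := by
  rcases lt_trichotomy x.1 y.1 with h1 | h1 | h1
  · exact Or.inl (Or.inl h1)
  · have : ∃ k, x.2 k ≠ y.2 k := by
      by_contra hcon
      push Not at hcon
      exact h (Prod.ext h1 (funext hcon))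
    classical
    have hmin : ∀ j < Nat.find this, x.2 j = y.2 j := fun j hj => by
      simpa using Nat.find_min this hj
    have hne := Nat.find_spec this
    cases hx : x.2 (Nat.find this) <;> cases hy : y.2 (Nat.find this)
    · simp_all
    · exact Or.inl (Or.inr ⟨h1, _, hmin, hx, hy⟩)
    · exact Or.inr (Or.inr ⟨h1.symm, _, fun j hj => (hmin j hj).symm, hy, hx⟩)
    · simp_all
  · exact Or.inr (Or.inl h1)

/-- Cones are convex for the planar order. -/
lemma PlanarLT.congr_left {x y z : Bdry} {n : ℕ} (h : Agree x y n) (hz : ¬ Agree x z n)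
    (hlt : PlanarLT x z) : PlanarLT y z := by
  rcases hlt with h1 | ⟨h1, k, hk, hx, hz'⟩
  · exact Or.inl (h.1 ▸ h1)
  · have hkn : k < n := by
      by_contra hcon
      exact hz ⟨h1, fun j hj => hk j (by omega)⟩
    exact Or.inr ⟨h.1.symm.trans h1, k, fun j hj => (h.2 j (hj.trans hkn)).symm.trans (hk j hj),
      (h.2 k hkn).symm.trans hx, hz'⟩

lemma PlanarLT.congr_right {x y z : Bdry} {n : ℕ} (h : Agree x y n) (hz : ¬ Agree x z n)
    (hlt : PlanarLT z x) : PlanarLT z y := by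
  have hne : z ≠ y := by rintro rfl; exact hz h
  rcases PlanarLT.total hne with h1 | h1
  · exact h1
  · have := PlanarLT.congr_left h.symm (fun h' => hz (h.trans h')) h1
    exact absurd (this.trans hlt) (PlanarLT.irrefl _)

/-- The cyclic order of the boundary. -/
def Cyc (x y z : Bdry) : Prop :=
  (PlanarLT x y ∧ PlanarLT y z) ∨ (PlanarLT y z ∧ PlanarLT z x) ∨ (PlanarLT z x ∧ PlanarLT x y)

lemma Cyc.rotate {x y z : Bdry} (h : Cyc x y z) : Cyc y z x := by
  unfold Cyc at *; tauto

lemma Cyc.ne {x y z : Bdry} (h : Cyc x y z) : x ≠ y := by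
  rintro rfl
  rcases h with ⟨h, -⟩ | ⟨h, h'⟩ | ⟨-, h⟩
  · exact PlanarLT.irrefl _ h
  · exact PlanarLT.irrefl _ (h.trans h')
  · exact PlanarLT.irrefl _ h

lemma Cyc.asymm {x y z : Bdry} (h : Cyc x y z) (h' : Cyc x z y) : False := by
  have key : ∀ a b, PlanarLT a b → PlanarLT b a → False :=
    fun a b h1 h2 => PlanarLT.irrefl _ (h1.trans h2)
  rcases h with ⟨h1, h2⟩ | ⟨h1, h2⟩ | ⟨h1, h2⟩ <;>
    rcases h' with ⟨h3, h4⟩ | ⟨h3, h4⟩ | ⟨h3, h4⟩ <;>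
    first
      | exact key _ _ h1 h3 | exact key _ _ h1 h4 | exact key _ _ h2 h3 | exact key _ _ h2 h4

lemma Cyc.total {x y z : Bdry} (hxy : x ≠ y) (hyz : y ≠ z) (hxz : x ≠ z) :
    Cyc x y z ∨ Cyc x z y := by
  unfold Cyc
  rcases PlanarLT.total hxy with h1 | h1 <;> rcases PlanarLT.total hyz with h2 | h2 <;>
    rcases PlanarLT.total hxz with h3 | h3 <;> tauto

/-- `g` acts on the cone of `x` at depth `n` through a planar isomorphism. -/
def IsPlanarAt (g : Equiv.Perm Bdry) (x : Bdry) (n m : ℕ) : Prop :=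
  ∀ y, Agree x y n → Agree (g x) (g y) m ∧ ∀ k, (g y).2 (m + k) = y.2 (n + k)

lemma IsPlanarAt.shift {g : Equiv.Perm Bdry} {x : Bdry} {n m : ℕ} (h : IsPlanarAt g x n m)
    (j : ℕ) : IsPlanarAt g x (n + j) (m + j) := by
  intro y hy
  obtain ⟨h1, h2⟩ := h y (hy.mono (by omega))
  have h3 := (h x (Agree.refl _ _)).2
  refine ⟨⟨h1.1, fun k hk => ?_⟩, fun k => by rw [add_assoc, add_assoc]; exact h2 _⟩
  by_cases hkm : k < m
  · exact h1.2 k hkm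
  · obtain ⟨i, rfl⟩ := Nat.exists_eq_add_of_le (not_lt.1 hkm)
    rw [h2, h3]
    exact hy.2 _ (by omega)

lemma IsPlanarAt.congr {g : Equiv.Perm Bdry} {x x' : Bdry} {n m : ℕ} (h : IsPlanarAt g x n m)
    (hx : Agree x x' n) : IsPlanarAt g x' n m :=
  fun y hy => ⟨(h x' hx).1.symm.trans (h y (hx.trans hy)).1, (h y (hx.trans hy)).2⟩

lemma IsPlanarAt.isTreeIsoAt {g : Equiv.Perm Bdry} {x : Bdry} {n m : ℕ}
    (h : IsPlanarAt g x n m) : IsTreeIsoAt g x n m := by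
  intro y z hy k
  -- an end of the target cone has the expected preimage
  have key : ∀ w, Agree (g x) w m → Agree x (g⁻¹ w) n := by
    intro w hw
    let v : Bdry := (x.1, fun k => if k < n then x.2 k else w.2 (m + (k - n)))
    have hv : Agree x v n := ⟨rfl, fun k hk => by simp [v, hk]⟩
    have : g v = w := by
      obtain ⟨h1, h2⟩ := h v hv
      refine Prod.ext (h1.1.symm.trans hw.1) (funext fun k => ?_)
      by_cases hkm : k < m
      · exact (h1.2 k hkm).symm.trans (hw.2 k hkm)
      · obtain ⟨i, rfl⟩ := Nat.exists_eq_add_of_le (not_lt.1 hkm)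
        rw [h2]; simp [v]
    rw [← this]; simpa using hv
  have hgy := h y hy
  constructor
  · intro hyz
    exact ((h.congr hy).shift k z hyz).1
  · intro hyz
    have hz : Agree x z n := by
      simpa using key (g z) (hgy.1.trans (hyz.mono (by omega)))
    have hgz := h z hz
    refine ⟨hy.1.symm.trans hz.1, fun i hi => ?_⟩
    by_cases hin : i < n
    · exact (hy.symm.trans hz).2 i hin
    · obtain ⟨j, rfl⟩ := Nat.exists_eq_add_of_le (not_lt.1 hin)
      rw [← hgy.2, ← hgz.2]
      exact hyz.2 _ (by omega)

lemma IsPlanarAt.comp {g h : Equiv.Perm Bdry} {x : Bdry} {n m p : ℕ}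
    (hg : IsPlanarAt g x n m) (hh : IsPlanarAt h (g x) m p) : IsPlanarAt (h * g) x n p :=
  fun y hy => ⟨(hh _ (hg y hy).1).1, fun k => ((hh _ (hg y hy).1).2 k).trans ((hg y hy).2 k)⟩

lemma IsPlanarAt.inv {g : Equiv.Perm Bdry} {x : Bdry} {n m : ℕ} (h : IsPlanarAt g x n m) :
    IsPlanarAt g⁻¹ (g x) m n := by
  intro y hy
  have h1 : Agree x (g⁻¹ y) n := (h.isTreeIsoAt.mem _).2 (by simpa using hy)
  refine ⟨by simpa using h1, fun k => ?_⟩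
  have := (h _ h1).2 k
  simpa using this.symm

lemma IsPlanarAt.lt {g : Equiv.Perm Bdry} {x y z : Bdry} {n m : ℕ} (h : IsPlanarAt g x n m)
    (hy : Agree x y n) (hz : Agree x z n) (hlt : PlanarLT y z) : PlanarLT (g y) (g z) := by
  have hyz := (h y hy).1.symm.trans (h z hz).1
  rcases hlt with h1 | ⟨h1, k, hk, hx, hz'⟩
  · exact absurd (hy.symm.trans hz).1 h1.ne
  · have hnk : n ≤ k := by
      by_contra hcon
      have := (hy.symm.trans hz).2 k (by omega)
      simp_all
    obtain ⟨j, rfl⟩ := Nat.exists_eq_add_of_le hnk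
    refine Or.inr ⟨hyz.1, m + j, fun i hi => ?_, ((h y hy).2 j).trans hx, ((h z hz).2 j).trans hz'⟩
    by_cases him : i < m
    · exact hyz.2 i him
    · obtain ⟨i, rfl⟩ := Nat.exists_eq_add_of_le (not_lt.1 him)
      rw [(h y hy).2, (h z hz).2]
      exact hk _ (by omega)

lemma self_mem_cone (x : Bdry) (n : ℕ) : x ∈ cone x n := Agree.refl x n

lemma cone_congr {x y : Bdry} {n : ℕ} (h : Agree x y n) : cone x n = cone y n :=
  Set.ext fun _ => ⟨fun hz => h.symm.trans hz, fun hz => h.trans hz⟩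

lemma half_eq_cone (x : Bdry) (n : ℕ) (b : Bool) :
    half x n b = cone (x.1, Function.update x.2 n b) (n + 1) := by
  ext y
  constructor
  · rintro ⟨⟨h1, h2⟩, h3⟩
    refine ⟨h1, fun k hk => ?_⟩
    rcases eq_or_ne k n with rfl | hkn
    · simpa using h3.symm
    · simpa [hkn] using h2 k (by omega)
  · rintro ⟨h1, h2⟩
    refine ⟨⟨h1, fun k hk => ?_⟩, ?_⟩
    · simpa [hk.ne] using h2 k (by omega)
    · simpa using (h2 n (by omega)).symm

lemma half_subset (x : Bdry) (n : ℕ) (b : Bool) : half x n b ⊆ cone x n := fun _ h => h.1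

lemma half_union (x : Bdry) (n : ℕ) (b : Bool) : half x n b ∪ half x n (!b) = cone x n := by
  ext y
  constructor
  · rintro (h | h) <;> exact h.1
  · intro h
    by_cases hb : y.2 n = b
    · exact Or.inl ⟨h, hb⟩
    · exact Or.inr ⟨h, by cases b <;> simp_all⟩

lemma half_disjoint (x : Bdry) (n : ℕ) (b : Bool) : Disjoint (half x n b) (half x n (!b)) := by
  rw [Set.disjoint_left]
  rintro y ⟨-, h⟩ ⟨-, h'⟩
  simp_all

lemma half_nonempty (x : Bdry) (n : ℕ) (b : Bool) : (half x n b).Nonempty := by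
  rw [half_eq_cone]; exact ⟨_, self_mem_cone _ _⟩

lemma Before.disjoint {U V : Set Bdry} (h : Before U V) : Disjoint U V :=
  Set.disjoint_left.2 fun x hx hx' => PlanarLT.irrefl x (h x hx x hx')

lemma before_half (x : Bdry) (n : ℕ) : Before (half x n false) (half x n true) := by
  rintro y ⟨hy, hy'⟩ z ⟨hz, hz'⟩
  exact Or.inr ⟨hy.1.symm.trans hz.1, n, fun j hj => (hy.symm.trans hz).2 j hj, hy', hz'⟩

/-- The leaves of the uniform tree with `3 * 2 ^ n` leaves, in the planar order. -/
lemma exists_uniform (n : ℕ) : ∃ l : List (Set Bdry), (∀ U ∈ l, ∃ x, U = cone x n) ∧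
    l.Pairwise Before ∧ ∀ x, ∃ U ∈ l, x ∈ U := by
  induction n with
  | zero =>
    refine ⟨[cone (0, fun _ => false) 0, cone (1, fun _ => false) 0, cone (2, fun _ => false) 0],
      ?_, ?_, ?_⟩
    · intro U hU
      simp only [List.mem_cons, List.not_mem_nil, or_false] at hU
      rcases hU with rfl | rfl | rfl <;> exact ⟨_, rfl⟩
    · have key : ∀ i j : Fin 3, i < j →
          Before (cone (i, fun _ => false) 0) (cone (j, fun _ => false) 0) :=
        fun i j hij x hx y hy => Or.inl (by rw [← hx.1, ← hy.1]; exact hij)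
      simp [key]
    · rintro ⟨i, f⟩
      refine ⟨cone (i, fun _ => false) 0, ?_, rfl, by simp⟩
      fin_cases i <;> simp
  | succ n ih =>
    obtain ⟨l, h1, h2, h3⟩ := ih
    have : ∀ U, ∃ x, U ∈ l → U = cone x n := fun U => by
      by_cases hU : U ∈ l
      · obtain ⟨x, hx⟩ := h1 U hU; exact ⟨x, fun _ => hx⟩
      · exact ⟨(0, fun _ => false), fun h => absurd h hU⟩
    choose r hr using this
    refine ⟨l.flatMap fun U => [half (r U) n false, half (r U) n true], ?_, ?_, ?_⟩
    · intro V hV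
      simp only [List.mem_flatMap, List.mem_cons, List.not_mem_nil, or_false] at hV
      obtain ⟨U, _, rfl | rfl⟩ := hV <;> exact ⟨_, half_eq_cone _ _ _⟩
    · rw [List.pairwise_flatMap]
      refine ⟨fun U _ => by simp [before_half], h2.imp_of_mem fun {U V} hU hV hUV => ?_⟩
      intro A hA B hB x hx y hy
      have hA' : A ⊆ U := by
        rw [hr U hU]
        simp only [List.mem_cons, List.not_mem_nil, or_false] at hA
        rcases hA with rfl | rfl <;> exact half_subset _ _ _
      have hB' : B ⊆ V := by
        rw [hr V hV]
        simp only [List.mem_cons, List.not_mem_nil, or_false] at hB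
        rcases hB with rfl | rfl <;> exact half_subset _ _ _
      exact hUV x (hA' hx) y (hB' hy)
    · intro x
      obtain ⟨U, hU, hx⟩ := h3 x
      have hx' := hx
      rw [hr U hU, ← half_union _ _ false] at hx'
      rcases hx' with h | h
      · exact ⟨_, List.mem_flatMap.2 ⟨U, hU, List.mem_cons_self⟩, h⟩
      · exact ⟨_, List.mem_flatMap.2 ⟨U, hU, List.mem_cons_of_mem _ List.mem_cons_self⟩, h⟩

lemma list_bound {P : Set Bdry → ℕ → Prop} : ∀ l : List (Set Bdry), (∀ U ∈ l, ∃ n, P U n) →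
    ∃ N, ∀ U ∈ l, ∃ n ≤ N, P U n
  | [], _ => ⟨0, by simp⟩
  | U :: l, h => by
    obtain ⟨N, hN⟩ := list_bound l fun V hV => h V (List.mem_cons_of_mem _ hV)
    obtain ⟨n, hn⟩ := h U List.mem_cons_self
    refine ⟨max n N, fun V hV => ?_⟩
    rcases List.mem_cons.1 hV with rfl | hV
    · exact ⟨n, le_max_left _ _, hn⟩
    · obtain ⟨k, hk, hk'⟩ := hN V hV
      exact ⟨k, hk.trans (le_max_right _ _), hk'⟩

lemma IsPlanarOn.exists_at {g : Equiv.Perm Bdry} {U V : Set Bdry} (h : IsPlanarOn g U V) :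
    ∃ n, ∀ x ∈ U, U = cone x n ∧ ∃ m, V = cone (g x) m ∧ IsPlanarAt g x n m := by
  obtain ⟨x, n, m, rfl, rfl, h⟩ := h
  refine ⟨n, fun y hy => ⟨cone_congr hy, m, cone_congr (h y hy).1, fun z hz => ?_⟩⟩
  exact ⟨(h y hy).1.symm.trans (h z (hy.trans hz)).1, (h z (hy.trans hz)).2⟩

/-- Local form of the elements of Thompson's group. -/
def IsCyclicPlanar (g : Equiv.Perm Bdry) : Prop :=
  (∃ n, ∀ x, ∃ m, IsPlanarAt g x n m) ∧ ∀ x y z, Cyc x y z → Cyc (g x) (g y) (g z)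

lemma IsThompsonT.isCyclicPlanar {g : Equiv.Perm Bdry} (h : IsThompsonT g) :
    IsCyclicPlanar g := by
  obtain ⟨l₀, l₁, hl₀, hb, hl₁, ⟨l', hrot, hb'⟩, hF⟩ := h
  rw [List.forall₂_iff_get] at hF
  obtain ⟨hlen, hF⟩ := hF
  simp only [List.get_eq_getElem] at hF
  have hidx : ∀ x, ∃ i, ∃ h : i < l₀.length, x ∈ l₀[i] := fun x => by
    obtain ⟨U, hU, hx⟩ := hl₀.cover x
    obtain ⟨i, hi, rfl⟩ := List.getElem_of_mem hU
    exact ⟨i, hi, hx⟩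
  constructor
  · obtain ⟨N, hN⟩ := list_bound (P := fun U n => ∀ x ∈ U, ∃ m, IsPlanarAt g x n m) l₀ (by
      intro U hU
      obtain ⟨i, hi, rfl⟩ := List.getElem_of_mem hU
      obtain ⟨n, hn⟩ := (hF i hi (hlen ▸ hi)).exists_at
      exact ⟨n, fun x hx => by obtain ⟨m, -, h⟩ := (hn x hx).2; exact ⟨m, h⟩⟩)
    refine ⟨N, fun x => ?_⟩
    obtain ⟨U, hU, hx⟩ := hl₀.cover x
    obtain ⟨n, hn, h⟩ := hN U hU
    obtain ⟨m, hm⟩ := h x hx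
    refine ⟨m + (N - n), ?_⟩
    have := hm.shift (N - n)
    rwa [Nat.add_sub_cancel' hn] at this
  · -- positions of the images in the planar order
    obtain ⟨c, hc, rfl⟩ := List.isRotated_iff_mod.1 hrot.symm
    have hlen' : l₀.length = l'.length := by simpa using hlen
    rw [← hlen'] at hc
    have F1 : ∀ i j (hi : i < l₀.length) (hj : j < l₀.length), i < j → ∀ x ∈ l₀[i], ∀ y ∈ l₀[j],
        PlanarLT x y := fun i j hi hj hij => List.pairwise_iff_getElem.1 hb i j hi hj hij
    have F2 : ∀ i (hi : i < l₀.length), ∀ x ∈ l₀[i],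
        ∃ h : (i + c) % l₀.length < l'.length, g x ∈ l'[(i + c) % l₀.length] := by
      intro i hi x hx
      have hlt : (i + c) % l₀.length < l'.length := hlen' ▸ Nat.mod_lt _ (by omega)
      refine ⟨hlt, ?_⟩
      obtain ⟨n, hn⟩ := (hF i hi (by rw [List.length_rotate]; omega)).exists_at
      obtain ⟨-, m, hm, -⟩ := hn x hx
      have : g x ∈ (l'.rotate c)[i]'(by rw [List.length_rotate]; omega) := by
        rw [hm]; exact self_mem_cone _ _
      rw [List.getElem_rotate] at this
      simpa only [hlen'] using this
    have F3 : ∀ i j (hi : i < l₀.length) (hj : j < l₀.length), ∀ x ∈ l₀[i], ∀ y ∈ l₀[j],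
        (i + c) % l₀.length < (j + c) % l₀.length → PlanarLT (g x) (g y) := by
      intro i j hi hj x hx y hy hij
      obtain ⟨h1, h1'⟩ := F2 i hi x hx
      obtain ⟨h2, h2'⟩ := F2 j hj y hy
      exact List.pairwise_iff_getElem.1 hb' _ _ h1 h2 hij _ h1' _ h2'
    have F4 : ∀ i (hi : i < l₀.length), ∀ x ∈ l₀[i], ∀ y ∈ l₀[i], PlanarLT x y →
        PlanarLT (g x) (g y) := by
      intro i hi x hx y hy hlt
      obtain ⟨n, hn⟩ := (hF i hi (by rw [List.length_rotate]; omega)).exists_at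
      obtain ⟨hU, m, -, hm⟩ := hn x hx
      rw [hU] at hy
      exact hm.lt (Agree.refl _ _) hy hlt
    have key : ∀ x y z, PlanarLT x y → PlanarLT y z → Cyc (g x) (g y) (g z) := by
      intro x y z hxy hyz
      obtain ⟨i, hi, hx⟩ := hidx x
      obtain ⟨j, hj, hy⟩ := hidx y
      obtain ⟨k, hk, hz⟩ := hidx z
      have hij : i ≤ j := by
        by_contra hcon
        exact PlanarLT.irrefl _ (hxy.trans (F1 j i hj hi (by omega) y hy x hx))
      have hjk : j ≤ k := by
        by_contra hcon
        exact PlanarLT.irrefl _ (hyz.trans (F1 k j hk hj (by omega) z hz y hy))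
      have hmod : ∀ a, a < l₀.length → (a + c) % l₀.length =
          if a + c < l₀.length then a + c else a + c - l₀.length := by
        intro a ha
        split_ifs with h
        · exact Nat.mod_eq_of_lt h
        · rw [Nat.mod_eq_sub_mod (by omega)]
          by_cases h2 : a + c - l₀.length < l₀.length
          · exact Nat.mod_eq_of_lt h2
          · omega
      have gxy := F3 i j hi hj x hx y hy
      have gyz := F3 j k hj hk y hy z hz
      have gzx := F3 k i hk hi z hz x hx
      rcases eq_or_lt_of_le hij with rfl | hij <;> rcases eq_or_lt_of_le hjk with rfl | hjk
      · exact Or.inl ⟨F4 i hi x hx y hy hxy, F4 i hi y hy z hz hyz⟩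
      · have h1 := F4 i hi x hx y hy hxy
        rw [hmod _ hi, hmod _ hk] at *
        by_cases h : (if i + c < l₀.length then i + c else i + c - l₀.length) <
          (if k + c < l₀.length then k + c else k + c - l₀.length)
        · exact Or.inl ⟨h1, gyz h⟩
        · exact Or.inr (Or.inr ⟨gzx (by split_ifs at * <;> omega), h1⟩)
      · have h1 := F4 j hj y hy z hz hyz
        rw [hmod _ hi, hmod _ hj] at *
        by_cases h : (if i + c < l₀.length then i + c else i + c - l₀.length) <
          (if j + c < l₀.length then j + c else j + c - l₀.length)
        · exact Or.inl ⟨gxy h, h1⟩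
        · exact Or.inr (Or.inl ⟨h1, gzx (by split_ifs at * <;> omega)⟩)
      · rw [hmod _ hi, hmod _ hj] at gxy
        rw [hmod _ hj, hmod _ hk] at gyz
        rw [hmod _ hk, hmod _ hi] at gzx
        by_cases h1 : i + c < l₀.length
        · by_cases h2 : j + c < l₀.length
          · by_cases h3 : k + c < l₀.length
            · exact Or.inl ⟨gxy (by split_ifs; omega), gyz (by split_ifs; omega)⟩
            · exact Or.inr (Or.inr ⟨gzx (by split_ifs; omega), gxy (by split_ifs; omega)⟩)
          · have h3 : ¬ k + c < l₀.length := by omega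
            exact Or.inr (Or.inl ⟨gyz (by split_ifs; omega), gzx (by split_ifs; omega)⟩)
        · exact Or.inl ⟨gxy (by split_ifs <;> omega), gyz (by split_ifs <;> omega)⟩
    intro x y z h
    rcases h with ⟨h1, h2⟩ | ⟨h1, h2⟩ | ⟨h1, h2⟩
    · exact key x y z h1 h2
    · exact (key y z x h1 h2).rotate.rotate
    · exact (key z x y h1 h2).rotate

lemma IsTreeIsoAt.image_cone {g : Equiv.Perm Bdry} {x : Bdry} {n m : ℕ}
    (h : IsTreeIsoAt g x n m) : g '' cone x n = cone (g x) m := by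
  ext y
  constructor
  · rintro ⟨z, hz, rfl⟩; exact (h.mem z).1 hz
  · intro hy
    exact ⟨g⁻¹ y, (h.mem _).2 (by have h2 : Agree (g x) y m := hy; simpa using h2), by simp⟩

lemma IsCyclicPlanar.isThompsonT {g : Equiv.Perm Bdry} (h : IsCyclicPlanar g) :
    IsThompsonT g := by
  obtain ⟨⟨n, hn⟩, hcyc⟩ := h
  obtain ⟨l, h1, h2, h3⟩ := exists_uniform n
  have hcone : ∀ U ∈ l, ∃ y k, g '' U = cone y k := by
    intro U hU
    obtain ⟨x, rfl⟩ := h1 U hU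
    obtain ⟨m, hm⟩ := hn x
    exact ⟨_, _, hm.isTreeIsoAt.image_cone⟩
  refine ⟨l, l.map (g '' ·), ⟨fun U hU => ?_, h2.imp Before.disjoint, h3⟩, h2, ⟨?_, ?_, ?_⟩, ?_, ?_⟩
  · obtain ⟨x, hx⟩ := h1 U hU; exact ⟨x, n, hx⟩
  · intro V hV
    obtain ⟨U, hU, rfl⟩ := List.mem_map.1 hV
    exact hcone U hU
  · rw [List.pairwise_map]
    exact h2.imp fun h => (Set.disjoint_image_iff g.injective).2 h.disjoint
  · intro x
    obtain ⟨U, hU, hx⟩ := h3 (g⁻¹ x)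
    exact ⟨g '' U, List.mem_map.2 ⟨U, hU, rfl⟩, _, hx, by simp⟩
  · let x₀ : Bdry := (0, fun _ => false)
    have hx₀ : ∀ y, y ≠ x₀ → PlanarLT x₀ y := by
      intro y hy
      rcases PlanarLT.total hy with (h | ⟨-, k, -, -, h⟩) | h
      · exact absurd h (by simp [x₀])
      · exact absurd h (by simp [x₀])
      · exact h
    obtain ⟨U, hU, hU₀⟩ := h3 (g⁻¹ x₀)
    obtain ⟨p, q, rfl⟩ := List.append_of_mem hU
    refine ⟨((U :: q) ++ p).map (g '' ·), (List.isRotated_append).map _, ?_⟩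
    obtain ⟨yU, kU, hyU⟩ := hcone U hU
    have first : ∀ V, Disjoint U V → Before (g '' U) (g '' V) := by
      intro V hV a ha b hb
      have hdis : Disjoint (g '' U) (g '' V) := (Set.disjoint_image_iff g.injective).2 hV
      have hbU : b ∉ g '' U := fun h => Set.disjoint_left.1 hdis h hb
      have hx₀U : x₀ ∈ g '' U := ⟨_, hU₀, by simp⟩
      have hne : b ≠ x₀ := by rintro rfl; exact hbU hx₀U
      rw [hyU] at hx₀U ha hbU
      exact PlanarLT.congr_left (Agree.trans (Agree.symm hx₀U) ha) (fun h => hbU (Agree.trans hx₀U h))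
        (hx₀ b hne)
    have other : ∀ V W, Disjoint U V → Disjoint U W →
        (∀ v ∈ V, ∀ w ∈ W, Cyc (g⁻¹ x₀) v w) → Before (g '' V) (g '' W) := by
      rintro V W hV hW hc a ⟨v, hv, rfl⟩ b ⟨w, hw, rfl⟩
      have hc' := hcyc _ _ _ (hc v hv w hw)
      have e : g (g⁻¹ x₀) = x₀ := by simp
      rw [e] at hc'
      have hav := first V hV x₀ ⟨_, hU₀, e⟩ (g v) ⟨v, hv, rfl⟩
      have haw := first W hW x₀ ⟨_, hU₀, e⟩ (g w) ⟨w, hw, rfl⟩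
      rcases hc' with ⟨-, h⟩ | ⟨h, -⟩ | ⟨h, -⟩
      · exact h
      · exact h
      · exact absurd (haw.trans h) (PlanarLT.irrefl _)
    rw [List.pairwise_append, List.pairwise_cons] at h2
    obtain ⟨hp, ⟨hUq, hq⟩, hpq⟩ := h2
    have hpU : ∀ V ∈ p, Before V U := fun V hV => hpq V hV U List.mem_cons_self
    have dq : ∀ V ∈ q, Disjoint U V := fun V hV => (hUq V hV).disjoint
    have dp : ∀ V ∈ p, Disjoint U V := fun V hV => (hpU V hV).disjoint.symm
    rw [List.pairwise_map, List.pairwise_append, List.pairwise_cons]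
    refine ⟨⟨fun V hV => first V (dq V hV), hq.imp_of_mem fun {V W} hV hW hVW => ?_⟩,
      hp.imp_of_mem fun {V W} hV hW hVW => ?_, fun V hV W hW => ?_⟩
    · exact other V W (dq V hV) (dq W hW) fun v hv w hw =>
        Or.inl ⟨hUq V hV _ hU₀ v hv, hVW v hv w hw⟩
    · exact other V W (dp V hV) (dp W hW) fun v hv w hw =>
        Or.inr (Or.inl ⟨hVW v hv w hw, hpU W hW w hw _ hU₀⟩)
    · rcases List.mem_cons.1 hV with rfl | hV
      · exact first W (dp W hW)
      · exact other V W (dq V hV) (dp W hW) fun v hv w hw =>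
          Or.inr (Or.inr ⟨hpU W hW w hw _ hU₀, hUq V hV _ hU₀ v hv⟩)
  · rw [List.forall₂_map_right_iff, List.forall₂_same]
    intro U hU
    obtain ⟨x, rfl⟩ := h1 U hU
    obtain ⟨m, hm⟩ := hn x
    refine ⟨x, n, m, rfl, hm.isTreeIsoAt.image_cone, fun y hy => ⟨⟨y, hy, rfl⟩, (hm y hy).2⟩⟩

lemma isThompsonT_iff (g : Equiv.Perm Bdry) : IsThompsonT g ↔ IsCyclicPlanar g :=
  ⟨IsThompsonT.isCyclicPlanar, IsCyclicPlanar.isThompsonT⟩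

/-- Thompson's group `𝒯`, as a subgroup of `𝒩`. -/
def ThompsonT : Subgroup Neretin where
  carrier := {g | IsThompsonT g}
  one_mem' := by
    rw [Set.mem_ofPred_eq, isThompsonT_iff]
    exact ⟨⟨0, fun x => ⟨0, fun y hy => ⟨hy, fun k => rfl⟩⟩⟩, fun x y z h => h⟩
  mul_mem' := by
    intro h g hh hg
    rw [Set.mem_ofPred_eq, isThompsonT_iff] at *
    obtain ⟨⟨n', hh⟩, ch⟩ := hh
    obtain ⟨⟨n, hg⟩, cg⟩ := hg
    refine ⟨⟨n + n', fun x => ?_⟩, fun x y z hc => ch _ _ _ (cg _ _ _ hc)⟩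
    obtain ⟨m, hm⟩ := hg x
    obtain ⟨m', hm'⟩ := hh ((g : Equiv.Perm Bdry) x)
    refine ⟨m' + m, (hm.shift n').comp ?_⟩
    have := hm'.shift m
    rwa [add_comm n' m] at this
  inv_mem' := by
    intro g hg
    rw [Set.mem_ofPred_eq, isThompsonT_iff] at *
    obtain ⟨⟨n, hg⟩, cg⟩ := hg
    constructor
    · obtain ⟨M, hM⟩ := exists_bound n (IsPlanarAt g · n ·) (fun x x' m hx h => h.congr hx) hg
      refine ⟨M, fun y => ?_⟩
      obtain ⟨m, hm, h⟩ := hM ((g : Equiv.Perm Bdry)⁻¹ y)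
      refine ⟨n + (M - m), ?_⟩
      have := h.inv.shift (M - m)
      rw [Nat.add_sub_cancel' hm] at this
      simpa using this
    · intro x y z hc
      have inj := ((g : Equiv.Perm Bdry)⁻¹).injective
      rcases Cyc.total (inj.ne hc.ne) (inj.ne hc.rotate.ne) (inj.ne hc.rotate.rotate.ne.symm)
        with h | h
      · exact h
      · have := cg _ _ _ h
        exact (hc.asymm (by simpa using this)).elim

/-! ### Planar trees and strata of the tower -/

/-- The set of ends lying beyond the leaves in the list `l`. -/
def support (l : List (Set Bdry)) : Set Bdry := {x | ∃ U ∈ l, x ∈ U}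

/-- A label of a stratum of the tower: a planar unrooted tree `T` with all inner vertices of valence
at least three, the leaves of which are labelled bijectively by the leaves of a finite dyadic tree
`α` containing the central vertex (for `α` uniform with `3 * 2 ^ n` leaves this labels a stratum of
the moduli space of stable real curves with `3 * 2 ^ n` marked points).

* `leaves` is the list of the labels in the cyclic order of the plane, starting anywhere.
* `edges` records the inner edges. Removing an inner edge cuts `T` into two parts; the labels of the
  leaves of each part are consecutive in the cyclic order, and both parts have at least two
  leaves. The edge is recorded by the two complementary sets of ends beyond these leaves. A
  collection of such cuts comes from a planar tree iff it is nested (any two of its members do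
  not cross), and then the tree is determined by it. -/
@[ext]
structure PlanarTree where
  leaves : List (Set Bdry)
  edges : Set (Set Bdry)
  isLeafList : IsLeafList leaves
  arc : ∀ S ∈ edges, ∃ l₁ l₂, List.IsRotated leaves (l₁ ++ l₂) ∧ 2 ≤ l₁.length ∧ 2 ≤ l₂.length ∧
    S = support l₁
  compl_mem : ∀ S ∈ edges, Sᶜ ∈ edges
  nested : ∀ S ∈ edges, ∀ S' ∈ edges, Disjoint S S' ∨ S ⊆ S' ∨ S' ⊆ S ∨ S ∪ S' = Set.univ

/-- Moves between labels of one and the same stratum over a fixed leaf set: the list of leaves may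
start at another leaf; the whole tree may be reflected; and either of the two parts into which
an inner edge cuts the tree may be reflected, the other part being kept. -/
inductive Move : PlanarTree → PlanarTree → Prop
  | rotate (T T' : PlanarTree) : T'.edges = T.edges → List.IsRotated T.leaves T'.leaves → Move T T'
  | mirror (T T' : PlanarTree) : T'.edges = T.edges → T'.leaves = T.leaves.reverse → Move T T'
  | flip (T T' : PlanarTree) (l₀ l₁ l₂ : List (Set Bdry)) : T'.edges = T.edges →
      T.leaves = l₀ ++ l₁ ++ l₂ → support l₁ ∈ T.edges → T'.leaves = l₀ ++ l₁.reverse ++ l₂ →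
      Move T T'

lemma support_append (l l' : List (Set Bdry)) : support (l ++ l') = support l ∪ support l' := by
  ext x
  simp only [support, List.mem_append, Set.mem_ofPred_eq, Set.mem_union]
  constructor
  · rintro ⟨U, h | h, hx⟩
    · exact Or.inl ⟨U, h, hx⟩
    · exact Or.inr ⟨U, h, hx⟩
  · rintro (⟨U, h, hx⟩ | ⟨U, h, hx⟩)
    · exact ⟨U, Or.inl h, hx⟩
    · exact ⟨U, Or.inr h, hx⟩

lemma support_reverse (l : List (Set Bdry)) : support l.reverse = support l := by
  simp [support]

lemma support_image (g : Equiv.Perm Bdry) (l : List (Set Bdry)) :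
    support (l.map (g '' ·)) = g '' support l := by
  ext y
  constructor
  · rintro ⟨V, hV, hy⟩
    obtain ⟨U, hU, rfl⟩ := List.mem_map.1 hV
    obtain ⟨x, hx, rfl⟩ := hy
    exact ⟨x, ⟨U, hU, hx⟩, rfl⟩
  · rintro ⟨x, ⟨U, hU, hx⟩, rfl⟩
    exact ⟨_, List.mem_map.2 ⟨U, hU, rfl⟩, x, hx, rfl⟩

lemma IsLeafList.perm {l l' : List (Set Bdry)} (h : IsLeafList l) (hp : l.Perm l') :
    IsLeafList l' where
  isCone U hU := h.isCone U (hp.mem_iff.2 hU)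
  disj := (hp.pairwise_iff fun h => Disjoint.symm h).1 h.disj
  cover x := by
    obtain ⟨U, hU, hx⟩ := h.cover x
    exact ⟨U, hp.mem_iff.1 hU, hx⟩

lemma IsLeafList.nonempty {l : List (Set Bdry)} (h : IsLeafList l) {U : Set Bdry} (hU : U ∈ l) :
    U.Nonempty := by
  obtain ⟨x, n, rfl⟩ := h.isCone U hU
  exact ⟨x, self_mem_cone x n⟩

lemma IsLeafList.eq_of_mem {l : List (Set Bdry)} (h : IsLeafList l) {U V : Set Bdry} (hU : U ∈ l)
    (hV : V ∈ l) {x : Bdry} (hxU : x ∈ U) (hxV : x ∈ V) : U = V := by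
  by_contra hne
  have : Std.Symm (Disjoint (α := Set Bdry)) := ⟨fun _ _ h => Disjoint.symm h⟩
  exact Set.disjoint_left.1 (h.disj.forall hU hV hne) hxU hxV

lemma IsLeafList.nodup {l : List (Set Bdry)} (h : IsLeafList l) : l.Nodup :=
  h.disj.imp_of_mem fun {U V} hU _ hUV => by
    rintro rfl
    obtain ⟨x, hx⟩ := h.nonempty hU
    exact Set.disjoint_left.1 hUV hx hx

lemma IsLeafList.three_le {l : List (Set Bdry)} (h : IsLeafList l) : 3 ≤ l.length := by
  choose f hf hx using fun i : Fin 3 => h.cover (i, fun _ => false)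
  have hinj : Function.Injective f := by
    intro i j hij
    obtain ⟨x, n, hxn⟩ := h.isCone _ (hf i)
    have h1 := hx i
    have h2 := hx j
    rw [← hij, hxn] at h2
    rw [hxn] at h1
    exact h1.1.symm.trans h2.1
  classical
  have : (Finset.univ.image f).card ≤ l.toFinset.card :=
    Finset.card_le_card fun U hU => by
      obtain ⟨i, -, rfl⟩ := Finset.mem_image.1 hU
      exact List.mem_toFinset.2 (hf i)
  rw [Finset.card_image_of_injective _ hinj, Finset.card_univ, Fintype.card_fin] at this
  exact this.trans (List.toFinset_card_le l)

/-- A leaf list cut in two parts cuts the boundary in two parts. -/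
lemma IsLeafList.support_compl {l₁ l₂ : List (Set Bdry)} (h : IsLeafList (l₁ ++ l₂)) :
    (support l₁)ᶜ = support l₂ := by
  ext x
  obtain ⟨U, hU, hx⟩ := h.cover x
  constructor
  · intro hx'
    rcases List.mem_append.1 hU with hU | hU
    · exact absurd ⟨U, hU, hx⟩ hx'
    · exact ⟨U, hU, hx⟩
  · rintro ⟨V, hV, hxV⟩ ⟨W, hW, hxW⟩
    exact Set.disjoint_left.1 ((List.pairwise_append.1 h.disj).2.2 W hW V hV) hxW hxV

open Classical in
/-- Replace the leaf `cone x n` by its two halves, the half `b` coming first. -/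
noncomputable def splitLeaf (x : Bdry) (n : ℕ) (b : Bool) (U : Set Bdry) : List (Set Bdry) :=
  if U = cone x n then [half x n b, half x n (!b)] else [U]

lemma splitLeaf_self (x : Bdry) (n : ℕ) (b : Bool) :
    splitLeaf x n b (cone x n) = [half x n b, half x n (!b)] := by
  simp [splitLeaf]

lemma splitLeaf_ne {x : Bdry} {n : ℕ} {b : Bool} {U : Set Bdry} (h : U ≠ cone x n) :
    splitLeaf x n b U = [U] := by
  simp [splitLeaf, h]

lemma support_splitLeaf (x : Bdry) (n : ℕ) (b : Bool) (U : Set Bdry) :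
    support (splitLeaf x n b U) = U := by
  by_cases h : U = cone x n
  · rw [h, splitLeaf_self]
    conv_rhs => rw [← half_union x n b]
    ext y; simp [support]
  · rw [splitLeaf_ne h]; ext y; simp [support]

lemma subset_of_mem_splitLeaf {x : Bdry} {n : ℕ} {b : Bool} {U V : Set Bdry}
    (h : V ∈ splitLeaf x n b U) : V ⊆ U := by
  intro y hy
  rw [← support_splitLeaf x n b U]
  exact ⟨V, h, hy⟩

lemma support_flatMap (x : Bdry) (n : ℕ) (b : Bool) (l : List (Set Bdry)) :
    support (l.flatMap (splitLeaf x n b)) = support l := by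
  ext y
  constructor
  · rintro ⟨V, hV, hy⟩
    obtain ⟨U, hU, hVU⟩ := List.mem_flatMap.1 hV
    exact ⟨U, hU, subset_of_mem_splitLeaf hVU hy⟩
  · rintro ⟨U, hU, hy⟩
    rw [← support_splitLeaf x n b U] at hy
    obtain ⟨V, hV, hy⟩ := hy
    exact ⟨V, List.mem_flatMap.2 ⟨U, hU, hV⟩, hy⟩

lemma one_le_splitLeaf (x : Bdry) (n : ℕ) (b : Bool) (U : Set Bdry) :
    1 ≤ (splitLeaf x n b U).length := by
  unfold splitLeaf; split_ifs <;> simp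

lemma length_le_flatMap (x : Bdry) (n : ℕ) (b : Bool) (l : List (Set Bdry)) :
    l.length ≤ (l.flatMap (splitLeaf x n b)).length := by
  induction l with
  | nil => simp
  | cons U l ih =>
    have := one_le_splitLeaf x n b U
    simp only [List.flatMap_cons, List.length_append, List.length_cons]
    omega

lemma isRotated_flatMap {α β : Type*} {l l' : List α} (f : α → List β) (h : List.IsRotated l l') :
    List.IsRotated (l.flatMap f) (l'.flatMap f) := by
  obtain ⟨k, hk, rfl⟩ := List.isRotated_iff_mod.1 h
  rw [List.rotate_eq_drop_append_take hk]
  conv_lhs => rw [← List.take_append_drop k l]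
  rw [List.flatMap_append, List.flatMap_append]
  exact List.isRotated_append

lemma flatMap_splitLeaf_of_notMem {x : Bdry} {n : ℕ} {b : Bool} {l : List (Set Bdry)}
    (h : cone x n ∉ l) : l.flatMap (splitLeaf x n b) = l := by
  induction l with
  | nil => simp
  | cons U l ih =>
    simp only [List.mem_cons, not_or] at h
    rw [List.flatMap_cons, splitLeaf_ne (Ne.symm h.1), ih h.2]
    rfl

lemma flatMap_splitLeaf_of_nodup {x : Bdry} {n : ℕ} {b : Bool} {p q : List (Set Bdry)}
    (h : (p ++ cone x n :: q).Nodup) :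
    (p ++ cone x n :: q).flatMap (splitLeaf x n b) = p ++ [half x n b, half x n (!b)] ++ q := by
  have h' := List.nodup_middle.1 h
  rw [List.nodup_cons, List.mem_append, not_or] at h'
  rw [List.flatMap_append, List.flatMap_cons, splitLeaf_self,
    flatMap_splitLeaf_of_notMem h'.1.1, flatMap_splitLeaf_of_notMem h'.1.2]
  simp

namespace PlanarTree

lemma mem_edges_cases (T : PlanarTree) {S : Set Bdry} (hS : S ∈ T.edges) {U : Set Bdry}
    (hU : U ∈ T.leaves) : U ⊆ S ∨ U ⊆ Sᶜ := by
  obtain ⟨l₁, l₂, hr, -, -, rfl⟩ := T.arc S hS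
  rw [(T.isLeafList.perm hr.perm).support_compl]
  rcases List.mem_append.1 (hr.mem_iff.1 hU) with h | h
  · exact Or.inl fun y hy => ⟨U, h, hy⟩
  · exact Or.inr fun y hy => ⟨U, h, hy⟩

/-- Expansion of the tree `T` at the leaf labelled by `cone x n`: the leaf becomes an inner vertex
with two new leaves, labelled by the two halves of the cone, in the planar order if `b = false`. -/
noncomputable def expand (T : PlanarTree) (x : Bdry) (n : ℕ) (b : Bool) (h : cone x n ∈ T.leaves) :
    PlanarTree where
  leaves := T.leaves.flatMap (splitLeaf x n b)
  edges := T.edges ∪ {cone x n, (cone x n)ᶜ}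
  isLeafList :=
    { isCone := fun V hV => by
        obtain ⟨U, hU, hV⟩ := List.mem_flatMap.1 hV
        by_cases hUx : U = cone x n
        · rw [hUx, splitLeaf_self] at hV
          simp only [List.mem_cons, List.not_mem_nil, or_false] at hV
          rcases hV with rfl | rfl <;> exact ⟨_, _, half_eq_cone _ _ _⟩
        · rw [splitLeaf_ne hUx, List.mem_singleton] at hV
          exact hV ▸ T.isLeafList.isCone U hU
      disj := by
        rw [List.pairwise_flatMap]
        refine ⟨fun U _ => ?_, T.isLeafList.disj.imp fun {U V} hUV A hA B hB => ?_⟩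
        · unfold splitLeaf
          split_ifs
          · simp [half_disjoint]
          · simp
        · exact hUV.mono (subset_of_mem_splitLeaf hA) (subset_of_mem_splitLeaf hB)
      cover := fun y => by
        have : y ∈ support (T.leaves.flatMap (splitLeaf x n b)) := by
          rw [support_flatMap]; exact T.isLeafList.cover y
        exact this }
  arc := by
    rintro S (hS | hS)
    · obtain ⟨l₁, l₂, hr, h1, h2, rfl⟩ := T.arc S hS
      refine ⟨l₁.flatMap (splitLeaf x n b), l₂.flatMap (splitLeaf x n b), ?_,
        h1.trans (length_le_flatMap _ _ _ _), h2.trans (length_le_flatMap _ _ _ _),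
        (support_flatMap _ _ _ _).symm⟩
      rw [← List.flatMap_append]
      exact isRotated_flatMap _ hr
    · obtain ⟨p, q, hpq⟩ := List.append_of_mem h
      have hr : List.IsRotated T.leaves ([cone x n] ++ (q ++ p)) := by
        rw [hpq]; exact List.isRotated_append
      have hlen : 2 ≤ (q ++ p).length := by
        have := T.isLeafList.three_le
        rw [hr.perm.length_eq] at this
        simp only [List.length_append, List.length_singleton] at this ⊢
        omega
      have hr' := isRotated_flatMap (splitLeaf x n b) hr
      rw [List.flatMap_append] at hr'
      have hs : support [cone x n] = cone x n := by ext; simp [support]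
      rcases hS with rfl | hS
      · refine ⟨_, _, hr', ?_, hlen.trans (length_le_flatMap _ _ _ _), ?_⟩
        · simp [splitLeaf_self]
        · rw [support_flatMap, hs]
      · refine ⟨_, _, hr'.trans List.isRotated_append, hlen.trans (length_le_flatMap _ _ _ _),
          ?_, ?_⟩
        · simp [splitLeaf_self]
        · rw [support_flatMap, ← (T.isLeafList.perm hr.perm).support_compl, hs]
          exact hS
  compl_mem := by
    rintro S (hS | rfl | rfl)
    · exact Or.inl (T.compl_mem S hS)
    · exact Or.inr (Or.inr rfl)
    · exact Or.inr (Or.inl (compl_compl _))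
  nested := by
    have key : ∀ S ∈ T.edges, Disjoint S (cone x n) ∨ cone x n ⊆ S := by
      intro S hS
      rcases T.mem_edges_cases hS h with h | h
      · exact Or.inr h
      · exact Or.inl (Set.disjoint_left.2 fun y hy hy' => h hy' hy)
    have key' : ∀ S ∈ T.edges, S ⊆ (cone x n)ᶜ ∨ S ∪ (cone x n)ᶜ = Set.univ := by
      intro S hS
      rcases key S hS with h | h
      · exact Or.inl (Set.subset_compl_iff_disjoint_right.2 h)
      · refine Or.inr (Set.eq_univ_of_forall fun y => ?_)
        by_cases hy : y ∈ cone x n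
        · exact Or.inl (h hy)
        · exact Or.inr hy
    rintro S (hS | rfl | rfl) S' (hS' | rfl | rfl)
    · exact T.nested S hS S' hS'
    · rcases key S hS with h | h <;> tauto
    · rcases key' S hS with h | h <;> tauto
    · rcases key S' hS' with h | h
      · exact Or.inl h.symm
      · tauto
    · exact Or.inr (Or.inl subset_rfl)
    · exact Or.inr (Or.inr (Or.inr (Set.union_compl_self _)))
    · rcases key' S' hS' with h | h
      · tauto
      · rw [Set.union_comm] at h; tauto
    · exact Or.inr (Or.inr (Or.inr (Set.compl_union_self _)))
    · exact Or.inr (Or.inl subset_rfl)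

/-- `g` carries each leaf of `T` to a cone through an isomorphism of the rooted trees below. -/
def Good (g : Equiv.Perm Bdry) (T : PlanarTree) : Prop :=
  ∀ U ∈ T.leaves, ∃ x n m, U = cone x n ∧ IsTreeIsoAt g x n m

/-- Composition of the symbol of `g` with the label `T`: each leaf label `U` is replaced
by its image under `g`. -/
def relabel (g : Equiv.Perm Bdry) (T : PlanarTree) (h : Good g T) : PlanarTree where
  leaves := T.leaves.map (g '' ·)
  edges := (g '' ·) '' T.edges
  isLeafList :=
    { isCone := fun V hV => by
        obtain ⟨U, hU, rfl⟩ := List.mem_map.1 hV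
        obtain ⟨x, n, m, rfl, hm⟩ := h U hU
        exact ⟨g x, m, hm.image_cone⟩
      disj := by
        rw [List.pairwise_map]
        exact T.isLeafList.disj.imp fun h => (Set.disjoint_image_iff g.injective).2 h
      cover := fun y => by
        obtain ⟨U, hU, hx⟩ := T.isLeafList.cover (g⁻¹ y)
        exact ⟨g '' U, List.mem_map.2 ⟨U, hU, rfl⟩, _, hx, by simp⟩ }
  arc := by
    rintro _ ⟨S, hS, rfl⟩
    obtain ⟨l₁, l₂, hr, h1, h2, rfl⟩ := T.arc S hS
    refine ⟨l₁.map (g '' ·), l₂.map (g '' ·), ?_, by simpa using h1, by simpa using h2,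
      (support_image g l₁).symm⟩
    rw [← List.map_append]
    exact hr.map _
  compl_mem := by
    rintro _ ⟨S, hS, rfl⟩
    exact ⟨Sᶜ, T.compl_mem S hS, Set.image_compl_eq g.bijective⟩
  nested := by
    rintro _ ⟨S, hS, rfl⟩ _ ⟨S', hS', rfl⟩
    rcases T.nested S hS S' hS' with h | h | h | h
    · exact Or.inl ((Set.disjoint_image_iff g.injective).2 h)
    · exact Or.inr (Or.inl (Set.image_mono h))
    · exact Or.inr (Or.inr (Or.inl (Set.image_mono h)))
    · exact Or.inr (Or.inr (Or.inr (by
        rw [← Set.image_union, h, Set.image_univ, g.surjective.range_eq])))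

end PlanarTree

open PlanarTree

/-- `T'` arises from `T` by a dyadic expansion of one leaf. -/
def Expansion (T T' : PlanarTree) : Prop := ∃ x n h, T' = T.expand x n false h

/-- `T` and `T'` label the same stratum, either by a move at a finite stage of the tower or because
they correspond to each other under an embedding of the inductive system. -/
def Identified (T T' : PlanarTree) : Prop := Move T T' ∨ Expansion T T'

/-- The strata of the cyclic tower: labels up to the equivalence relation generated by moves and
dyadic expansions. -/
def Stratum : Type := Quot Identified

/-- The stratum labelled by `T`. -/
def Stratum.mk (T : PlanarTree) : Stratum := Quot.mk Identified T

/-! ### The action of the Neretin group on the strata -/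

lemma mk_eq_of_move {T T' : PlanarTree} (h : Move T T') : Stratum.mk T = Stratum.mk T' :=
  Quot.sound (r := Identified) (Or.inl h)

lemma mk_expand (T : PlanarTree) (x : Bdry) (n : ℕ) (h : cone x n ∈ T.leaves) :
    Stratum.mk (T.expand x n false h) = Stratum.mk T := by
  have hs : Identified T (T.expand x n false h) := Or.inr ⟨x, n, h, rfl⟩
  exact (Quot.sound hs).symm

lemma mk_eq_of_moves {T T' : PlanarTree} (h : Relation.EqvGen Move T T') :
    Stratum.mk T = Stratum.mk T' := by
  induction h with
  | rel _ _ h => exact mk_eq_of_move h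
  | refl _ => rfl
  | symm _ _ _ ih => exact ih.symm
  | trans _ _ _ _ _ h1 h2 => exact h1.trans h2

lemma cone_eq_cone {x y : Bdry} {n m : ℕ} (h : cone x n = cone y m) : n = m ∧ Agree x y n := by
  have key : ∀ {x y : Bdry} {n m : ℕ}, cone x n = cone y m → ¬ n < m := by
    intro x y n m h hlt
    have hx : Agree y x m := by
      have : x ∈ cone y m := h ▸ self_mem_cone x n
      exact this
    have h1 : ((x.1, Function.update x.2 n (!(x.2 n))) : Bdry) ∈ cone x n :=
      ⟨rfl, fun k hk => by simp [hk.ne]⟩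
    rw [h] at h1
    have := (hx.symm.trans h1).2 n hlt
    simp at this
  have hnm : n = m := le_antisymm (not_lt.1 (key h.symm)) (not_lt.1 (key h))
  refine ⟨hnm, ?_⟩
  have : y ∈ cone x n := h ▸ self_mem_cone y m
  exact this

lemma half_congr {x y : Bdry} {n : ℕ} (h : Agree x y n) (b : Bool) : half x n b = half y n b :=
  Set.ext fun _ => ⟨fun hz => ⟨h.symm.trans hz.1, hz.2⟩, fun hz => ⟨h.trans hz.1, hz.2⟩⟩

lemma half_ne_cone (x : Bdry) (n : ℕ) (b : Bool) : half x n b ≠ cone x n := by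
  rw [half_eq_cone]
  intro h
  have := (cone_eq_cone h).1
  omega

namespace PlanarTree

lemma expand_congr (T : PlanarTree) {x y : Bdry} {n m : ℕ} (b : Bool) (h : cone x n ∈ T.leaves)
    (hxy : cone x n = cone y m) : T.expand x n b h = T.expand y m b (hxy ▸ h) := by
  obtain ⟨rfl, ha⟩ := cone_eq_cone hxy
  have : splitLeaf x n b = splitLeaf y n b := by
    funext U
    unfold splitLeaf
    rw [hxy, half_congr ha, half_congr ha]
  apply PlanarTree.ext
  · simp only [expand, this]
  · simp only [expand, hxy]

lemma mem_expand_of_ne (T : PlanarTree) {x : Bdry} {n : ℕ} {b : Bool} (h : cone x n ∈ T.leaves)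
    {U : Set Bdry} (hU : U ∈ T.leaves) (hne : U ≠ cone x n) : U ∈ (T.expand x n b h).leaves :=
  List.mem_flatMap.2 ⟨U, hU, by rw [splitLeaf_ne hne]; exact List.mem_singleton_self _⟩

lemma mem_expand (T : PlanarTree) {x : Bdry} {n : ℕ} {b : Bool} (h : cone x n ∈ T.leaves)
    {U : Set Bdry} (hU : U ∈ (T.expand x n b h).leaves) :
    (U ∈ T.leaves ∧ U ≠ cone x n) ∨ ∃ c, U = half x n c := by
  obtain ⟨V, hV, hUV⟩ := List.mem_flatMap.1 hU
  by_cases hVx : V = cone x n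
  · rw [hVx, splitLeaf_self] at hUV
    simp only [List.mem_cons, List.not_mem_nil, or_false] at hUV
    rcases hUV with rfl | rfl
    · exact Or.inr ⟨_, rfl⟩
    · exact Or.inr ⟨_, rfl⟩
  · rw [splitLeaf_ne hVx, List.mem_singleton] at hUV
    subst hUV
    exact Or.inl ⟨hV, hVx⟩

lemma expand_comm (T : PlanarTree) {x y : Bdry} {n m : ℕ} (b c : Bool) (hx : cone x n ∈ T.leaves)
    (hy : cone y m ∈ T.leaves) (hne : cone x n ≠ cone y m) :
    (T.expand x n b hx).expand y m c (T.mem_expand_of_ne hx hy hne.symm) =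
      (T.expand y m c hy).expand x n b (T.mem_expand_of_ne hy hx hne) := by
  have hdis : Disjoint (cone x n) (cone y m) := by
    rw [Set.disjoint_left]
    intro z hz hz'
    exact hne (T.isLeafList.eq_of_mem hx hy hz hz')
  have key : ∀ {x y : Bdry} {n m : ℕ} (b : Bool), Disjoint (cone x n) (cone y m) →
      half x n b ≠ cone y m := by
    intro x y n m b hd he
    obtain ⟨z, hz⟩ := half_nonempty x n b
    exact Set.disjoint_left.1 hd (half_subset x n b hz) (he ▸ hz)
  apply PlanarTree.ext
  · simp only [expand]
    rw [List.flatMap_assoc, List.flatMap_assoc]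
    refine List.flatMap_congr fun U _ => ?_
    by_cases h1 : U = cone x n
    · subst h1
      rw [splitLeaf_self, splitLeaf_ne hne]
      simp [splitLeaf_self, splitLeaf_ne (key _ hdis)]
    · by_cases h2 : U = cone y m
      · subst h2
        rw [splitLeaf_self, splitLeaf_ne h1]
        simp [splitLeaf_self, splitLeaf_ne (key _ hdis.symm)]
      · simp [splitLeaf_ne h1, splitLeaf_ne h2]
  · simp only [expand]
    rw [Set.union_assoc, Set.union_assoc, Set.union_comm {cone x n, _}]

/-- The two ways of expanding a leaf differ by a reflection at the new vertex. -/
lemma expand_flip (T : PlanarTree) (x : Bdry) (n : ℕ) (b : Bool) (h : cone x n ∈ T.leaves) :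
    Move (T.expand x n b h) (T.expand x n (!b) h) := by
  obtain ⟨p, q, hpq⟩ := List.append_of_mem h
  have hnd := T.isLeafList.nodup
  rw [hpq] at hnd
  refine Move.flip _ _ p [half x n b, half x n (!b)] q rfl ?_ ?_ ?_
  · simp only [expand, hpq]
    exact flatMap_splitLeaf_of_nodup hnd
  · have := support_splitLeaf x n b (cone x n)
    rw [splitLeaf_self] at this
    rw [this]
    exact Or.inr (Or.inl rfl)
  · simp only [expand, hpq]
    rw [flatMap_splitLeaf_of_nodup hnd]
    simp

lemma expand_moves (T : PlanarTree) (x : Bdry) (n : ℕ) (b c : Bool) (h : cone x n ∈ T.leaves) :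
    Relation.EqvGen Move (T.expand x n b h) (T.expand x n c h) := by
  by_cases hbc : c = b
  · subst hbc; exact Relation.EqvGen.refl _
  · have : c = !b := by cases b <;> cases c <;> simp_all
    subst this
    exact Relation.EqvGen.rel _ _ (T.expand_flip x n b h)

end PlanarTree

lemma Move.perm {T T' : PlanarTree} (h : Move T T') : T.leaves.Perm T'.leaves := by
  cases h with
  | rotate _ h => exact h.perm
  | mirror _ h => rw [h]; exact (List.reverse_perm _).symm
  | flip l₀ l₁ l₂ _ h1 _ h2 =>
    rw [h1, h2]
    exact ((List.reverse_perm l₁).symm.append_left l₀).append_right l₂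

lemma moves_perm {T T' : PlanarTree} (h : Relation.EqvGen Move T T') :
    T.leaves.Perm T'.leaves := by
  induction h with
  | rel _ _ h => exact h.perm
  | refl _ => exact List.Perm.refl _
  | symm _ _ _ ih => exact ih.symm
  | trans _ _ _ _ _ h1 h2 => exact h1.trans h2

lemma Move.expand {T T' : PlanarTree} (h : Move T T') (x : Bdry) (n : ℕ)
    (hx : cone x n ∈ T.leaves) (hx' : cone x n ∈ T'.leaves) :
    Relation.EqvGen Move (T.expand x n false hx) (T'.expand x n false hx') := by
  have hnd := T.isLeafList.nodup
  have hrev : ∀ p q : List (Set Bdry), (p ++ cone x n :: q).Nodup →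
      ((p ++ cone x n :: q).reverse).flatMap (splitLeaf x n true) =
        ((p ++ cone x n :: q).flatMap (splitLeaf x n false)).reverse := by
    intro p q hpq
    rw [flatMap_splitLeaf_of_nodup hpq]
    have e : (p ++ cone x n :: q).reverse = q.reverse ++ cone x n :: p.reverse := by simp
    rw [e, flatMap_splitLeaf_of_nodup (by rw [← e]; exact List.nodup_reverse.2 hpq)]
    simp
  have last := T'.expand_moves x n true false hx'
  cases h with
  | rotate he hr =>
    refine Relation.EqvGen.rel _ _ (Move.rotate _ _ ?_ ?_)
    · simp only [PlanarTree.expand, he]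
    · exact isRotated_flatMap _ hr
  | mirror he hr =>
    refine Relation.EqvGen.trans _ _ _ (Relation.EqvGen.rel _ _ (Move.mirror _ _ ?_ ?_)) last
    · simp only [PlanarTree.expand, he]
    · simp only [PlanarTree.expand, hr]
      obtain ⟨p, q, hpq⟩ := List.append_of_mem hx
      rw [hpq] at hnd ⊢
      exact hrev p q hnd
  | flip l₀ l₁ l₂ he h1 hs h2 =>
    by_cases hmem : cone x n ∈ l₁
    · refine Relation.EqvGen.trans _ _ _ (Relation.EqvGen.rel _ _
        (Move.flip _ _ l₀ (l₁.flatMap (splitLeaf x n false)) l₂ ?_ ?_ ?_ ?_)) last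
      · simp only [PlanarTree.expand, he]
      · simp only [PlanarTree.expand, h1, List.flatMap_append]
        rw [h1, List.nodup_append', List.nodup_append'] at hnd
        obtain ⟨⟨-, -, d01⟩, -, d12⟩ := hnd
        rw [flatMap_splitLeaf_of_notMem (l := l₀) fun h => d01 h hmem,
          flatMap_splitLeaf_of_notMem (l := l₂) fun h => d12 (List.mem_append_right _ hmem) h]
      · rw [support_flatMap]; exact Or.inl hs
      · simp only [PlanarTree.expand, h2, List.flatMap_append]
        rw [h1, List.nodup_append', List.nodup_append'] at hnd
        obtain ⟨⟨-, hnd1, d01⟩, -, d12⟩ := hnd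
        rw [flatMap_splitLeaf_of_notMem (l := l₀) fun h => d01 h hmem,
          flatMap_splitLeaf_of_notMem (l := l₂) fun h => d12 (List.mem_append_right _ hmem) h]
        obtain ⟨p, q, rfl⟩ := List.append_of_mem hmem
        rw [hrev p q hnd1]
    · refine Relation.EqvGen.rel _ _ (Move.flip _ _ (l₀.flatMap (splitLeaf x n false)) l₁
        (l₂.flatMap (splitLeaf x n false)) ?_ ?_ ?_ ?_)
      · simp only [PlanarTree.expand, he]
      · simp only [PlanarTree.expand, h1, List.flatMap_append]
        rw [flatMap_splitLeaf_of_notMem hmem]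
      · exact Or.inl hs
      · simp only [PlanarTree.expand, h2, List.flatMap_append]
        rw [flatMap_splitLeaf_of_notMem (l := l₁.reverse) (by simpa using hmem)]

lemma moves_expand {T T' : PlanarTree} (h : Relation.EqvGen Move T T') (x : Bdry) (n : ℕ)
    (hx : cone x n ∈ T.leaves) (hx' : cone x n ∈ T'.leaves) :
    Relation.EqvGen Move (T.expand x n false hx) (T'.expand x n false hx') := by
  induction h with
  | rel _ _ h => exact h.expand x n hx hx'
  | refl _ => exact Relation.EqvGen.refl _
  | symm _ _ _ ih => exact (ih hx' hx).symm
  | trans _ T'' _ h1 _ ih1 ih2 =>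
    have hx'' : cone x n ∈ T''.leaves := (moves_perm h1).mem_iff.1 hx
    exact (ih1 hx hx'').trans _ _ _ (ih2 hx'' hx')

/-- Iterated expansions of one leaf. -/
abbrev Expansions : PlanarTree → PlanarTree → Prop := Relation.ReflTransGen Expansion

lemma mk_expansions {T T' : PlanarTree} (h : Expansions T T') :
    Stratum.mk T' = Stratum.mk T := by
  induction h with
  | refl => rfl
  | tail _ h ih =>
    obtain ⟨x, n, hx, rfl⟩ := h
    rw [mk_expand, ih]

lemma expansions_confluent {T T₁ T₂ : PlanarTree} (h₁ : Expansions T T₁) (h₂ : Expansions T T₂) :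
    ∃ T₃, Expansions T₁ T₃ ∧ Expansions T₂ T₃ := by
  refine Relation.church_rosser ?_ h₁ h₂
  rintro T _ _ ⟨x, n, hx, rfl⟩ ⟨y, m, hy, rfl⟩
  by_cases h : cone x n = cone y m
  · rw [T.expand_congr false hx h]
    exact ⟨_, .refl, .refl⟩
  · refine ⟨_, .single ⟨y, m, T.mem_expand_of_ne hx hy (Ne.symm h), rfl⟩, .single ?_⟩
    exact ⟨x, n, T.mem_expand_of_ne hy hx h, T.expand_comm false false hx hy h⟩

lemma moves_expansions {T T' T₁ : PlanarTree} (h : Relation.EqvGen Move T T')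
    (h₁ : Expansions T T₁) : ∃ T₁', Expansions T' T₁' ∧ Relation.EqvGen Move T₁ T₁' := by
  induction h₁ with
  | refl => exact ⟨T', .refl, h⟩
  | tail _ he ih =>
    obtain ⟨U, hU, hm⟩ := ih
    obtain ⟨x, n, hx, rfl⟩ := he
    have hx' := (moves_perm hm).mem_iff.1 hx
    exact ⟨_, hU.tail ⟨x, n, hx', rfl⟩, moves_expand hm x n hx hx'⟩

/-- All leaves of `T` have depth at least `N`. -/
def Deep (N : ℕ) (T : PlanarTree) : Prop := ∀ U ∈ T.leaves, ∃ x n, N ≤ n ∧ U = cone x n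

lemma exists_deep_succ (N : ℕ) : ∀ (k : ℕ) (T : PlanarTree), Deep N T →
    {U | U ∈ T.leaves ∧ ∃ x, U = cone x N}.ncard ≤ k → ∃ T', Expansions T T' ∧ Deep (N + 1) T' := by
  intro k
  induction k with
  | zero =>
    intro T hT hk
    refine ⟨T, .refl, fun U hU => ?_⟩
    obtain ⟨x, n, hn, rfl⟩ := hT U hU
    refine ⟨x, n, ?_, rfl⟩
    have hfin : {U | U ∈ T.leaves ∧ ∃ x, U = cone x N}.Finite :=
      (List.finite_toSet T.leaves).subset fun U h => h.1
    have hempty := (Set.ncard_eq_zero hfin).1 (Nat.le_zero.1 hk)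
    rcases eq_or_lt_of_le hn with rfl | hn
    · have : cone x N ∈ {U | U ∈ T.leaves ∧ ∃ x, U = cone x N} := ⟨hU, x, rfl⟩
      rw [hempty] at this
      exact this.elim
    · exact hn
  | succ k ih =>
    intro T hT hk
    by_cases hex : ∃ x, cone x N ∈ T.leaves
    · obtain ⟨x, hx⟩ := hex
      have hfin : {U | U ∈ T.leaves ∧ ∃ x, U = cone x N}.Finite :=
        (List.finite_toSet T.leaves).subset fun U h => h.1
      obtain ⟨T', hT', hd⟩ := ih (T.expand x N false hx) (by
          intro U hU
          rcases T.mem_expand hx hU with ⟨h, -⟩ | ⟨c, rfl⟩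
          · exact hT U h
          · exact ⟨_, N + 1, by omega, half_eq_cone _ _ _⟩) (by
          refine Nat.le_of_lt_succ (lt_of_lt_of_le (Set.ncard_lt_ncard ?_ hfin) hk)
          refine ⟨?_, fun hsub => ?_⟩
          · rintro U ⟨hU, y, rfl⟩
            rcases T.mem_expand hx hU with ⟨h, -⟩ | ⟨c, h⟩
            · exact ⟨h, y, rfl⟩
            · rw [half_eq_cone] at h
              have := (cone_eq_cone h).1
              omega
          · obtain ⟨h, -⟩ := hsub ⟨hx, x, rfl⟩
            rcases T.mem_expand hx h with ⟨-, h⟩ | ⟨c, h⟩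
            · exact h rfl
            · exact half_ne_cone _ _ _ h.symm)
      exact ⟨T', hT'.head ⟨x, N, hx, rfl⟩, hd⟩
    · refine ⟨T, .refl, fun U hU => ?_⟩
      obtain ⟨x, n, hn, rfl⟩ := hT U hU
      refine ⟨x, n, ?_, rfl⟩
      rcases eq_or_lt_of_le hn with rfl | hn
      · exact absurd ⟨x, hU⟩ hex
      · exact hn

lemma exists_deep (N : ℕ) (T : PlanarTree) : ∃ T', Expansions T T' ∧ Deep N T' := by
  induction N with
  | zero =>
    refine ⟨T, .refl, fun U hU => ?_⟩
    obtain ⟨x, n, rfl⟩ := T.isLeafList.isCone U hU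
    exact ⟨x, n, Nat.zero_le _, rfl⟩
  | succ N ih =>
    obtain ⟨T₁, h1, hd⟩ := ih
    obtain ⟨T₂, h2, hd2⟩ := exists_deep_succ N _ T₁ hd le_rfl
    exact ⟨T₂, h1.trans h2, hd2⟩

lemma Deep.good {g : Equiv.Perm Bdry} {N : ℕ} (hg : ∀ x, ∃ m, IsTreeIsoAt g x N m)
    {T : PlanarTree} (hT : Deep N T) : Good g T := by
  intro U hU
  obtain ⟨x, n, hn, rfl⟩ := hT U hU
  obtain ⟨m, hm⟩ := hg x
  refine ⟨x, n, m + (n - N), rfl, ?_⟩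
  have := hm.shift (n - N)
  rwa [Nat.add_sub_cancel' hn] at this

lemma exists_good (g : Neretin) (T : PlanarTree) : ∃ T', Expansions T T' ∧ Good g T' := by
  obtain ⟨N, hN⟩ := g.2
  obtain ⟨T', h, hd⟩ := exists_deep N T
  exact ⟨T', h, hd.good hN⟩

lemma IsTreeIsoAt.image_half {g : Equiv.Perm Bdry} {x : Bdry} {n m : ℕ}
    (h : IsTreeIsoAt g x n m) : ∃ c, ∀ b, g '' half x n b = half (g x) m (xor c b) := by
  obtain ⟨y, hy⟩ := half_nonempty x n false
  -- `c` is the half in which the image of the left half lies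
  have hgy := (h.mem y).1 hy.1
  refine ⟨(g y).2 m, ?_⟩
  have key : ∀ z, Agree x z n → ((g z).2 m = xor ((g y).2 m) (z.2 n)) := by
    intro z hz
    have h1 := h y z hy.1 1
    have hgz := (h.mem z).1 hz
    have h2 : ∀ (u v : Bdry) k, Agree u v k → (Agree u v (k + 1) ↔ u.2 k = v.2 k) := by
      intro u v k huv
      refine ⟨fun h => h.2 k (by omega), fun h => ⟨huv.1, fun j hj => ?_⟩⟩
      rcases Nat.lt_succ_iff_lt_or_eq.1 hj with hj | rfl
      · exact huv.2 j hj
      · exact h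
    rw [h2 _ _ _ (hy.1.symm.trans hz), h2 _ _ _ (hgy.symm.trans hgz), hy.2] at h1
    cases hz' : z.2 n
    · simp [h1.1 hz'.symm]
    · have : (g y).2 m ≠ (g z).2 m := fun h => by
        have := h1.2 h
        rw [hz'] at this
        exact absurd this (by simp)
      cases h3 : (g y).2 m <;> cases h4 : (g z).2 m <;> simp_all
  intro b
  ext w
  constructor
  · rintro ⟨z, hz, rfl⟩
    exact ⟨(h.mem z).1 hz.1, by rw [key z hz.1, hz.2]⟩
  · rintro ⟨hw, hw'⟩
    have hz : Agree x (g⁻¹ w) n := (h.mem _).2 (by simpa using hw)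
    have h3 := key _ hz
    have e : g (g⁻¹ w) = w := by simp
    rw [e] at h3
    refine ⟨g⁻¹ w, ⟨hz, ?_⟩, by simp⟩
    rw [hw'] at h3
    exact (Bool.xor_right_inj.1 h3).symm

namespace PlanarTree

lemma Good.of_perm {g : Equiv.Perm Bdry} {T T' : PlanarTree} (h : Good g T)
    (hp : T.leaves.Perm T'.leaves) : Good g T' :=
  fun U hU => h U (hp.mem_iff.2 hU)

lemma Good.expand {g : Equiv.Perm Bdry} {T : PlanarTree} (h : Good g T) (x : Bdry) (n : ℕ)
    (hx : cone x n ∈ T.leaves) : Good g (T.expand x n false hx) := by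
  intro U hU
  rcases T.mem_expand hx hU with ⟨hU, -⟩ | ⟨c, rfl⟩
  · exact h U hU
  · obtain ⟨y, k, m, hc, hm⟩ := h _ hx
    obtain ⟨rfl, ha⟩ := cone_eq_cone hc
    refine ⟨_, n + 1, m + 1, half_eq_cone _ _ _, IsTreeIsoAt.shift (hm.congr ?_) 1⟩
    have : (x.1, Function.update x.2 n c) ∈ half x n c := by
      rw [half_eq_cone]; exact self_mem_cone _ _
    exact ha.symm.trans (half_subset _ _ _ this)

lemma relabel_expand {g : Equiv.Perm Bdry} {T : PlanarTree} (h : Good g T) (x : Bdry) (n : ℕ)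
    (hx : cone x n ∈ T.leaves) (h' : Good g (T.expand x n false hx)) :
    ∃ y m c, ∃ hy : cone y m ∈ (T.relabel g h).leaves,
      (T.expand x n false hx).relabel g h' = (T.relabel g h).expand y m c hy := by
  obtain ⟨y, k, m, hc, hm⟩ := h _ hx
  obtain ⟨rfl, ha⟩ := cone_eq_cone hc
  replace hm := hm.congr ha.symm
  obtain ⟨c, hhalf⟩ := hm.image_half
  have himg := hm.image_cone
  have hy : cone (g x) m ∈ (T.relabel g h).leaves := List.mem_map.2 ⟨_, hx, himg⟩
  refine ⟨g x, m, c, hy, ?_⟩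
  apply PlanarTree.ext
  · simp only [relabel, expand]
    rw [List.map_flatMap, List.flatMap_map]
    refine List.flatMap_congr fun U _ => ?_
    by_cases hU : U = cone x n
    · subst hU
      rw [himg, splitLeaf_self, splitLeaf_self]
      simp [hhalf]
    · have hU' : g '' U ≠ cone (g x) m := by
        rw [← himg]; exact fun he => hU (g.injective.image_injective he)
      rw [splitLeaf_ne hU, splitLeaf_ne hU']
      rfl
  · simp only [relabel, expand]
    rw [Set.image_union, Set.image_pair, himg, Set.image_compl_eq g.bijective, himg]

lemma relabel_move {g : Equiv.Perm Bdry} {T T' : PlanarTree} (hm : Move T T') (h : Good g T)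
    (h' : Good g T') : Move (T.relabel g h) (T'.relabel g h') := by
  cases hm with
  | rotate he hr => exact .rotate _ _ (by simp only [relabel, he]) (hr.map _)
  | mirror he hr =>
    exact .mirror _ _ (by simp only [relabel, he]) (by simp only [relabel, hr, List.map_reverse])
  | flip l₀ l₁ l₂ he h1 hs h2 =>
    refine .flip _ _ (l₀.map (g '' ·)) (l₁.map (g '' ·)) (l₂.map (g '' ·))
      (by simp only [relabel, he]) ?_ ?_ ?_
    · simp only [relabel, h1, List.map_append]
    · rw [support_image]; exact ⟨_, hs, rfl⟩
    · simp only [relabel, h2, List.map_append, List.map_reverse]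

lemma relabel_moves {g : Equiv.Perm Bdry} {T T' : PlanarTree} (hm : Relation.EqvGen Move T T')
    (h : Good g T) (h' : Good g T') :
    Relation.EqvGen Move (T.relabel g h) (T'.relabel g h') := by
  induction hm with
  | rel _ _ hm => exact .rel _ _ (relabel_move hm h h')
  | refl _ => exact .refl _
  | symm _ _ _ ih => exact (ih h' h).symm
  | trans _ T'' _ h1 _ ih1 ih2 =>
    have h'' : Good g T'' := h.of_perm (moves_perm h1)
    exact (ih1 h h'').trans _ _ _ (ih2 h'' h')

lemma Good.expansions {g : Equiv.Perm Bdry} {T T' : PlanarTree} (h : Good g T)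
    (he : Expansions T T') : Good g T' := by
  induction he with
  | refl => exact h
  | tail _ he ih =>
    obtain ⟨x, n, hx, rfl⟩ := he
    exact ih.expand x n hx

lemma mk_relabel_expansions {g : Equiv.Perm Bdry} {T T' : PlanarTree} (h : Good g T)
    (he : Expansions T T') (h' : Good g T') :
    Stratum.mk (T'.relabel g h') = Stratum.mk (T.relabel g h) := by
  induction he with
  | refl => rfl
  | tail he₀ he ih =>
    obtain ⟨x, n, hx, rfl⟩ := he
    have hg := h.expansions he₀
    obtain ⟨y, m, c, hy, e⟩ := relabel_expand hg x n hx h'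
    rw [e, mk_eq_of_moves (expand_moves _ y m c false hy), mk_expand, ih hg]

end PlanarTree

/-- The image under `g` of the stratum labelled by `T`: expand `T` until the symbol of `g` can be
composed with it, then replace each leaf label by its image. -/
noncomputable def actTree (g : Neretin) (T : PlanarTree) : Stratum :=
  Stratum.mk ((exists_good g T).choose.relabel g (exists_good g T).choose_spec.2)

/-- The result does not depend on the chosen expansion. -/
lemma actTree_eq (g : Neretin) {T T' : PlanarTree} (he : Expansions T T') (h : Good g T') :
    actTree g T = Stratum.mk (T'.relabel g h) := by
  obtain ⟨T₃, h1, h2⟩ := expansions_confluent (exists_good g T).choose_spec.1 he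
  have h3 := h.expansions h2
  rw [actTree, ← mk_relabel_expansions _ h1 h3, mk_relabel_expansions h h2 h3]

/-- The map by which `g` acts on the set of strata of the tower. -/
noncomputable def act (g : Neretin) : Stratum → Stratum :=
  Quot.lift (actTree g) (by
    rintro T T' (hm | he)
    · obtain ⟨T₁, h1, hg⟩ := exists_good g T
      obtain ⟨T₁', h1', hm'⟩ := moves_expansions (.rel _ _ hm) h1
      have hg' : Good g T₁' := hg.of_perm (moves_perm hm')
      rw [actTree_eq g h1 hg, actTree_eq g h1' hg']
      exact mk_eq_of_moves (relabel_moves hm' hg hg')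
    · obtain ⟨T₁, h1, hg⟩ := exists_good g T'
      rw [actTree_eq g h1 hg, actTree_eq g (h1.head he) hg])

lemma act_mk (g : Neretin) {T T' : PlanarTree} (he : Expansions T T') (h : Good g T') :
    act g (Stratum.mk T) = Stratum.mk (T'.relabel g h) := actTree_eq g he h

/-- The action of the Neretin group on the set of strata of the cyclic tower. -/
noncomputable instance : MulAction Neretin Stratum where
  smul := act
  one_smul s := by
    induction s using Quot.ind with | _ T => ?_
    have h : Good ((1 : Neretin) : Equiv.Perm Bdry) T := by
      intro U hU
      obtain ⟨x, n, rfl⟩ := T.isLeafList.isCone U hU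
      exact ⟨x, n, n, rfl, fun _ _ _ _ => Iff.rfl⟩
    refine (act_mk 1 .refl h).trans (congrArg Stratum.mk (PlanarTree.ext ?_ ?_))
    · simp [relabel]
    · simp [relabel]
  mul_smul g h s := by
    induction s using Quot.ind with | _ T => ?_
    obtain ⟨N, hN⟩ := h.2
    obtain ⟨M, hM⟩ := g.2
    obtain ⟨T', he, hd⟩ := exists_deep (N + M) T
    have hh : ∀ U ∈ T'.leaves, ∃ x n m p, U = cone x n ∧
        IsTreeIsoAt (h : Equiv.Perm Bdry) x n m ∧
        IsTreeIsoAt (g : Equiv.Perm Bdry) ((h : Equiv.Perm Bdry) x) m p := by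
      intro U hU
      obtain ⟨x, n, hn, rfl⟩ := hd U hU
      obtain ⟨m, hm⟩ := hN x
      obtain ⟨p, hp⟩ := hM ((h : Equiv.Perm Bdry) x)
      refine ⟨x, n, m + (n - N), p + (m + (n - N) - M), rfl, ?_, ?_⟩
      · have := hm.shift (n - N)
        rwa [Nat.add_sub_cancel' (by omega)] at this
      · have := hp.shift (m + (n - N) - M)
        rwa [Nat.add_sub_cancel' (by omega)] at this
    have h1 : Good (h : Equiv.Perm Bdry) T' := fun U hU => by
      obtain ⟨x, n, m, p, hU, hm, -⟩ := hh U hU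
      exact ⟨x, n, m, hU, hm⟩
    have h2 : Good (g : Equiv.Perm Bdry) (T'.relabel h h1) := fun V hV => by
      obtain ⟨U, hU, rfl⟩ := List.mem_map.1 hV
      obtain ⟨x, n, m, p, rfl, hm, hp⟩ := hh U hU
      exact ⟨_, m, p, hm.image_cone, hp⟩
    have h3 : Good ((g * h : Neretin) : Equiv.Perm Bdry) T' := fun U hU => by
      obtain ⟨x, n, m, p, hU, hm, hp⟩ := hh U hU
      exact ⟨x, n, p, hU, hm.comp hp⟩
    refine (act_mk (g * h) he h3).trans ?_
    refine Eq.trans ?_ ((congrArg (act g) (act_mk h he h1)).trans (act_mk g .refl h2)).symm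
    refine congrArg Stratum.mk (PlanarTree.ext ?_ ?_)
    · simp [relabel, Set.image_image]
    · simp [relabel, Set.image_image]

/-! ### The tower and the distinguished infinite associahedron -/

/-- `s` is a face of `t` (the stratum `s` lies in the closure of `t`): for suitable labels, the tree
labelling `t` arises from the tree labelling `s` by contracting inner edges. -/
def IsFace (s t : Stratum) : Prop :=
  ∃ T T' : PlanarTree, Stratum.mk T = s ∧ Stratum.mk T' = t ∧ T.leaves = T'.leaves ∧
    T'.edges ⊆ T.edges

lemma expansions_parallel {T T' T₁ : PlanarTree} (hl : T.leaves = T'.leaves)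
    (hs : T'.edges ⊆ T.edges) (h : Expansions T T₁) :
    ∃ T₁', Expansions T' T₁' ∧ T₁.leaves = T₁'.leaves ∧ T₁'.edges ⊆ T₁.edges := by
  induction h with
  | refl => exact ⟨T', .refl, hl, hs⟩
  | tail _ he ih =>
    obtain ⟨U, hU, hl', hs'⟩ := ih
    obtain ⟨x, n, hx, rfl⟩ := he
    refine ⟨U.expand x n false (hl' ▸ hx), hU.tail ⟨x, n, _, rfl⟩, ?_, ?_⟩
    · simp only [expand, hl']
    · exact Set.union_subset_union_left _ hs'

lemma IsFace.smul {s t : Stratum} (h : IsFace s t) (g : Neretin) : IsFace (g • s) (g • t) := by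
  obtain ⟨T, T', rfl, rfl, hl, hs⟩ := h
  obtain ⟨T₁, he, hg⟩ := exists_good g T
  obtain ⟨T₁', he', hl', hs'⟩ := expansions_parallel hl hs he
  have hg' : Good (g : Equiv.Perm Bdry) T₁' := hg.of_perm (hl' ▸ List.Perm.refl _)
  refine ⟨T₁.relabel g hg, T₁'.relabel g hg', (act_mk g he hg).symm, (act_mk g he' hg').symm, ?_,
    Set.image_mono hs'⟩
  simp only [relabel, hl']

/-- The points of the cyclic tower. The tower is a regular cell complex, hence it is the geometric
realization of the poset of its strata: a point is given by barycentric coordinates on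
a finite chain of strata. -/
@[ext]
structure Tower where
  coord : Stratum →₀ ℝ
  nonneg : ∀ s, 0 ≤ coord s
  sum_eq_one : coord.sum (fun _ r => r) = 1
  isChain : IsChain IsFace (coord.support : Set Stratum)

/-- The stratum `s` (an open cell) as a set of points of the tower: its points are those whose
chain of strata has the largest member `s`. -/
def Tower.stratum (s : Stratum) : Set Tower :=
  {p | s ∈ p.coord.support ∧ ∀ t ∈ p.coord.support, IsFace t s}

/-- The cellular action of the Neretin group on the cyclic tower. -/
noncomputable instance : MulAction Neretin Tower where
  smul g p :=
    { coord := p.coord.mapDomain (g • ·)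
      nonneg := fun s => by
        rw [← smul_inv_smul g s, Finsupp.mapDomain_apply (MulAction.injective g)]
        exact p.nonneg _
      sum_eq_one := by
        rw [Finsupp.sum_mapDomain_index_inj (MulAction.injective g)]
        exact p.sum_eq_one
      isChain := by
        classical
        rw [Finsupp.mapDomain_support_of_injective (MulAction.injective g), Finset.coe_image]
        rintro _ ⟨s, hs, rfl⟩ _ ⟨t, ht, rfl⟩ hne
        rcases p.isChain hs ht (fun h => hne (by rw [h])) with h | h
        · exact Or.inl (h.smul g)
        · exact Or.inr (h.smul g) }
  one_smul p := Tower.ext (by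
    change p.coord.mapDomain ((1 : Neretin) • ·) = p.coord
    simp [Finsupp.mapDomain])
  mul_smul g h p := Tower.ext (by
    change p.coord.mapDomain ((g * h) • ·) = (p.coord.mapDomain (h • ·)).mapDomain (g • ·)
    rw [← Finsupp.mapDomain_comp]
    congr 1
    funext s
    exact mul_smul g h s)

/-- The strata with a cyclic labelling: those which have a label in which the leaves of `T` carry
the leaves of `α` in the cyclic order of the plane. -/
def IsCyclicStratum (s : Stratum) : Prop :=
  ∃ T, Stratum.mk T = s ∧ IsCyclicList T.leaves

/-- The distinguished infinite associahedron `K_∞`: the union of the strata with a cyclic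
labelling. -/
def KInfty : Set Tower := {p | ∃ s, IsCyclicStratum s ∧ p ∈ Tower.stratum s}

/-! ### Outer automorphisms -/

instance (G : Type*) [Group G] : (MulAut.conj : G →* MulAut G).range.Normal where
  conj_mem := by
    rintro _ ⟨x, rfl⟩ f
    exact ⟨f x, by ext y; simp⟩

/-- The group of outer automorphisms of `G`: automorphisms modulo inner automorphisms. -/
abbrev Out (G : Type*) [Group G] : Type _ := MulAut G ⧸ (MulAut.conj : G →* MulAut G).range

end CyclicTower

/-! Everything is done with transformations of the boundary. The theorem rests on a computation of
all automorphisms of Thompson's group (`mulAut_thompsonT`) and on a computation of the stabilizer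
(`mem_stabilizer_iff`).

Automorphisms. Following Rubin, disjointness of supports is expressed through commutators, up to
passing to a 12th power. Hence an automorphism respects inclusion of closed supports; these are
clopen and form a basis, so compactness produces a homeomorphism `h` inducing the automorphism
(`ClopenSupports.exists_homeomorph`). Thompson's group is transitive on positively ordered triples
of dyadic ends, so `h` preserves or reverses the cyclic order (`preservesCyc_or`). After composition
with the involution it preserves it, and the crux is that `h` then lies in Thompson's group
(`isThompsonT_of_normalizes`).

For the crux, two cones are called similar if the planar map between them matches the sets which `h`
sends to cones. As conjugates `h * g * h⁻¹` are piecewise planar, the similarity type of a deep cone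
depends on boundedly many last turns only (`Normalizes.exists_hasMemory`). Either no turn matters,
or deep left cones are never similar to deep right ones. This dichotomy is applied to `h⁻¹`. In its
second case planarity of a conjugate passes from the two halves of a cone to the cone, with a bound
uniform in `g`, and no turn matters for `h`. So all deep cones are similar with respect to `h` or
`h⁻¹`. Comparing a set with a smaller copy of itself shows that deep sets sent to cones are cones
(`HasMemory.exists_isCone`). The inverse thus sends small cones to cones, and a cyclic map doing so
is planar.

Stabilizer. Elements of Thompson's group carry cyclic labels to cyclic labels, and so does the
involution after a mirror move. Conversely, consider strata of trees with one inner vertex. All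
inner edges created by expansions cut off a set inside one original leaf, so moves can only keep or
globally reverse the cyclic order of the original leaves (`Refines`). Therefore an element of the
stabilizer preserves or reverses the cyclic order, and an order-preserving spheromorphism belongs to
Thompson's group.

Conjugation by the involution is not inner (`inversionAut_notMem_range`), so the outer automorphism
group has two elements, and the involution has square one, which splits the stabilizer. -/

namespace CyclicTower
open PlanarTree

/-! ### Planar maps between cones -/

/-- The end that agrees with `y` up to depth `m` and then makes the turns which `x` makes from
depth `n` on. -/
def graft (y : Bdry) (m n : ℕ) (x : Bdry) : Bdry :=
  (y.1, fun k => if k < m then y.2 k else x.2 (n + (k - m)))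

lemma agree_graft (y : Bdry) (m n : ℕ) (x : Bdry) : Agree y (graft y m n x) m :=
  ⟨rfl, fun k hk => by simp [graft, hk]⟩

lemma graft_add (y : Bdry) (m n : ℕ) (x : Bdry) (k : ℕ) :
    (graft y m n x).2 (m + k) = x.2 (n + k) := by simp [graft]

lemma eq_of_agree {x y : Bdry} {n : ℕ} (h : Agree x y n) (h' : ∀ k, x.2 (n + k) = y.2 (n + k)) :
    x = y := by
  refine Prod.ext h.1 (funext fun k => ?_)
  by_cases hk : k < n
  · exact h.2 k hk
  · obtain ⟨j, rfl⟩ := Nat.exists_eq_add_of_le (not_lt.1 hk)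
    exact h' j

lemma eq_graft {y w x : Bdry} {m n : ℕ} (h : Agree y w m) (h' : ∀ k, w.2 (m + k) = x.2 (n + k)) :
    w = graft y m n x :=
  eq_of_agree (h.symm.trans (agree_graft _ _ _ _)) fun k => by rw [h', graft_add]

lemma graft_congr {y y' : Bdry} {m : ℕ} (h : Agree y y' m) (n : ℕ) (x : Bdry) :
    graft y m n x = graft y' m n x :=
  eq_graft (h.symm.trans (agree_graft _ _ _ _)) fun k => graft_add _ _ _ _ k

lemma graft_self {x z : Bdry} {n : ℕ} (h : Agree x z n) : graft x n n z = z :=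
  (eq_graft h fun _ => rfl).symm

lemma graft_graft (w y x : Bdry) (p m n : ℕ) :
    graft w p m (graft y m n x) = graft w p n x :=
  eq_graft (agree_graft _ _ _ _) fun k => by rw [graft_add, graft_add]

/-- Planar maps between cones restrict to planar maps between smaller cones, so the map may be
computed at any deeper level. -/
lemma graft_graft_add (y : Bdry) (m n k : ℕ) {x z : Bdry} (h : Agree z x (n + k)) :
    graft (graft y m n z) (m + k) (n + k) x = graft y m n x := by
  refine (eq_graft ?_ fun j => ?_).symm
  · refine ⟨rfl, fun j hj => ?_⟩
    by_cases hjm : j < m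
    · simp [graft, hjm]
    · simp only [graft, hjm, if_false]
      exact h.2 _ (by omega)
  · rw [add_assoc, graft_add, add_assoc]

lemma isPlanarAt_iff {g : Equiv.Perm Bdry} {x : Bdry} {n m : ℕ} :
    IsPlanarAt g x n m ↔ ∀ z, Agree x z n → g z = graft (g x) m n z :=
  ⟨fun h z hz => eq_graft (h z hz).1 (h z hz).2, fun h z hz => by
    rw [h z hz]; exact ⟨agree_graft _ _ _ _, fun k => graft_add _ _ _ _ k⟩⟩

/-! ### Cyclic lists of leaves -/

/-- `l` lists the leaves of a finite dyadic tree in the cyclic order of the plane. -/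
def IsCyclicLeafList (l : List (Set Bdry)) : Prop := IsLeafList l ∧ IsCyclicList l

lemma IsCyclicLeafList.isRotated {l l' : List (Set Bdry)} (h : IsCyclicLeafList l)
    (hr : List.IsRotated l l') : IsCyclicLeafList l' := by
  obtain ⟨h1, l₀, h2, h3⟩ := h
  exact ⟨h1.perm hr.perm, l₀, hr.symm.trans h2, h3⟩

/-- The tree with a single inner vertex. -/
def starTree (l : List (Set Bdry)) (h : IsLeafList l) : PlanarTree where
  leaves := l
  edges := ∅
  isLeafList := h
  arc := fun _ h => h.elim
  compl_mem := fun _ h => h.elim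
  nested := fun _ h => h.elim

/-- The halves, left before right, occupy the place of the old leaf in the planar order, so the
cyclic order survives. -/
lemma IsCyclicLeafList.split {p q : List (Set Bdry)} {x : Bdry} {n : ℕ}
    (h : IsCyclicLeafList (p ++ cone x n :: q)) :
    IsCyclicLeafList (p ++ half x n false :: half x n true :: q) := by
  have hnd := h.1.nodup
  have e : p ++ half x n false :: half x n true :: q =
      (p ++ cone x n :: q).flatMap (splitLeaf x n false) := by
    rw [flatMap_splitLeaf_of_nodup hnd]; simp
  rw [e]
  obtain ⟨h1, l', hr, hb⟩ := h
  -- The leaf-list property is borrowed from the expansion of the tree with a single inner vertex.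
  refine ⟨((starTree _ h1).expand x n false (by simp [starTree])).isLeafList,
    l'.flatMap (splitLeaf x n false), isRotated_flatMap _ hr, ?_⟩
  rw [List.pairwise_flatMap]
  refine ⟨fun U _ => ?_, hb.imp fun {U V} hUV A hA B hB x hx y hy =>
    hUV x (subset_of_mem_splitLeaf hA hx) y (subset_of_mem_splitLeaf hB hy)⟩
  unfold splitLeaf
  split_ifs
  · simp [before_half]
  · simp

lemma half_eq_cone_of_mem {x y : Bdry} {n : ℕ} {b : Bool} (h : y ∈ half x n b) :
    half x n b = cone y (n + 1) := by
  rw [half_eq_cone] at h ⊢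
  exact cone_congr h

/-- A leaf whose first end is `x` can be replaced by `k + 1` leaves, the first of which
has the first end `x` again. -/
lemma IsCyclicLeafList.exists_comb {p : List (Set Bdry)} {x : Bdry} (k : ℕ) :
    ∀ {n : ℕ} {q : List (Set Bdry)}, (∀ j, n ≤ j → x.2 j = false) →
      IsCyclicLeafList (p ++ cone x n :: q) →
      ∃ r, r.length = k ∧ IsCyclicLeafList (p ++ cone x (n + k) :: (r ++ q)) := by
  induction k with
  | zero => intro n q _ h; exact ⟨[], rfl, h⟩
  | succ k ih =>
    intro n q hx h
    have h1 := h.split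
    -- Since `x` turns left at depth `n`, the left half is again a cone around `x`, and the
    -- splitting can go on there.
    rw [half_eq_cone_of_mem (b := false) ⟨Agree.refl x n, hx n le_rfl⟩] at h1
    obtain ⟨r, hr, h2⟩ := ih (fun j hj => hx j (by omega)) h1
    refine ⟨r ++ [half x n true], by simp [hr], ?_⟩
    have e : n + 1 + k = n + (k + 1) := by omega
    rw [e] at h2
    simpa using h2

lemma IsLeafList.index {l : List (Set Bdry)} (h : IsLeafList l) (x : Bdry) :
    ∃ i : Fin l.length, x ∈ l[i] := by
  obtain ⟨U, hU, hx⟩ := h.cover x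
  obtain ⟨i, hi, rfl⟩ := List.getElem_of_mem hU
  exact ⟨⟨i, hi⟩, hx⟩

lemma IsLeafList.index_unique {l : List (Set Bdry)} (h : IsLeafList l) {x : Bdry}
    {i j : Fin l.length} (hi : x ∈ l[i]) (hj : x ∈ l[j]) : i = j := by
  have := h.eq_of_mem (List.getElem_mem i.2) (List.getElem_mem j.2) hi hj
  exact Fin.ext ((List.Nodup.getElem_inj_iff h.nodup).1 this)

/-- Two lists of leaves of the same length, in the planar and in the cyclic order, form a symbol of
an element of Thompson's group. -/
lemma exists_isThompsonT {l₀ l₁ : List (Set Bdry)} (h₀ : IsLeafList l₀)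
    (hb : l₀.Pairwise Before) (h₁ : IsCyclicLeafList l₁) (hlen : l₀.length = l₁.length) :
    ∃ g, IsThompsonT g ∧ List.Forall₂ (IsPlanarOn g) l₀ l₁ := by
  have c₀ : ∀ i : Fin l₀.length, ∃ a n, l₀[i] = cone a n := fun i => h₀.isCone _ (List.getElem_mem _)
  have c₁ : ∀ i : Fin l₁.length, ∃ a n, l₁[i] = cone a n :=
    fun i => h₁.1.isCone _ (List.getElem_mem _)
  choose a n ha using c₀
  choose b m hbm using c₁
  choose i₀ hi₀ using h₀.index
  choose i₁ hi₁ using h₁.1.index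
  let F : Fin l₀.length → Fin l₁.length := Fin.cast hlen
  let G : Fin l₁.length → Fin l₀.length := Fin.cast hlen.symm
  have hFG : ∀ i, F (G i) = i := fun i => rfl
  have hGF : ∀ i, G (F i) = i := fun i => rfl
  have e₀ : ∀ i x, x ∈ cone (a i) (n i) → i₀ x = i := fun i x hx =>
    h₀.index_unique (hi₀ x) ((ha i).symm ▸ hx)
  have e₁ : ∀ i x, x ∈ cone (b i) (m i) → i₁ x = i := fun i x hx =>
    h₁.1.index_unique (hi₁ x) ((hbm i).symm ▸ hx)
  have m₀ : ∀ x, Agree (a (i₀ x)) x (n (i₀ x)) := fun x => by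
    have := hi₀ x; rw [ha] at this; exact this
  have m₁ : ∀ x, Agree (b (i₁ x)) x (m (i₁ x)) := fun x => by
    have := hi₁ x; rw [hbm] at this; exact this
  -- Each leaf of the first list is carried by the planar map onto the leaf in the same position of
  -- the second list.
  let g : Equiv.Perm Bdry :=
    { toFun := fun x => graft (b (F (i₀ x))) (m (F (i₀ x))) (n (i₀ x)) x
      invFun := fun y => graft (a (G (i₁ y))) (n (G (i₁ y))) (m (i₁ y)) y
      left_inv := fun x => by
        have : i₁ (graft (b (F (i₀ x))) (m (F (i₀ x))) (n (i₀ x)) x) = F (i₀ x) :=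
          e₁ _ _ (agree_graft _ _ _ _)
        simp only [this, hGF]
        rw [graft_graft, graft_self (m₀ x)]
      right_inv := fun y => by
        have : i₀ (graft (a (G (i₁ y))) (n (G (i₁ y))) (m (i₁ y)) y) = G (i₁ y) :=
          e₀ _ _ (agree_graft _ _ _ _)
        simp only [this, hFG]
        rw [graft_graft, graft_self (m₁ y)] }
  have hg : ∀ i x, x ∈ cone (a i) (n i) → g x = graft (b (F i)) (m (F i)) (n i) x := fun i x hx => by
    change graft (b (F (i₀ x))) (m (F (i₀ x))) (n (i₀ x)) x = _
    rw [e₀ i x hx]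
  have hF : List.Forall₂ (IsPlanarOn g) l₀ l₁ := by
    rw [List.forall₂_iff_get]
    refine ⟨hlen, fun i hi hi' => ⟨a ⟨i, hi⟩, n ⟨i, hi⟩, m ⟨i, hi'⟩, ha ⟨i, hi⟩, ?_, ?_⟩⟩
    · rw [hg ⟨i, hi⟩ _ (self_mem_cone _ _)]
      exact (hbm ⟨i, hi'⟩).trans (cone_congr (agree_graft _ _ _ _))
    · intro y hy
      have hy' : y ∈ cone (a ⟨i, hi⟩) (n ⟨i, hi⟩) := by rw [← ha ⟨i, hi⟩]; exact hy
      rw [hg _ y hy']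
      refine ⟨?_, fun k => graft_add _ _ _ _ k⟩
      have : graft (b (F ⟨i, hi⟩)) (m (F ⟨i, hi⟩)) (n ⟨i, hi⟩) y ∈ cone (b ⟨i, hi'⟩) (m ⟨i, hi'⟩) :=
        agree_graft _ _ _ _
      rw [← hbm ⟨i, hi'⟩] at this
      exact this
  exact ⟨g, ⟨l₀, l₁, h₀, hb, h₁.1, h₁.2, hF⟩, hF⟩

lemma forall₂_rotate {α β : Type*} {R : α → β → Prop} {l : List α} {l' : List β}
    (h : List.Forall₂ R l l') (k : ℕ) : List.Forall₂ R (l.rotate k) (l'.rotate k) := by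
  induction k generalizing l l' with
  | zero => simpa using h
  | succ k ih =>
    cases h with
    | nil => simp
    | cons h1 h2 =>
      rw [List.rotate_cons_succ, List.rotate_cons_succ]
      exact ih (List.rel_append h2 (List.Forall₂.cons h1 List.Forall₂.nil))

lemma exists_isThompsonT_of_cyclic {l₀ l₁ : List (Set Bdry)} (h₀ : IsCyclicLeafList l₀)
    (h₁ : IsCyclicLeafList l₁) (hlen : l₀.length = l₁.length) :
    ∃ g, IsThompsonT g ∧ List.Forall₂ (IsPlanarOn g) l₀ l₁ := by
  obtain ⟨h, l', ⟨k, rfl⟩, hb⟩ := h₀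
  obtain ⟨g, hg, hF⟩ := exists_isThompsonT (h.perm (List.IsRotated.perm ⟨k, rfl⟩)) hb
    (h₁.isRotated ⟨k, rfl⟩) (by simpa using hlen)
  refine ⟨g, hg, ?_⟩
  -- The symbol was built on lists rotated by `k`; a total rotation by a multiple of the length
  -- restores both lists.
  have := forall₂_rotate hF (l₀.length * k - k)
  rw [List.rotate_rotate, List.rotate_rotate] at this
  rcases Nat.eq_zero_or_pos l₀.length with h0 | h0
  · have e₁ : l₁ = [] := List.length_eq_zero_iff.1 (hlen.symm.trans h0)
    rw [List.length_eq_zero_iff.1 h0, e₁]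
    exact .nil
  · have e : k + (l₀.length * k - k) = l₀.length * k := by
      have : k ≤ l₀.length * k := Nat.le_mul_of_pos_left k h0
      omega
    rw [e] at this
    conv at this => arg 3; rw [hlen]
    rwa [List.rotate_length_mul, List.rotate_length_mul] at this

lemma IsPlanarOn.isPlanarAt {g : Equiv.Perm Bdry} {x y : Bdry} {n m : ℕ}
    (h : IsPlanarOn g (cone x n) (cone y m)) : IsPlanarAt g x n m ∧ Agree y (g x) m := by
  obtain ⟨n', hn⟩ := h.exists_at
  obtain ⟨h1, m', h2, h3⟩ := hn x (self_mem_cone x n)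
  obtain ⟨rfl, -⟩ := cone_eq_cone h1
  obtain ⟨rfl, h4⟩ := cone_eq_cone h2
  exact ⟨h3, h4⟩

/-- A cone determines its depth, so source and target depths coincide and no turn is changed. -/
lemma IsPlanarOn.eq_self {g : Equiv.Perm Bdry} {U : Set Bdry} (h : IsPlanarOn g U U) {x : Bdry}
    (hx : x ∈ U) : g x = x := by
  obtain ⟨n, hn⟩ := h.exists_at
  obtain ⟨h1, m, h2, h3⟩ := hn x hx
  obtain ⟨rfl, h4⟩ := cone_eq_cone (h1.symm.trans h2)
  exact eq_of_agree h4.symm fun k => (h3 x (Agree.refl _ _)).2 k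

/-! ### Elements of Thompson's group -/

lemma exists_cyclicLeafList (x : Bdry) (n : ℕ) : ∃ r, IsCyclicLeafList (cone x n :: r) := by
  obtain ⟨l, h1, h2, h3⟩ := exists_uniform n
  obtain ⟨U, hU, hx⟩ := h3 x
  obtain ⟨y, rfl⟩ := h1 U hU
  rw [← cone_congr hx.symm] at hU
  obtain ⟨p, q, rfl⟩ := List.append_of_mem hU
  refine ⟨q ++ p, ?_⟩
  have hl : IsLeafList (p ++ cone x n :: q) :=
    ⟨fun U hU => (h1 U hU).imp fun y hy => ⟨n, hy⟩, h2.imp Before.disjoint, h3⟩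
  exact IsCyclicLeafList.isRotated ⟨hl, _, .refl _, h2⟩ List.isRotated_append

/-- The first end of a cone. -/
def firstEnd (x : Bdry) (n : ℕ) : Bdry := (x.1, fun k => if k < n then x.2 k else false)

lemma agree_firstEnd (x : Bdry) (n : ℕ) : Agree x (firstEnd x n) n :=
  ⟨rfl, fun k hk => by simp [firstEnd, hk]⟩

lemma firstEnd_of_le (x : Bdry) {n k : ℕ} (h : n ≤ k) : (firstEnd x n).2 k = false := by
  simp [firstEnd, h]

/-- Thompson's group acts transitively on cones. -/
lemma exists_isPlanarAt (x : Bdry) (n : ℕ) (y : Bdry) (m : ℕ) :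
    ∃ g, IsThompsonT g ∧ IsPlanarAt g x n m ∧ Agree y (g x) m := by
  -- A cone starts cyclic leaf lists of every sufficiently large length, obtained by splitting
  -- another leaf repeatedly at its first end. Two such lists of equal length form a symbol.
  have key : ∀ (x : Bdry) (n : ℕ), ∃ L, ∀ k, L ≤ k → ∃ r, IsCyclicLeafList (cone x n :: r) ∧
      r.length = k := by
    intro x n
    obtain ⟨r, hr⟩ := exists_cyclicLeafList x n
    have h3 := hr.1.three_le
    rcases r with _ | ⟨U, r⟩
    · simp at h3
    obtain ⟨z, i, rfl⟩ := hr.1.isCone U (by simp)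
    rw [cone_congr (agree_firstEnd z i)] at hr
    refine ⟨r.length + 1, fun k hk => ?_⟩
    obtain ⟨s, hs, h⟩ := IsCyclicLeafList.exists_comb (p := [cone x n]) (k - (r.length + 1))
      (fun j hj => firstEnd_of_le z hj) hr
    exact ⟨_, h, by simp [hs]; omega⟩
  obtain ⟨L, hL⟩ := key x n
  obtain ⟨L', hL'⟩ := key y m
  obtain ⟨r, h1, h2⟩ := hL (max L L') (le_max_left _ _)
  obtain ⟨r', h1', h2'⟩ := hL' (max L L') (le_max_right _ _)
  obtain ⟨g, hg, hF⟩ := exists_isThompsonT_of_cyclic h1 h1' (by simp [h2, h2'])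
  rw [List.forall₂_cons] at hF
  exact ⟨g, hg, hF.1.isPlanarAt⟩

/-- An element of Thompson's group with the support `cone x n`, which carries each end of the
left half of this cone into the left half of the left half, and so on. -/
lemma exists_isThompsonT_cone (x : Bdry) (n : ℕ) : ∃ g, IsThompsonT g ∧
    (∀ z, z ∉ cone x n → g z = z) ∧
    (∀ z ∈ half x n false, g z = graft z (n + 1) n z) ∧
    ∀ z ∈ cone x n, ∀ k, ∃ w ∈ cone z k, g w ≠ w := by
  obtain ⟨r, hr⟩ := exists_cyclicLeafList x n
  set x₀ : Bdry := (x.1, Function.update x.2 n false)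
  set x₁ : Bdry := (x.1, Function.update x.2 n true)
  have h := IsCyclicLeafList.split (p := []) hr
  have e₀ : half x n false = cone x₀ (n + 1) := half_eq_cone _ _ _
  have e₁ : half x n true = cone x₁ (n + 1) := half_eq_cone _ _ _
  simp only [List.nil_append] at h
  -- The cone is cut into three leaves in two ways, through its right half for the source and
  -- through its left half for the target. Matched in order, the turns `0`, `10`, `11` become `00`,
  -- `01`, `1`.
  have hA := h
  rw [e₁] at hA
  have hA := IsCyclicLeafList.split (p := [half x n false]) hA
  have hB := h
  rw [e₀] at hB
  have hB := IsCyclicLeafList.split (p := []) hB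
  simp only [List.cons_append, List.nil_append] at hA hB
  obtain ⟨g, hg, hF⟩ := exists_isThompsonT_of_cyclic hA hB rfl
  rw [List.forall₂_cons, List.forall₂_cons, List.forall₂_cons] at hF
  obtain ⟨f1, f2, f3, f4⟩ := hF
  have hfix : ∀ z, z ∉ cone x n → g z = z := by
    intro z hz
    obtain ⟨U, hU, hzU⟩ := hr.1.cover z
    have hU' : U ∈ r := by
      rcases List.mem_cons.1 hU with rfl | h
      · exact absurd hzU hz
      · exact h
    rw [List.forall₂_same] at f4
    exact (f4 U hU').eq_self hzU
  have m₀ : x₀ ∈ half x n false := by rw [e₀]; exact self_mem_cone _ _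
  have m₁ : x₁ ∈ half x n true := by rw [e₁]; exact self_mem_cone _ _
  rw [e₀, half_eq_cone] at f1
  rw [half_eq_cone x₁, half_eq_cone x₀] at f2
  rw [half_eq_cone x₁, e₁] at f3
  have g1 := f1.isPlanarAt
  have g2 := f2.isPlanarAt
  have g3 := f3.isPlanarAt
  have hleft : ∀ z ∈ half x n false, g z = graft z (n + 1) n z := by
    intro z hz
    rw [e₀] at hz
    have h1 := g1.1 z hz
    have h2 : Agree (x₀.1, Function.update x₀.2 (n + 1) false) (g z) (n + 1 + 1) := g1.2.trans h1.1
    have hz' : z ∈ half x n false := by rw [e₀]; exact hz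
    refine eq_graft (Agree.trans (Agree.symm hz) ⟨h2.1, fun k hk => ?_⟩) fun k => ?_
    · have := h2.2 k (by omega)
      simpa [Function.update_of_ne (show k ≠ n + 1 by omega)] using this
    · rcases k with _ | k
      · have := h2.2 (n + 1) (by omega)
        simp only [Function.update_self] at this
        rw [Nat.add_zero, ← this, Nat.add_zero, hz'.2]
      · have := h1.2 k
        rw [show n + 1 + (k + 1) = n + 1 + 1 + k by omega, this,
          show n + 1 + k = n + (k + 1) by omega]
  refine ⟨g, hg, hfix, hleft, fun z hz k => ?_⟩
  -- an isomorphism of two different cones, one containing the other, has a single fixed end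
  have moved : ∀ (u : Bdry) (p q : ℕ), p ≠ q → IsPlanarAt g u p q → ∀ v ∈ cone u p, ∀ k,
      ∃ w ∈ cone v k, g w ≠ w := by
    intro u p q hpq hp v hv k
    by_contra hcon
    push Not at hcon
    -- If a whole subcone were fixed, the turns at depths `p + j` and `q + j` would agree for all
    -- its ends. Flipping the single turn at depth `p + q + k` of `v` breaks this.
    have key : ∀ w ∈ cone v (p + q + k), ∀ j, w.2 (q + j) = w.2 (p + j) := by
      intro w hw j
      have := (hp w (Agree.trans hv (Agree.mono hw (by omega)))).2 j
      rwa [hcon w (Agree.mono (m := k) hw (by omega))] at this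
    set w : Bdry := (v.1, Function.update v.2 (p + q + k) (!(v.2 (p + q + k)))) with hw
    have hv' := key v (self_mem_cone _ _)
    have hw' := key w ⟨rfl, fun j hj => by simp [hw, hj.ne]⟩
    have hne : ∀ i j, i = p + q + k → j < p + q + k → v.2 i = v.2 j → w.2 i ≠ w.2 j := by
      rintro i j rfl hj h
      simp [hw, hj.ne, h]
    rcases lt_or_gt_of_ne hpq with hlt | hlt
    · exact hne _ _ (by omega) (by omega) (hv' (p + k)) (hw' (p + k))
    · exact hne _ _ (by omega) (by omega) (hv' (q + k)).symm (hw' (q + k)).symm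
  have hz' : Agree x z n := hz
  by_cases h0 : z.2 n = false
  · exact moved x₀ (n + 1) (n + 1 + 1) (by omega) g1.1 z (by rw [← e₀]; exact ⟨hz', h0⟩) k
  · have hz1 : z ∈ half x n true := ⟨hz', by simpa using h0⟩
    -- The middle leaf passes from the right half to the left half, so all its ends are moved; on
    -- the last leaf the depth changes.
    by_cases h1 : z.2 (n + 1) = false
    · have : z ∈ half x₁ (n + 1) false := ⟨by rw [e₁] at hz1; exact hz1, h1⟩
      refine ⟨z, self_mem_cone _ _, fun he => ?_⟩
      rw [half_eq_cone] at this
      have h2 := (g2.2.trans (g2.1 z this).1).2 n (by omega)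
      rw [he, hz1.2] at h2
      simp [x₀] at h2
    · have : z ∈ half x₁ (n + 1) true := ⟨by rw [e₁] at hz1; exact hz1, by simpa using h1⟩
      rw [half_eq_cone] at this
      exact moved _ (n + 1 + 1) (n + 1) (by omega) g3.1 z this k

/-! ### Triples of ends in cyclic position. -/

lemma exists_not_agree {x y : Bdry} (h : x ≠ y) : ∃ n, ∀ m, n ≤ m → ¬ Agree x y m := by
  by_contra! hcon
  obtain ⟨_, _, h0⟩ := hcon 0
  refine h (Prod.ext h0.1 (funext fun k => ?_))
  obtain ⟨m, hm, hk⟩ := hcon (k + 1)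
  exact hk.2 k (by omega)

/-- At a depth separating the three ends, a uniform tree lists their cones in the planar order; a
rotation brings the cone of `a` to the front. -/
lemma exists_three_leaves_of_lt {a b c : Bdry} (hab : PlanarLT a b) (hbc : PlanarLT b c) (N : ℕ) :
    ∃ n A B C, N ≤ n ∧
      IsCyclicLeafList (cone a n :: (A ++ cone b n :: (B ++ cone c n :: C))) := by
  obtain ⟨n₁, h₁⟩ := exists_not_agree (x := a) (y := b) (by rintro rfl; exact hab.irrefl _)
  obtain ⟨n₂, h₂⟩ := exists_not_agree (x := b) (y := c) (by rintro rfl; exact hbc.irrefl _)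
  set n := N + n₁ + n₂ with hn
  obtain ⟨l, h1, h2, h3⟩ := exists_uniform n
  have mem : ∀ x, cone x n ∈ l := fun x => by
    obtain ⟨U, hU, hx⟩ := h3 x
    obtain ⟨y, rfl⟩ := h1 U hU
    rwa [← cone_congr (Agree.symm hx)] at hU
  have hl : IsLeafList l :=
    ⟨fun U hU => (h1 U hU).imp fun y hy => ⟨n, hy⟩, h2.imp Before.disjoint, h3⟩
  have no : ∀ {x y}, PlanarLT x y → ¬ Before (cone y n) (cone x n) := fun {x y} h h' =>
    (h.trans (h' _ (self_mem_cone _ _) _ (self_mem_cone _ _))).irrefl _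
  have hne : ∀ {x y}, ¬ Agree x y n → cone x n ≠ cone y n := fun h he => h (cone_eq_cone he).2
  have mb := mem b
  have mc := mem c
  obtain ⟨P, Q, rfl⟩ := List.append_of_mem (mem a)
  have hP := (List.pairwise_append.1 h2).2.2
  have mb' : cone b n ∈ Q := by
    rcases List.mem_append.1 mb with h | h
    · exact (no hab (hP _ h _ List.mem_cons_self)).elim
    · rcases List.mem_cons.1 h with h | h
      · exact (hne (h₁ n (by omega)) h.symm).elim
      · exact h
  have hQ := (List.pairwise_cons.1 (List.pairwise_append.1 h2).2.1).2
  have mc' : cone c n ∈ Q := by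
    rcases List.mem_append.1 mc with h | h
    · exact (no hbc (hP _ h _ (List.mem_cons_of_mem _ mb'))).elim
    · rcases List.mem_cons.1 h with h | h
      · refine (no hbc ?_).elim
        rw [h]
        exact (List.pairwise_cons.1 (List.pairwise_append.1 h2).2.1).1 _ mb'
      · exact h
  obtain ⟨A, R, rfl⟩ := List.append_of_mem mb'
  have mc'' : cone c n ∈ R := by
    rcases List.mem_append.1 mc' with h | h
    · exact (no hbc ((List.pairwise_append.1 hQ).2.2 _ h _ List.mem_cons_self)).elim
    · rcases List.mem_cons.1 h with h | h
      · exact (hne (h₂ n (by omega)) h.symm).elim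
      · exact h
  obtain ⟨B, C, rfl⟩ := List.append_of_mem mc''
  refine ⟨n, A, B, C ++ P, by omega, IsCyclicLeafList.isRotated ⟨hl, _, .refl _, h2⟩ ?_⟩
  convert List.isRotated_append (l := P) using 1
  simp

lemma exists_three_leaves {a b c : Bdry} (h : Cyc a b c) (N : ℕ) :
    ∃ n A B C, N ≤ n ∧
      IsCyclicLeafList (cone a n :: (A ++ cone b n :: (B ++ cone c n :: C))) := by
  rcases h with ⟨h1, h2⟩ | ⟨h1, h2⟩ | ⟨h1, h2⟩
  · exact exists_three_leaves_of_lt h1 h2 N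
  · obtain ⟨n, A, B, C, hn, h⟩ := exists_three_leaves_of_lt h1 h2 N
    refine ⟨n, C, A, B, hn, h.isRotated ?_⟩
    convert List.isRotated_append (l := cone b n :: A ++ cone c n :: B)
      (l' := cone a n :: C) using 1 <;> simp
  · obtain ⟨n, A, B, C, hn, h⟩ := exists_three_leaves_of_lt h1 h2 N
    refine ⟨n, B, C, A, hn, h.isRotated ?_⟩
    convert List.isRotated_append (l := cone c n :: A)
      (l' := cone a n :: B ++ cone b n :: C) using 1 <;> simp

/-- The ends which finally turn left only. -/
def FinallyLeft (x : Bdry) : Prop := ∃ N, ∀ j, N ≤ j → x.2 j = false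

/-- Splitting each of the three leaves at its dyadic end inserts new leaves right behind it. All
three gaps can thus be given any large lengths, which allows two such configurations to be matched.
-/
lemma exists_three_leaves_length {a b c : Bdry} (h : Cyc a b c) (ha : FinallyLeft a)
    (hb : FinallyLeft b) (hc : FinallyLeft c) : ∃ L, ∀ k₁ k₂ k₃, L ≤ k₁ → L ≤ k₂ → L ≤ k₃ →
      ∃ n₁ n₂ n₃ A B C, (∀ j, n₁ ≤ j → a.2 j = false) ∧ (∀ j, n₂ ≤ j → b.2 j = false) ∧
        (∀ j, n₃ ≤ j → c.2 j = false) ∧ A.length = k₁ ∧ B.length = k₂ ∧ C.length = k₃ ∧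
        IsCyclicLeafList (cone a n₁ :: (A ++ cone b n₂ :: (B ++ cone c n₃ :: C))) := by
  obtain ⟨Na, ha⟩ := ha
  obtain ⟨Nb, hb⟩ := hb
  obtain ⟨Nc, hc⟩ := hc
  obtain ⟨n, A, B, C, hn, h⟩ := exists_three_leaves h (Na + Nb + Nc)
  refine ⟨A.length + B.length + C.length, fun k₁ k₂ k₃ h₁ h₂ h₃ => ?_⟩
  obtain ⟨r₁, e₁, h⟩ := IsCyclicLeafList.exists_comb (p := []) (k₁ - A.length)
    (fun j hj => ha j (by omega)) h
  have h : IsCyclicLeafList ((cone a (n + (k₁ - A.length)) :: (r₁ ++ A)) ++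
    cone b n :: (B ++ cone c n :: C)) := by simpa using h
  obtain ⟨r₂, e₂, h⟩ := IsCyclicLeafList.exists_comb (k₂ - B.length)
    (fun j hj => hb j (by omega)) h
  have h : IsCyclicLeafList ((cone a (n + (k₁ - A.length)) :: (r₁ ++ A) ++
    cone b (n + (k₂ - B.length)) :: (r₂ ++ B)) ++ cone c n :: C) := by simpa using h
  obtain ⟨r₃, e₃, h⟩ := IsCyclicLeafList.exists_comb (k₃ - C.length)
    (fun j hj => hc j (by omega)) h
  refine ⟨n + (k₁ - A.length), n + (k₂ - B.length), n + (k₃ - C.length), r₁ ++ A, r₂ ++ B, r₃ ++ C,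
    fun j hj => ha j (by omega),
    fun j hj => hb j (by omega), fun j hj => hc j (by omega), by simp; omega, by simp; omega,
    by simp; omega, ?_⟩
  simpa using h

lemma IsPlanarOn.eq_of_finallyLeft {g : Equiv.Perm Bdry} {x y : Bdry} {n m : ℕ}
    (h : IsPlanarOn g (cone x n) (cone y m)) (hx : ∀ j, n ≤ j → x.2 j = false)
    (hy : ∀ j, m ≤ j → y.2 j = false) : g x = y := by
  refine (eq_of_agree h.isPlanarAt.2 fun k => ?_).symm
  rw [hy _ (by omega), (h.isPlanarAt.1 x (Agree.refl _ _)).2 k, hx _ (by omega)]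

/-- Thompson's group acts transitively on the cyclically ordered triples of dyadic ends. -/
lemma exists_isThompsonT_triple {a b c a' b' c' : Bdry} (h : Cyc a b c) (h' : Cyc a' b' c')
    (ha : FinallyLeft a) (hb : FinallyLeft b) (hc : FinallyLeft c) (ha' : FinallyLeft a')
    (hb' : FinallyLeft b') (hc' : FinallyLeft c') :
    ∃ g, IsThompsonT g ∧ g a = a' ∧ g b = b' ∧ g c = c' := by
  obtain ⟨L, hL⟩ := exists_three_leaves_length h ha hb hc
  obtain ⟨L', hL'⟩ := exists_three_leaves_length h' ha' hb' hc'
  have le := le_max_left L L'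
  have le' := le_max_right L L'
  -- Equal gaps put the distinguished leaves into the same positions of both lists; planar maps of
  -- leaves send first ends to first ends.
  obtain ⟨n₁, n₂, n₃, A, B, C, z₁, z₂, z₃, e₁, e₂, e₃, hl⟩ := hL _ _ _ le le le
  obtain ⟨m₁, m₂, m₃, A', B', C', w₁, w₂, w₃, f₁, f₂, f₃, hl'⟩ := hL' _ _ _ le' le' le'
  obtain ⟨g, hg, hF⟩ := exists_isThompsonT_of_cyclic hl hl' (by simp [*])
  rw [List.forall₂_cons] at hF
  have h2 := List.forall₂_drop A.length hF.2
  rw [List.drop_left' rfl, List.drop_left' (f₁.trans e₁.symm), List.forall₂_cons] at h2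
  have h3 := List.forall₂_drop B.length h2.2
  rw [List.drop_left' rfl, List.drop_left' (f₂.trans e₂.symm), List.forall₂_cons] at h3
  exact ⟨g, hg, hF.1.eq_of_finallyLeft z₁ w₁, h2.1.eq_of_finallyLeft z₂ w₂,
    h3.1.eq_of_finallyLeft z₃ w₃⟩

/-! ### Reconstruction of a space from a locally moving group -/

section Reconstruction

open Topology
open scoped commutatorElement

set_option linter.unusedSectionVars false

variable {G X : Type*} [Group G]

/-- An algebraic form of the disjointness of the supports of `f` and (a power of) `g`. -/
def AlgDisjoint (f g : G) : Prop :=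
  ∀ h, ¬ Commute f h → ∃ f₁ f₂, Commute f₁ g ∧ Commute f₂ g ∧ Commute ⁅f₁, ⁅f₂, h⁆⁆ g ∧
    ⁅f₁, ⁅f₂, h⁆⁆ ≠ 1

lemma AlgDisjoint.map {f g : G} (h : AlgDisjoint f g) (φ : G ≃* G) :
    AlgDisjoint (φ f) (φ g) := by
  intro k hk
  obtain ⟨f₁, f₂, h1, h2, h3, h4⟩ := h (φ.symm k) fun hc => hk (by simpa using hc.map φ)
  refine ⟨φ f₁, φ f₂, h1.map φ, h2.map φ, by simpa [map_commutatorElement] using h3.map φ, ?_⟩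
  intro he
  refine h4 (φ.injective ?_)
  simpa [map_commutatorElement] using he

variable [MulAction G X]

lemma commute_of_disjoint [FaithfulSMul G X] {a b : G} (h : ∀ x : X, a • x = x ∨ b • x = x) :
    Commute a b := by
  have : Commute (MulAction.toPermHom G X a) (MulAction.toPermHom G X b) :=
    Equiv.Perm.Disjoint.commute h
  exact MulAction.toPerm_injective ((map_mul (MulAction.toPermHom G X) a b).trans
    (this.eq.trans (map_mul (MulAction.toPermHom G X) b a).symm))

lemma exists_smul_ne [FaithfulSMul G X] {a : G} (h : a ≠ 1) : ∃ x : X, a • x ≠ x := by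
  by_contra! hcon
  exact h (eq_of_smul_eq_smul (α := X) fun x => by rw [hcon, one_smul])

lemma smul_mem_of_fix {U : Set X} {a : G} (ha : ∀ x ∉ U, a • x = x) {x : X} (hx : x ∈ U) :
    a • x ∈ U := by
  by_contra h
  have := ha _ h
  rw [smul_left_cancel a this] at h
  exact h hx

lemma fix_inv {x : X} {a : G} (h : a • x = x) : a⁻¹ • x = x := by
  rw [inv_smul_eq_iff, h]

variable [TopologicalSpace X] [T2Space X] [ContinuousConstSMul G X]

lemma exists_open_displaced {a : G} {x : X} (h : a • x ≠ x) {W : Set X} (hW : IsOpen W)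
    (hx : x ∈ W) : ∃ U, IsOpen U ∧ x ∈ U ∧ U ⊆ W ∧ ∀ u ∈ U, a • u ∉ U := by
  obtain ⟨V, V', hV, hV', hx', hax, hd⟩ := t2_separation h.symm
  refine ⟨W ∩ V ∩ (a • ·) ⁻¹' V', (hW.inter hV).inter (hV'.preimage (continuous_const_smul a)),
    ⟨⟨hx, hx'⟩, hax⟩, fun u hu => hu.1.1, fun u hu hu' => ?_⟩
  exact Set.disjoint_left.1 hd hu'.1.2 hu.2

variable (G X) in
/-- Every nonempty open set contains the support of an element the `12`-th power of which is
not trivial. -/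
def LocallyMoving : Prop :=
  ∀ U : Set X, IsOpen U → U.Nonempty → ∃ g : G, (∀ x ∉ U, g • x = x) ∧ g ^ 12 ≠ 1

variable [FaithfulSMul G X]

lemma LocallyMoving.algDisjoint (hG : LocallyMoving G X) {f g : G}
    (h : ∀ x : X, f • x = x ∨ g • x = x) : AlgDisjoint f g := by
  intro k hk
  obtain ⟨x, hfx, hkx⟩ : ∃ x : X, f • x ≠ x ∧ k • x ≠ x := by
    by_contra! hcon
    exact hk (commute_of_disjoint (X := X) fun x => or_iff_not_imp_left.2 (hcon x))
  have hopen : IsOpen {x : X | f • x ≠ x} := isOpen_ne_fun (continuous_const_smul f) continuous_id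
  -- `U` lies in the support of `f`, where `g` is trivial, and is displaced by `k`. So elements
  -- supported in `U` commute with `g`, and their commutators with `k` keep their action on `U`.
  obtain ⟨U, hU, hxU, hUf, hUk⟩ := exists_open_displaced hkx hopen hfx
  have hUg : ∀ u ∈ U, g • u = u := fun u hu => (h u).resolve_left (hUf hu)
  obtain ⟨a, ha, ha'⟩ := hG U hU ⟨x, hxU⟩
  obtain ⟨y, hy⟩ := exists_smul_ne (X := X) (a := a) (by rintro rfl; simp at ha')
  have hyU : y ∈ U := by by_contra hcon; exact hy (ha y hcon)
  obtain ⟨V, hV, hyV, hVU, hVa⟩ := exists_open_displaced hy hU hyU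
  obtain ⟨b, hb, hb'⟩ := hG V hV ⟨y, hyV⟩
  obtain ⟨z, hz⟩ := exists_smul_ne (X := X) (a := b) (by rintro rfl; simp at hb')
  have hzV : z ∈ V := by by_contra hcon; exact hz (hb z hcon)
  have hbU : ∀ u ∉ U, b • u = u := fun u hu => hb u fun h => hu (hVU h)
  have hfixg : ∀ {c : G}, (∀ u ∉ U, c • u = u) → Commute c g := fun {c} hc =>
    commute_of_disjoint (X := X) fun u => by
      by_cases hu : u ∈ U
      · exact Or.inr (hUg u hu)
      · exact Or.inl (hc u hu)
  -- the commutator of `b` and `k` acts on `U` as `b` does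
  have key : ∀ u ∈ U, ⁅b, k⁆ • u = b • u := by
    intro u hu
    have h1 : k⁻¹ • u ∉ U := fun h => hUk _ h (by simpa using hu)
    rw [commutatorElement_def, mul_smul, mul_smul, mul_smul, fix_inv (hbU _ h1), smul_inv_smul]
  refine ⟨a, b, hfixg ha, hfixg hbU, hfixg fun u hu => ?_, fun he => ?_⟩
  · have h1 : ⁅b, k⁆⁻¹ • u ∉ U := by
      intro h1
      have h2 := key _ h1
      rw [smul_inv_smul] at h2
      exact hu (h2 ▸ smul_mem_of_fix hbU h1)
    rw [commutatorElement_def, mul_smul, mul_smul, mul_smul, fix_inv (ha _ h1), smul_inv_smul,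
      ha u hu]
  -- If `a` commuted with the inner commutator, then at `z` in `V` this would equate `a • b • z`
  -- with `a • z`, since `a • z` is outside `V` and is fixed by `b`.
  · rw [commutatorElement_eq_one_iff_mul_comm] at he
    have h1 := congrArg (· • z) he
    simp only [mul_smul] at h1
    rw [key z (hVU hzV), key _ (smul_mem_of_fix ha (hVU hzV)), hb _ (hVa z hzV)] at h1
    exact hz (smul_left_cancel a h1)

/-- A pigeonhole argument. If `f` and `g ^ 12` both move `x`, then so do `g`, `g ^ 2`, `g ^ 3`, `g ^
4`, as their exponents divide 12, and some neighbourhood `U` is displaced by all of them and by `f`.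
For `k` supported in `U`, the double commutator is supported in four translates of `U` by elements
commuting with `g`, while its support is invariant under `g`. Two of the five points `g ^ i • y`
with `i < 5` then fall into one translate, against displacement by a power of `g`. -/
lemma AlgDisjoint.disjoint (hG : LocallyMoving G X) {f g : G} (h : AlgDisjoint f g) (x : X) :
    f • x = x ∨ g ^ 12 • x = x := by
  by_contra! hcon
  obtain ⟨hf, hg⟩ := hcon
  have hgi : ∀ d, d ∣ 12 → g ^ d • x ≠ x := by
    rintro d ⟨e, he⟩ hd
    refine hg ?_
    rw [he, pow_mul]
    have : g ^ d ∈ MulAction.stabilizer G x := hd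
    exact Subgroup.pow_mem _ this e
  obtain ⟨U₀, o₀, m₀, s₀, d₀⟩ := exists_open_displaced hf isOpen_univ (Set.mem_univ x)
  obtain ⟨U₁, o₁, m₁, s₁, d₁⟩ := exists_open_displaced (hgi 1 (by norm_num)) o₀ m₀
  obtain ⟨U₂, o₂, m₂, s₂, d₂⟩ := exists_open_displaced (hgi 2 (by norm_num)) o₁ m₁
  obtain ⟨U₃, o₃, m₃, s₃, d₃⟩ := exists_open_displaced (hgi 3 (by norm_num)) o₂ m₂
  obtain ⟨U, o, m, s, d₄⟩ := exists_open_displaced (hgi 4 (by norm_num)) o₃ m₃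
  have hUf : ∀ u ∈ U, f • u ∉ U := fun u hu hu' =>
    d₀ u (s₁ (s₂ (s₃ (s hu)))) (s₁ (s₂ (s₃ (s hu'))))
  have hUg : ∀ e, 1 ≤ e → e ≤ 4 → ∀ u ∈ U, g ^ e • u ∉ U := by
    intro e h1 h2 u hu hu'
    interval_cases e
    · exact d₁ u (s₂ (s₃ (s hu))) (s₂ (s₃ (s hu')))
    · exact d₂ u (s₃ (s hu)) (s₃ (s hu'))
    · exact d₃ u (s hu) (s hu')
    · exact d₄ u hu hu'
  obtain ⟨k, hk, hk'⟩ := hG U o ⟨x, m⟩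
  obtain ⟨z, hz⟩ := exists_smul_ne (X := X) (a := k) (by rintro rfl; simp at hk')
  have hzU : z ∈ U := by by_contra hcon; exact hz (hk z hcon)
  obtain ⟨f₁, f₂, c₁, c₂, c, hne⟩ := h k fun hc => by
    have := congrArg (· • z) hc.eq
    simp only [mul_smul] at this
    rw [hk _ (hUf z hzU)] at this
    exact hz (smul_left_cancel f this)
  obtain ⟨y, hy⟩ := exists_smul_ne (X := X) hne
  -- The elements `1`, `f₁`, `f₂`, `f₁ * f₂`, whose translates of `U` cover the support of the
  -- double commutator.
  let a : Bool × Bool → G := fun p => cond p.1 f₁ 1 * cond p.2 f₂ 1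
  have hac : ∀ p, Commute (a p) g := by
    rintro ⟨b₁, b₂⟩
    cases b₁ <;> cases b₂ <;> simp [a, c₁, c₂, c₁.mul_left c₂]
  have supp : ∀ y : X, ⁅f₁, ⁅f₂, k⁆⁆ • y ≠ y → ∃ p, (a p)⁻¹ • y ∈ U := by
    intro y hy
    by_contra! hcon
    have h1 : y ∉ U := by simpa [a] using hcon (false, false)
    have h2 : f₁⁻¹ • y ∉ U := by simpa [a] using hcon (true, false)
    have h3 : f₂⁻¹ • y ∉ U := by simpa [a] using hcon (false, true)
    have h4 : f₂⁻¹ • f₁⁻¹ • y ∉ U := by simpa [a, mul_smul] using hcon (true, true)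
    refine hy ?_
    simp only [commutatorElement_def, mul_inv_rev, inv_inv, mul_smul]
    rw [fix_inv (hk _ h3), smul_inv_smul, hk _ h1, fix_inv (hk _ h2), hk _ h4, smul_inv_smul,
      smul_inv_smul]
  have hy' : ∀ i : Fin 5, ∃ p, (a p)⁻¹ • g ^ (i : ℕ) • y ∈ U := fun i => by
    refine supp _ fun he => hy ?_
    rw [← mul_smul, (c.pow_right i).eq, mul_smul] at he
    exact smul_left_cancel _ he
  choose p hp using hy'
  have pig : ∃ i j : Fin 5, i < j ∧ p i = p j := by
    obtain ⟨i, j, hij, e⟩ := Fintype.exists_ne_map_eq_of_card_lt p (by simp)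
    rcases lt_or_gt_of_ne hij with h | h
    · exact ⟨i, j, h, e⟩
    · exact ⟨j, i, h, e.symm⟩
  obtain ⟨i, j, hij, e⟩ := pig
  refine hUg (j - i : ℕ) (by have : (i : ℕ) < j := hij; omega) (by omega) _ (hp i) ?_
  have e2 : g ^ (j - i : ℕ) • (a (p i))⁻¹ • g ^ (i : ℕ) • y = (a (p j))⁻¹ • g ^ (j : ℕ) • y := by
    rw [← mul_smul, ← mul_smul, ← mul_smul, e, ((hac (p j)).symm.pow_left _).inv_right.eq,
      mul_assoc, ← pow_add, Nat.sub_add_cancel hij.le]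
  rw [e2]
  exact hp j

/-! ### Closed supports as an algebraic invariant. -/

variable (X) in
/-- The closed support of `g`. -/
def closedSupport (g : G) : Set X := closure {x | g • x ≠ x}

/-- The right-hand side involves the group alone, which makes inclusion of closed supports invariant
under automorphisms. In one direction `k ^ 12` is trivial on the support of `f`, hence on its
closure. In the other, near a point off the closure that `t` moves there is an element with small
support, disjoint from `f`, whose 12th power does not commute with `t`. -/
lemma LocallyMoving.fix_iff (hG : LocallyMoving G X) (f t : G) :
    (∀ x ∉ closedSupport X f, t • x = x) ↔ ∀ k, AlgDisjoint f k → Commute t (k ^ 12) := by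
  constructor
  · intro ht k hk
    refine commute_of_disjoint (X := X) fun x => ?_
    by_cases hx : x ∈ closedSupport X f
    · refine Or.inr ?_
      have hcl : IsClosed {x : X | k ^ 12 • x = x} :=
        isClosed_eq (continuous_const_smul _) continuous_id
      exact hcl.closure_subset_iff.2 (fun y hy => (hk.disjoint hG y).resolve_left hy) hx
    · exact Or.inl (ht x hx)
  · intro h x hx
    by_contra htx
    obtain ⟨U, hU, hxU, hUf, hUt⟩ := exists_open_displaced htx isClosed_closure.isOpen_compl hx
    obtain ⟨g, hg, hg'⟩ := hG U hU ⟨x, hxU⟩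
    have hd : AlgDisjoint f g := hG.algDisjoint fun y : X => by
      by_cases hy : y ∈ U
      · refine Or.inl ?_
        by_contra hne
        exact hUf hy (subset_closure hne)
      · exact Or.inr (hg y hy)
    have hc := h g hd
    obtain ⟨z, hz⟩ := exists_smul_ne (X := X) hg'
    have hg12 : ∀ u ∉ U, g ^ 12 • u = u := fun u hu => by
      have : g ∈ MulAction.stabilizer G u := hg u hu
      exact Subgroup.pow_mem _ this 12
    have hzU : z ∈ U := by by_contra hcon; exact hz (hg12 z hcon)
    have := congrArg (· • z) hc.eq
    simp only [mul_smul] at this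
    rw [hg12 _ (hUt z hzU)] at this
    exact hz (smul_left_cancel t this)

lemma fix_iff_closedSupport_subset (f t : G) :
    (∀ x ∉ closedSupport X f, t • x = x) ↔ closedSupport X t ⊆ closedSupport X f := by
  constructor
  · intro h
    refine closure_minimal (fun x hx => ?_) isClosed_closure
    by_contra hcon
    exact hx (h x hcon)
  · intro h x hx
    by_contra hne
    exact hx (h (subset_closure hne))

lemma LocallyMoving.subset_map (hG : LocallyMoving G X) (φ : G ≃* G) {f t : G}
    (h : closedSupport X t ⊆ closedSupport X f) :
    closedSupport X (φ t) ⊆ closedSupport X (φ f) := by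
  rw [← fix_iff_closedSupport_subset, hG.fix_iff] at h ⊢
  intro k hk
  have := (h (φ.symm k) (by simpa using hk.map φ.symm)).map φ
  simpa using this

lemma mem_closedSupport_conj (t f : G) (x : X) :
    x ∈ closedSupport X (t⁻¹ * f * t) ↔ t • x ∈ closedSupport X f := by
  have : {x : X | (t⁻¹ * f * t) • x ≠ x} = Homeomorph.smul t ⁻¹' {x : X | f • x ≠ x} := by
    ext y
    simp [mul_smul, inv_smul_eq_iff]
  rw [closedSupport, this, ← Homeomorph.preimage_closure]
  rfl

lemma closedSupport_nonempty_iff (f : G) : (closedSupport X f).Nonempty ↔ f ≠ 1 := by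
  rw [closedSupport, closure_nonempty_iff]
  constructor
  · rintro ⟨x, hx⟩ rfl
    simp at hx
  · intro h
    exact exists_smul_ne h

variable (G X) in
/-- The closed supports of the elements of `G` are open, and they form a basis of the topology. -/
structure ClopenSupports : Prop where
  isOpen : ∀ f : G, IsOpen (closedSupport X f)
  basis : ∀ (x : X) (U : Set X), IsOpen U → x ∈ U → ∃ f : G, x ∈ closedSupport X f ∧
    closedSupport X f ⊆ U

/-- If the image supports met, their open intersection would contain the support of a nontrivial
`k`; the preimage of `k` would be supported in both original sets. -/
lemma ClopenSupports.disjoint_map (hS : ClopenSupports G X) (hG : LocallyMoving G X)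
    (φ : G ≃* G) {f t : G} (h : Disjoint (closedSupport X t) (closedSupport X f)) :
    Disjoint (closedSupport X (φ t)) (closedSupport X (φ f)) := by
  rw [Set.disjoint_left]
  intro y hy hy'
  obtain ⟨k, hk, hk'⟩ := hS.basis y _ ((hS.isOpen (φ t)).inter (hS.isOpen (φ f))) ⟨hy, hy'⟩
  have h1 := hG.subset_map φ.symm (hk'.trans Set.inter_subset_left)
  have h2 := hG.subset_map φ.symm (hk'.trans Set.inter_subset_right)
  simp only [MulEquiv.symm_apply_apply] at h1 h2
  have hne : φ.symm k ≠ 1 := by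
    have := (closedSupport_nonempty_iff (X := X) k).1 ⟨y, hk⟩
    simpa using this
  obtain ⟨z, hz⟩ := (closedSupport_nonempty_iff (X := X) _).2 hne
  exact Set.disjoint_left.1 h (h1 hz) (h2 hz)

lemma ClopenSupports.eq (hS : ClopenSupports G X) {x y : X}
    (h : ∀ f : G, x ∈ closedSupport X f → y ∈ closedSupport X f) : x = y := by
  by_contra hne
  obtain ⟨f, hf, hf'⟩ := hS.basis x {y}ᶜ isOpen_compl_singleton hne
  exact hf' (h f hf) rfl

/-- The supports of `φ f`, for all `f` with `x` in the closed support, form a directed family of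
nonempty compact sets, and a common point serves as `y`. The converse implication uses that
disjointness is preserved. -/
lemma ClopenSupports.exists_image [CompactSpace X] (hS : ClopenSupports G X)
    (hG : LocallyMoving G X) (φ : G ≃* G) (x : X) :
    ∃ y, ∀ f : G, x ∈ closedSupport X f ↔ y ∈ closedSupport X (φ f) := by
  let I := {f : G // x ∈ closedSupport X f}
  have : Nonempty I := by
    obtain ⟨f, hf, -⟩ := hS.basis x Set.univ isOpen_univ trivial
    exact ⟨⟨f, hf⟩⟩
  obtain ⟨y, hy⟩ := IsCompact.nonempty_iInter_of_directed_nonempty_isCompact_isClosed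
    (fun f : I => closedSupport X (φ f)) (by
      rintro ⟨f, hf⟩ ⟨f', hf'⟩
      obtain ⟨k, hk, hk'⟩ := hS.basis x _ ((hS.isOpen f).inter (hS.isOpen f')) ⟨hf, hf'⟩
      exact ⟨⟨k, hk⟩, hG.subset_map φ (hk'.trans Set.inter_subset_left),
        hG.subset_map φ (hk'.trans Set.inter_subset_right)⟩)
    (fun f => by
      rw [closedSupport_nonempty_iff]
      have := (closedSupport_nonempty_iff (X := X) f.1).1 ⟨x, f.2⟩
      simpa using this)
    (fun f => isClosed_closure.isCompact) (fun f => isClosed_closure)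
  rw [Set.mem_iInter] at hy
  refine ⟨y, fun f => ⟨fun hf => hy ⟨f, hf⟩, fun hf => ?_⟩⟩
  by_contra hx
  obtain ⟨k, hk, hk'⟩ := hS.basis x _ (isClosed_closure.isOpen_compl : IsOpen (closedSupport X f)ᶜ) hx
  have := hS.disjoint_map hG φ (Set.subset_compl_iff_disjoint_right.1 hk')
  exact Set.disjoint_left.1 this (hy ⟨k, hk⟩) hf

/-- Each automorphism of a locally moving group with clopen supports is spatial. -/
theorem ClopenSupports.exists_homeomorph [CompactSpace X] (hS : ClopenSupports G X)
    (hG : LocallyMoving G X) (φ : G ≃* G) :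
    ∃ h : X ≃ₜ X, ∀ (g : G) (x : X), h (g • x) = φ g • h x := by
  choose h hh using hS.exists_image hG φ
  choose k hk using hS.exists_image hG φ.symm
  have cont : ∀ (φ : G ≃* G) (h : X → X),
      (∀ x f, x ∈ closedSupport X f ↔ h x ∈ closedSupport X (φ f)) → Continuous h := by
    intro φ h hh
    rw [continuous_def]
    intro U hU
    rw [isOpen_iff_mem_nhds]
    intro x hx
    obtain ⟨f, hf, hf'⟩ := hS.basis _ U hU hx
    have e : φ (φ.symm f) = f := by simp
    refine Filter.mem_of_superset ((hS.isOpen (φ.symm f)).mem_nhds ((hh x _).2 (e.symm ▸ hf))) ?_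
    intro z hz
    have := (hh z _).1 hz
    rw [e] at this
    exact hf' this
  let H : X ≃ₜ X :=
    { toFun := h
      invFun := k
      left_inv := fun x => (hS.eq fun f hf => by
        have := (hk (h x) (φ f)).1 ((hh x f).1 hf)
        simpa using this).symm
      right_inv := fun y => (hS.eq fun f hf => by
        have := (hh (k y) (φ.symm f)).1 ((hk y f).1 hf)
        simpa using this).symm
      continuous_toFun := cont φ h hh
      continuous_invFun := cont φ.symm k hk }
  -- Conjugation by `g` translates closed supports and `φ` respects conjugation, so equivariance is
  -- checked on the supports around a point.
  refine ⟨H, fun g x => hS.eq fun f hf => ?_⟩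
  change h (g • x) ∈ _ at hf
  change φ g • h x ∈ _
  have h1 := (hh (g • x) (φ.symm f)).2 (by simpa using hf)
  rw [← mem_closedSupport_conj, hh] at h1
  simpa [mem_closedSupport_conj] using h1

end Reconstruction

/-! ### Order and cones -/

lemma PlanarLT.asymm {x y : Bdry} (h : PlanarLT x y) (h' : PlanarLT y x) : False :=
  (h.trans h').irrefl _

lemma PlanarLT.ne {x y : Bdry} (h : PlanarLT x y) : x ≠ y := by
  rintro rfl; exact h.irrefl _

lemma planarLT_of_agree {x y : Bdry} {k : ℕ} (h : Agree x y k) (hx : x.2 k = false)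
    (hy : y.2 k = true) : PlanarLT x y := Or.inr ⟨h.1, k, h.2, hx, hy⟩

lemma PlanarLT.exists_agree {x y : Bdry} (h : PlanarLT x y) (h1 : x.1 = y.1) :
    ∃ k, Agree x y k ∧ x.2 k = false ∧ y.2 k = true := by
  rcases h with h | ⟨-, k, h2, h3, h4⟩
  · exact absurd h1 h.ne
  · exact ⟨k, ⟨h1, h2⟩, h3, h4⟩

lemma agree_of_between {x y z : Bdry} {n : ℕ} (h : Agree x y n) (hxz : PlanarLT x z)
    (hzy : PlanarLT z y) : Agree x z n := by
  by_contra hcon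
  exact (PlanarLT.congr_left h hcon hxz).asymm hzy

lemma exists_notMem_cone (x : Bdry) (n : ℕ) : ∃ v, v ∉ cone x n :=
  ⟨(x.1 + 1, x.2), fun h => by have h1 : x.1 = x.1 + 1 := h.1; simp at h1⟩

/-- Cutting the circle at an end outside the cone makes the cyclic order linear on the cone. This is
how cyclic maps are compared with the planar order. -/
lemma cyc_outside_iff {x y z v : Bdry} {n : ℕ} (hy : y ∈ cone x n) (hz : z ∈ cone x n)
    (hv : v ∉ cone x n) : Cyc y z v ↔ PlanarLT y z := by
  have hyz : Agree y z n := Agree.trans (Agree.symm hy) hz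
  have hyv : ¬ Agree y v n := fun h => hv (Agree.trans hy h)
  have hzv : ¬ Agree z v n := fun h => hv (Agree.trans hz h)
  constructor
  · rintro (⟨h, -⟩ | ⟨h1, h2⟩ | ⟨-, h⟩)
    · exact h
    · exact (h1.asymm (PlanarLT.congr_right hyz hyv h2)).elim
    · exact h
  · intro h
    have hne : y ≠ v := by rintro rfl; exact hyv (Agree.refl _ _)
    rcases PlanarLT.total hne with h1 | h1
    · exact Or.inl ⟨h, PlanarLT.congr_left hyz hyv h1⟩
    · exact Or.inr (Or.inr ⟨h1, h⟩)

/-- The map `g` preserves the cyclic order. -/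
def PreservesCyc (g : Equiv.Perm Bdry) : Prop := ∀ x y z, Cyc x y z → Cyc (g x) (g y) (g z)

lemma PreservesCyc.iff {g : Equiv.Perm Bdry} (h : PreservesCyc g) {x y z : Bdry} :
    Cyc (g x) (g y) (g z) ↔ Cyc x y z := by
  refine ⟨fun hc => ?_, h x y z⟩
  have i := g.injective
  rcases Cyc.total (x := x) (y := y) (z := z) (fun e => hc.ne (e ▸ rfl))
    (fun e => hc.rotate.ne (e ▸ rfl)) (fun e => hc.rotate.rotate.ne (e ▸ rfl)) with h1 | h1
  · exact h1
  · exact (hc.asymm (h _ _ _ h1)).elim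

lemma PreservesCyc.inv {g : Equiv.Perm Bdry} (h : PreservesCyc g) : PreservesCyc g⁻¹ := by
  intro x y z hc
  rw [← h.iff]
  simpa using hc

lemma IsThompsonT.preservesCyc {g : Equiv.Perm Bdry} (h : IsThompsonT g) : PreservesCyc g :=
  h.isCyclicPlanar.2

/-- The last end of a cone. -/
def lastEnd (x : Bdry) (n : ℕ) : Bdry := (x.1, fun k => if k < n then x.2 k else true)

lemma agree_lastEnd (x : Bdry) (n : ℕ) : Agree x (lastEnd x n) n :=
  ⟨rfl, fun k hk => by simp [lastEnd, hk]⟩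

lemma lastEnd_of_le (x : Bdry) {n k : ℕ} (h : n ≤ k) : (lastEnd x n).2 k = true := by
  simp [lastEnd, h]

lemma firstEnd_lt {x z : Bdry} {n : ℕ} (h : Agree x z n) (hne : z ≠ firstEnd x n) :
    PlanarLT (firstEnd x n) z := by
  rcases PlanarLT.total hne with h1 | h1
  · obtain ⟨l, h3, h4, h5⟩ := h1.exists_agree h.1.symm
    by_cases hl : l < n
    · rw [← (h.symm.trans (agree_firstEnd x n)).2 l hl, h4] at h5
      exact absurd h5 (by simp)
    · rw [firstEnd_of_le x (not_lt.1 hl)] at h5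
      exact absurd h5 (by simp)
  · exact h1

lemma lt_lastEnd {x z : Bdry} {n : ℕ} (h : Agree x z n) (hne : z ≠ lastEnd x n) :
    PlanarLT z (lastEnd x n) := by
  rcases PlanarLT.total hne with h1 | h1
  · exact h1
  · obtain ⟨l, h3, h4, h5⟩ := h1.exists_agree h.1
    by_cases hl : l < n
    · rw [← (h.symm.trans (agree_lastEnd x n)).2 l hl, h5] at h4
      exact absurd h4 (by simp)
    · rw [lastEnd_of_le x (not_lt.1 hl)] at h4
      exact absurd h4 (by simp)

/-! ### Successors in the cyclic order -/

/-- There are no ends between `p` and `q`. -/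
def Succ (p q : Bdry) : Prop := p ≠ q ∧ ∀ z, ¬ Cyc p z q

lemma Succ.unique {p q q' : Bdry} (h : Succ p q) (h' : Succ p q') : q = q' := by
  by_contra hne
  rcases Cyc.total h.1 hne h'.1 with hc | hc
  · exact h'.2 q hc
  · exact h.2 q' hc

lemma Succ.map {p q : Bdry} (h : Succ p q) {g : Equiv.Perm Bdry} (hg : PreservesCyc g) :
    Succ (g p) (g q) := by
  refine ⟨g.injective.ne h.1, fun z hz => h.2 (g⁻¹ z) ?_⟩
  rw [← hg.iff]
  simpa using hz

lemma succ_of_agree {p q : Bdry} {k : ℕ} (h : Agree p q k) (hp : p.2 k = false)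
    (hq : q.2 k = true) (hp' : ∀ i, k < i → p.2 i = true) (hq' : ∀ i, k < i → q.2 i = false) :
    Succ p q := by
  have hlt := planarLT_of_agree h hp hq
  refine ⟨hlt.ne, fun z hz => ?_⟩
  obtain ⟨h1, h2⟩ : PlanarLT p z ∧ PlanarLT z q := by
    rcases hz with h | ⟨-, h⟩ | ⟨h, -⟩
    · exact h
    · exact (h.asymm hlt).elim
    · exact (h.asymm hlt).elim
  have hpz := agree_of_between h h1 h2
  obtain ⟨l, a1, a2, a3⟩ := h1.exists_agree hpz.1
  obtain ⟨l', b1, b2, b3⟩ := h2.exists_agree (hpz.symm.trans h).1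
  have hl : l ≤ k := by
    by_contra hcon
    rw [hp' l (by omega)] at a2
    exact absurd a2 (by simp)
  have hl' : l' ≤ k := by
    by_contra hcon
    rw [hq' l' (by omega)] at b3
    exact absurd b3 (by simp)
  have e : l = k := by
    by_contra hne
    have := hpz.2 l (by omega)
    rw [a2, a3] at this
    exact absurd this (by simp)
  have e' : l' = k := by
    by_contra hne
    have := (hpz.symm.trans h).2 l' (by omega)
    rw [b2, b3] at this
    exact absurd this (by simp)
  subst e e'
  rw [a3] at b2
  exact absurd b2 (by simp)

lemma exists_last {f : ℕ → Bool} {b : Bool} {N p i : ℕ} (h : ∀ i, N ≤ i → f i = !b) (hi : p ≤ i)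
    (hb : f i = b) : ∃ r, p ≤ r ∧ f r = b ∧ ∀ i, r < i → f i = !b := by
  classical
  have hiN : i ≤ N := by
    by_contra hcon
    rw [h i (by omega)] at hb
    cases b <;> simp at hb
  refine ⟨Nat.findGreatest (fun j => f j = b) N,
    hi.trans (Nat.le_findGreatest hiN hb), Nat.findGreatest_spec (P := fun j => f j = b) hiN hb, fun j hj => ?_⟩
  by_cases hjN : j ≤ N
  · have := Nat.findGreatest_is_greatest hj hjN
    cases b <;> simpa using this
  · exact h j (by omega)

/-- The last left turn becomes right and all later turns become left. If there are only right turns,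
the first end beyond the next edge at the central vertex follows, with addition in `Fin 3` closing
the circle. -/
lemma exists_succ {p : Bdry} (h : ∃ N, ∀ i, N ≤ i → p.2 i = true) : ∃ q, Succ p q := by
  obtain ⟨N, h⟩ := h
  by_cases h0 : ∃ i, p.2 i = false
  · obtain ⟨i, hi⟩ := h0
    obtain ⟨r, -, hr, hr'⟩ := exists_last (b := false) h (Nat.zero_le i) hi
    refine ⟨(p.1, fun k => if k < r then p.2 k else if k = r then true else false),
      succ_of_agree (k := r) ⟨rfl, fun k hk => by simp [hk]⟩ hr (by simp) hr' fun i hi => ?_⟩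
    simp [show ¬ i < r by omega, show i ≠ r by omega]
  · push Not at h0
    simp only [ne_eq, Bool.not_eq_false] at h0
    have hp : ∀ z, PlanarLT p z → p.1 < z.1 := by
      rintro z (h | ⟨-, k, -, h, -⟩)
      · exact h
      · rw [h0] at h; exact absurd h (by simp)
    have hq : ∀ (i : Fin 3) z, PlanarLT z (i, fun _ => false) → z.1 < i := by
      rintro i z (h | ⟨-, k, -, -, h⟩)
      · exact h
      · exact absurd h (by simp)
    refine ⟨(p.1 + 1, fun _ => false), fun e => ?_, fun z hz => ?_⟩
    · have := congrArg Prod.fst e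
      simp at this
    · have key : ∀ i j : Fin 3, ¬ ((i < j ∧ j < i + 1) ∨ (j < i + 1 ∧ i + 1 ≤ i) ∨
        (i + 1 ≤ i ∧ i < j)) := by decide
      refine key p.1 z.1 ?_
      have le : ∀ {x y}, PlanarLT x y → x.1 ≤ y.1 := by
        rintro x y (h | ⟨h, -⟩)
        · exact h.le
        · exact h.le
      rcases hz with ⟨h1, h2⟩ | ⟨h1, h2⟩ | ⟨h1, h2⟩
      · exact Or.inl ⟨hp _ h1, hq _ _ h2⟩
      · exact Or.inr (Or.inl ⟨hq _ _ h1, le h2⟩)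
      · exact Or.inr (Or.inr ⟨le h1, hp _ h2⟩)

/-- The mirror image of an end. -/
lemma planarLT_invPerm {x y : Bdry} : PlanarLT (invPerm x) (invPerm y) ↔ PlanarLT y x := by
  have key : ∀ x y, PlanarLT x y → PlanarLT (invPerm y) (invPerm x) := by
    rintro x y (h | ⟨h, k, h1, h2, h3⟩)
    · exact Or.inl (Fin.rev_lt_rev.2 h)
    · exact Or.inr ⟨by simp [invPerm, h], k, fun j hj => by simp [invPerm, h1 j hj],
        by simp [invPerm, h3], by simp [invPerm, h2]⟩
  have inv : ∀ x, invPerm (invPerm x) = x := fun x => by simp [invPerm]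
  refine ⟨fun h => ?_, key _ _⟩
  have := key _ _ h
  rwa [inv, inv] at this

lemma cyc_invPerm {x y z : Bdry} : Cyc (invPerm x) (invPerm y) (invPerm z) ↔ Cyc x z y := by
  simp only [Cyc, planarLT_invPerm]
  tauto

lemma invPerm_invPerm (x : Bdry) : invPerm (invPerm x) = x := by simp [invPerm]

lemma succ_invPerm {p q : Bdry} : Succ (invPerm p) (invPerm q) ↔ Succ q p := by
  have key : ∀ p q, Succ q p → Succ (invPerm p) (invPerm q) := by
    rintro p q ⟨h1, h2⟩
    refine ⟨invPerm.injective.ne h1.symm, fun z hz => ?_⟩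
    rw [← invPerm_invPerm z, cyc_invPerm] at hz
    exact h2 _ hz.rotate
  refine ⟨fun h => ?_, key _ _⟩
  simpa [invPerm_invPerm] using key _ _ h

/-- A left turn of `p` below the depth where `p` and `q` part could be changed to a right one,
giving an end in between. Together with `exists_succ` this makes eventual right turning a property
of the cyclic order. -/
lemma Succ.finallyRight {p q : Bdry} (h : Succ p q) : ∃ N, ∀ i, N ≤ i → p.2 i = true := by
  obtain ⟨N, hN⟩ := exists_not_agree h.1
  refine ⟨N, fun i hi => ?_⟩
  by_contra hcon
  have hcon : p.2 i = false := by simpa using hcon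
  set z : Bdry := (p.1, Function.update p.2 i true)
  have hpz : Agree p z i := ⟨rfl, fun k hk => by simp [z, hk.ne]⟩
  have hlt : PlanarLT p z := planarLT_of_agree hpz hcon (by simp [z])
  refine h.2 z ?_
  have hq : q ∉ cone p N := hN N le_rfl
  exact (cyc_outside_iff (self_mem_cone p N) (hpz.mono hi) hq).2 hlt

lemma Succ.finallyLeft {p q : Bdry} (h : Succ p q) : FinallyLeft q := by
  obtain ⟨N, hN⟩ := (succ_invPerm.2 h).finallyRight
  exact ⟨N, fun i hi => by simpa [invPerm] using hN i hi⟩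

lemma exists_pred {q : Bdry} (h : FinallyLeft q) : ∃ p, Succ p q := by
  obtain ⟨N, hN⟩ := h
  obtain ⟨p, hp⟩ := exists_succ (p := invPerm q) ⟨N, fun i hi => by simp [invPerm, hN i hi]⟩
  refine ⟨invPerm p, succ_invPerm.1 ?_⟩
  rwa [invPerm_invPerm]

/-! ### Conjugators of Thompson's group -/

lemma image_eq_self {α : Type*} {f : α → α} {E : Set α} (h : ∀ z ∈ E, f z = z) : f '' E = E :=
  (Set.image_congr h).trans (Set.image_id' E)

lemma inv_image_image {α : Type*} (g : Equiv.Perm α) (E : Set α) :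
    (g⁻¹ : Equiv.Perm α) '' (g '' E) = E := by
  rw [Set.image_image]; exact image_eq_self fun z _ => by simp

/-- `U` is a cone. -/
def IsCone (U : Set Bdry) : Prop := ∃ x n, U = cone x n

lemma cone_subset {x z : Bdry} {n k : ℕ} (h : cone z k ⊆ cone x n) : n ≤ k ∧ Agree x z n := by
  have hz : Agree x z n := h (self_mem_cone z k)
  refine ⟨?_, hz⟩
  by_contra hcon
  have h1 : (z.1, Function.update z.2 k (!(z.2 k))) ∈ cone z k := ⟨rfl, fun j hj => by simp [hj.ne]⟩
  have := (hz.symm.trans (h h1)).2 k (by omega)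
  simp at this

lemma cone_subset_of_agree {x z : Bdry} {n k : ℕ} (h : Agree x z n) (hk : n ≤ k) :
    cone z k ⊆ cone x n := fun _ hw => h.trans (Agree.mono hw hk)

lemma IsCone.subset_or {U V : Set Bdry} (hU : IsCone U) (hV : IsCone V) {z : Bdry} (hzU : z ∈ U)
    (hzV : z ∈ V) : U ⊆ V ∨ V ⊆ U := by
  obtain ⟨x, n, rfl⟩ := hU
  obtain ⟨y, m, rfl⟩ := hV
  rw [cone_congr hzU, cone_congr hzV]
  rcases le_total n m with h | h
  · exact Or.inr (cone_subset_of_agree (Agree.refl _ _) h)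
  · exact Or.inl (cone_subset_of_agree (Agree.refl _ _) h)

lemma IsPlanarAt.isCone_iff {g : Equiv.Perm Bdry} {x : Bdry} {n m : ℕ} (h : IsPlanarAt g x n m)
    {U : Set Bdry} (hU : U ⊆ cone x n) : IsCone (g '' U) ↔ IsCone U := by
  have key : ∀ {g : Equiv.Perm Bdry} {x : Bdry} {n m : ℕ}, IsPlanarAt g x n m → ∀ {U : Set Bdry},
      U ⊆ cone x n → IsCone U → IsCone (g '' U) := by
    rintro g x n m h _ hU ⟨z, k, rfl⟩
    obtain ⟨hk, hz⟩ := cone_subset hU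
    obtain ⟨j, rfl⟩ := Nat.exists_eq_add_of_le hk
    exact ⟨_, _, ((h.congr hz).shift j).isTreeIsoAt.image_cone⟩
  refine ⟨fun hc => ?_, key h hU⟩
  have := key h.inv (U := g '' U) ?_ hc
  · rwa [inv_image_image] at this
  · rintro _ ⟨z, hz, rfl⟩
    exact (h z (hU hz)).1

/-- The planar map of `cone x n` onto `cone y m` matches the images of the cones under `h⁻¹` that
lie in these two cones. -/
def Sim (h : Equiv.Perm Bdry) (x : Bdry) (n : ℕ) (y : Bdry) (m : ℕ) : Prop :=
  ∀ E ⊆ cone x n, IsCone (h '' E) ↔ IsCone (h '' (graft y m n '' E))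

section Sim

variable {h : Equiv.Perm Bdry}

lemma Sim.congr {x x' y y' : Bdry} {n m : ℕ} (hs : Sim h x n y m) (hx : Agree x x' n)
    (hy : Agree y y' m) : Sim h x' n y' m := by
  intro E hE
  rw [← cone_congr hx] at hE
  rw [hs E hE, show graft y m n = graft y' m n from funext (graft_congr hy n)]

lemma sim_refl {x y : Bdry} {n : ℕ} (hxy : Agree x y n) : Sim h x n y n := by
  intro E hE
  rw [image_eq_self fun z hz => graft_self (hxy.symm.trans (hE hz))]

lemma Sim.symm {x y : Bdry} {n m : ℕ} (hs : Sim h x n y m) : Sim h y m x n := by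
  intro E hE
  rw [hs (graft x n m '' E) (by rintro _ ⟨z, -, rfl⟩; exact agree_graft _ _ _ _),
    Set.image_image (graft y m n) (graft x n m), image_eq_self (f := fun z => graft y m n _)
      fun z hz => ?_]
  rw [graft_graft]
  exact graft_self (hE hz)

lemma Sim.trans {x y z : Bdry} {n m p : ℕ} (hs : Sim h x n y m) (hs' : Sim h y m z p) :
    Sim h x n z p := by
  intro E hE
  rw [hs E hE, hs' _ (by rintro _ ⟨w, -, rfl⟩; exact agree_graft _ _ _ _),
    Set.image_image (graft z p m) (graft y m n)]
  simp only [graft_graft]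

lemma Sim.child {x y z : Bdry} {n m : ℕ} (hs : Sim h x n y m) (hz : Agree x z n) (k : ℕ) :
    Sim h z (n + k) (graft y m n z) (m + k) := by
  intro E hE
  rw [hs E (hE.trans (cone_subset_of_agree hz (by omega))),
    Set.image_congr fun w hw => (graft_graft_add y m n k (hE hw)).symm]

/-- Small cones contain the images of small cones only. -/
lemma exists_small (h : Equiv.Perm Bdry) (n : ℕ) :
    ∃ M, ∀ w z k, M ≤ k → ∀ E ⊆ cone z k, ¬ cone w n ⊆ h '' E := by
  obtain ⟨M, hM⟩ := exists_bound n
    (fun w M => ∀ z k, M ≤ k → ∀ E ⊆ cone z k, ¬ cone w n ⊆ h '' E)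
    (fun x x' m hx hP => by rwa [cone_congr hx] at hP) (fun w => by
      -- A set whose image covers `cone w n` contains the preimages of `w` and `w'`, so it fits in
      -- no cone deeper than the point where these part.
      set w' : Bdry := (w.1, Function.update w.2 n (!(w.2 n)))
      have hw' : w' ∈ cone w n := ⟨rfl, fun j hj => by simp [w', hj.ne]⟩
      have hne : h⁻¹ w ≠ h⁻¹ w' := by
        refine (h⁻¹).injective.ne fun e => ?_
        have := congrFun (congrArg Prod.snd e) n
        simp [w'] at this
      obtain ⟨M, hM⟩ := exists_not_agree hne
      refine ⟨M, fun z k hk E hE hsub => hM k hk ?_⟩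
      obtain ⟨a, ha, ha'⟩ := hsub (self_mem_cone w n)
      obtain ⟨b, hb, hb'⟩ := hsub hw'
      rw [← ha', ← hb']
      simpa using Agree.trans (Agree.symm (hE ha)) (hE hb))
  refine ⟨M, fun w z k hk => ?_⟩
  obtain ⟨m, hm, h⟩ := hM w
  exact h z k (hm.trans hk)

/-- The conjugate is planar on all cones of some depth. If `E` is so small that its image covers no
cone of that depth, the image is itself a deeper cone, and planar maps keep it a cone. The bound
depends on `g`. -/
lemma exists_isCone_image (g : Equiv.Perm Bdry) (hg : IsThompsonT (h * g * h⁻¹)) :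
    ∃ M, ∀ z k, M ≤ k → ∀ E ⊆ cone z k, IsCone (h '' E) → IsCone (h '' (g '' E)) := by
  obtain ⟨n, hn⟩ := hg.isCyclicPlanar.1
  obtain ⟨M, hM⟩ := exists_small h n
  refine ⟨M, fun z k hk E hE ⟨w, j, hw⟩ => ?_⟩
  have hj : n ≤ j := by
    by_contra hcon
    refine hM w z k hk E hE ?_
    rw [hw]
    exact cone_subset_of_agree (Agree.refl _ _) (by omega)
  obtain ⟨m, hm⟩ := hn w
  have hc := (hm.isCone_iff (U := h '' E) (by
    rw [hw]; exact cone_subset_of_agree (Agree.refl _ _) hj)).2 ⟨w, j, hw⟩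
  convert hc using 1
  simp [Set.image_image]

/-- The conjugate by `h` of each element of Thompson's group is in Thompson's group. -/
def Normalizes (h : Equiv.Perm Bdry) : Prop := ∀ g, IsThompsonT g → IsThompsonT (h * g * h⁻¹)

lemma IsThompsonT.inv {g : Equiv.Perm Bdry} (hg : IsThompsonT g) : IsThompsonT g⁻¹ := by
  obtain ⟨n, hn⟩ := hg.isCyclicPlanar.1
  let t : Neretin := ⟨g, n, fun x => (hn x).imp fun _ h => h.isTreeIsoAt⟩
  have : t ∈ ThompsonT := hg
  exact ThompsonT.inv_mem this

lemma IsPlanarAt.image_eq {g : Equiv.Perm Bdry} {x : Bdry} {n m : ℕ} (h : IsPlanarAt g x n m)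
    {E : Set Bdry} (hE : E ⊆ cone x n) : graft (g x) m n '' E = g '' E :=
  Set.image_congr fun z hz => (isPlanarAt_iff.1 h z (hE hz)).symm

/-- The planar map between the two cones is induced by an element of Thompson's group. Deep inside,
this element and its inverse preserve the sets with a cone as image. -/
lemma Normalizes.exists_sim (hh : Normalizes h) (x : Bdry) (n : ℕ) (y : Bdry) (m : ℕ) :
    ∃ M, ∀ z, Agree x z n → ∀ k, M ≤ k → Sim h z (n + k) (graft y m n z) (m + k) := by
  obtain ⟨g, hg, hp, hy⟩ := exists_isPlanarAt x n y m
  obtain ⟨M, hM⟩ := exists_isCone_image g (hh g hg)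
  obtain ⟨M', hM'⟩ := exists_isCone_image g⁻¹ (hh _ hg.inv)
  refine ⟨max M M', fun z hz k hk E hE => ?_⟩
  have hp' := (hp.congr hz).shift k
  have e : graft y m n z = g z := by
    rw [isPlanarAt_iff.1 hp z hz, graft_congr hy]
  rw [e, hp'.image_eq hE]
  refine ⟨hM z _ (by omega) E hE, fun hc => ?_⟩
  have := hM' (g z) (m + k) (by omega) (g '' E) (by
    rintro _ ⟨w, hw, rfl⟩; exact (hp' w (hE hw)).1) hc
  rwa [inv_image_image] at this

/-- The type of a small cone with respect to `Sim` depends on the last `N` turns only. -/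
def HasMemory (h : Equiv.Perm Bdry) (N : ℕ) : Prop :=
  ∃ d, ∀ x n y m, d ≤ n → d ≤ m → (∀ i < N, x.2 (n + i) = y.2 (m + i)) →
    Sim h x (n + N) y (m + N)

lemma Normalizes.exists_hasMemory (hh : Normalizes h) : ∃ N, HasMemory h N := by
  let o : Bdry := (0, fun _ => false)
  -- Five planar maps generate all forgetting: three replace the first edge by that of `o`, two drop
  -- a left or a right first turn. `M` serves all five.
  choose M₁ h₁ using fun i : Fin 3 => hh.exists_sim (i, fun _ => false) 0 o 0
  choose M₂ h₂ using fun b : Bool => hh.exists_sim (0, fun _ => b) 1 o 0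
  let M := M₁ 0 + M₁ 1 + M₁ 2 + M₂ true + M₂ false
  have le₁ : ∀ i, M₁ i ≤ M := by
    intro i; fin_cases i <;> simp [M] <;> omega
  have le₂ : ∀ b, M₂ b ≤ M := by
    intro b; cases b <;> simp [M] <;> omega
  -- The first `n` turns are dropped one at a time; the remaining `k` turns stay long enough for the
  -- bound `M` at each stage.
  have drop : ∀ n x k, M ≤ k → Sim h x (n + k) (graft o 0 n x) k := by
    intro n
    induction n with
    | zero =>
      intro x k hk
      simpa using h₁ x.1 x ⟨rfl, by simp⟩ k ((le₁ _).trans hk)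
    | succ n ih =>
      intro x k hk
      have s₁ := ih x (1 + k) (by omega)
      have s₂ := h₂ (x.2 n) (graft o 0 n x) ⟨rfl, fun j hj => by
        obtain rfl : j = 0 := by omega
        simp [graft]⟩ k ((le₂ _).trans hk)
      have e : graft o 0 1 (graft o 0 n x) = graft o 0 (n + 1) x := by
        refine Prod.ext rfl (funext fun j => ?_)
        simp [graft, add_assoc]
      rw [e, zero_add] at s₂
      have := s₁.trans s₂
      rwa [← add_assoc] at this
  refine ⟨M, 0, fun x n y m _ _ hxy => ?_⟩
  have hd : Agree (graft o 0 n x) (graft o 0 m y) M := ⟨rfl, fun k hk => by simp [graft, hxy k hk]⟩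
  exact ((drop n x M le_rfl).trans (sim_refl hd)).trans (drop m y M le_rfl).symm

/-- Small left cones and small right cones are of different types. -/
def SeparatesTurns (h : Equiv.Perm Bdry) : Prop :=
  ∃ d, ∀ x n y m, d ≤ n → d ≤ m → x.2 n = false → y.2 m = true → ¬ Sim h x (n + 1) y (m + 1)

/-- If the least memory is `N + 1`, some word of `N` turns has two non-similar deep cones ending in
it, preceded by different turns. A similar pair of a deep left and a deep right cone would have
similar descendants along this word, and memory `N + 1` would transfer the similarity to those two
cones. -/
lemma Normalizes.hasMemory_or_separatesTurns (hh : Normalizes h) :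
    HasMemory h 0 ∨ SeparatesTurns h := by
  classical
  rw [or_iff_not_imp_left]
  intro h0
  have hex := hh.exists_hasMemory
  obtain ⟨N, hN⟩ : ∃ N, Nat.find hex = N + 1 :=
    Nat.exists_eq_succ_of_ne_zero fun e => h0 (e ▸ Nat.find_spec hex)
  have hmem := Nat.find_spec hex
  have hmin := Nat.find_min hex (m := N) (by omega)
  rw [hN] at hmem
  obtain ⟨d, hd⟩ := hmem
  obtain ⟨x, n, y, m, hn, hm, hx, hy, hxy, hs⟩ : ∃ x n y m, d ≤ n ∧ d ≤ m ∧ x.2 n = false ∧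
      y.2 m = true ∧ (∀ i < N, x.2 (n + 1 + i) = y.2 (m + 1 + i)) ∧
      ¬ Sim h x (n + 1 + N) y (m + 1 + N) := by
    by_contra! hcon
    refine hmin ⟨d + 1, fun x n y m hn hm hxy => ?_⟩
    obtain ⟨n, rfl⟩ := Nat.exists_eq_succ_of_ne_zero (show n ≠ 0 by omega)
    obtain ⟨m, rfl⟩ := Nat.exists_eq_succ_of_ne_zero (show m ≠ 0 by omega)
    simp only [Nat.succ_eq_add_one] at *
    by_cases he : x.2 n = y.2 m
    · have := hd x n y m (by omega) (by omega) fun i hi => by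
        rcases i with _ | i
        · simpa using he
        · have := hxy i (by omega)
          rwa [add_right_comm, add_assoc, add_right_comm m, add_assoc m] at this
      rwa [← add_assoc, ← add_assoc, add_right_comm, add_right_comm m] at this
    · cases hxn : x.2 n <;> cases hym : y.2 m
      · simp [hxn, hym] at he
      · exact hcon x n y m (by omega) (by omega) hxn hym hxy
      · exact (hcon y m x n (by omega) (by omega) hym hxn fun i hi => (hxy i hi).symm).symm
      · simp [hxn, hym] at he
  refine ⟨d, fun u p v q hp hq hu hv hsim => hs ?_⟩
  have e : ∀ i, (n + 1 + i = n + (i + 1)) := fun i => by omega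
  -- Continue `u` as `x` and `v` as `y`: the next `N` turns coincide, and including the preceding
  -- turn they are those of `x` and `y`.
  set u' := graft u (p + 1) (n + 1) x
  set v' := graft v (q + 1) (m + 1) y
  have au : Agree u u' (p + 1) := agree_graft _ _ _ _
  have av : Agree v v' (q + 1) := agree_graft _ _ _ _
  have s₁ : Sim h u' (p + 1 + N) v' (q + 1 + N) := by
    refine (hsim.child au N).congr (Agree.refl _ _) ⟨rfl, fun k hk => ?_⟩
    by_cases hkq : k < q + 1
    · exact ((agree_graft v (q + 1) (p + 1) u').symm.trans av).2 k hkq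
    · obtain ⟨i, rfl⟩ := Nat.exists_eq_add_of_le (not_lt.1 hkq)
      rw [graft_add, graft_add, graft_add]
      exact hxy i (by omega)
  have s₂ : Sim h x (n + 1 + N) u' (p + 1 + N) := by
    have := hd x n u' p hn hp fun i hi => by
      rcases i with _ | i
      · have := au.2 p (by omega)
        simp only [add_zero]
        rw [hx, ← this, hu]
      · rw [show p + (i + 1) = p + 1 + i by omega, graft_add, ← e]
    rwa [show n + 1 + N = n + (N + 1) by omega, show p + 1 + N = p + (N + 1) by omega]
  have s₃ : Sim h y (m + 1 + N) v' (q + 1 + N) := by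
    have := hd y m v' q hm hq fun i hi => by
      rcases i with _ | i
      · have := av.2 q (by omega)
        simp only [add_zero]
        rw [hy, ← this, hv]
      · rw [show q + (i + 1) = q + 1 + i by omega, graft_add, show m + (i + 1) = m + 1 + i by omega]
    rwa [show m + 1 + N = m + (N + 1) by omega, show q + 1 + N = q + (N + 1) by omega]
  exact (s₂.trans s₁).trans s₃.symm

end Sim

/-! ### Conjugators preserving the cyclic order -/

section Climb

variable {h : Equiv.Perm Bdry}

/-- If a cyclic transformation is planar on both halves of a cone and does not change the last
turns of these halves, then it is planar on the whole cone. -/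
lemma isPlanarAt_of_halves {g : Equiv.Perm Bdry} (hg : PreservesCyc g) {w : Bdry} {j : ℕ}
    {u : Bool → Bdry} {p : Bool → ℕ} (hu : ∀ b, u b ∈ half w j b)
    (hp : ∀ b, IsPlanarAt g (u b) (j + 1) (p b + 1)) (hl : ∀ b, (g (u b)).2 (p b) = b) :
    ∃ m, IsPlanarAt g w j m := by
  have key : ∀ b z, Agree (u b) z (j + 1) → (g z).2 (p b) = b := fun b z hz => by
    rw [← ((hp b) z hz).1.2 (p b) (by omega), hl]
  let a := lastEnd (u false) (j + 1)
  let c := firstEnd (u true) (j + 1)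
  have ha : Agree (u false) a (j + 1) := agree_lastEnd _ _
  have hc : Agree (u true) c (j + 1) := agree_firstEnd _ _
  have ha' : ∀ i, p false < i → (g a).2 i = true := fun i hi => by
    obtain ⟨k, rfl⟩ := Nat.exists_eq_add_of_le (show p false + 1 ≤ i from hi)
    rw [((hp false) a ha).2 k]
    exact lastEnd_of_le _ (by omega)
  have hc' : ∀ i, p true < i → (g c).2 i = false := fun i hi => by
    obtain ⟨k, rfl⟩ := Nat.exists_eq_add_of_le (show p true + 1 ≤ i from hi)
    rw [((hp true) c hc).2 k]
    exact firstEnd_of_le _ (by omega)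
  -- The last end of the left half and the first end of the right half are neighbours, hence so are
  -- their images. The left image ends in a left turn, so its successor is known explicitly, which
  -- forces both image halves to have the same depth and the same parent cone.
  have hac : Succ a c := by
    refine succ_of_agree (k := j) ?_ ?_ ?_ ?_ ?_
    · exact ((ha.mono (by omega)).symm.trans (hu false).1.symm).trans
        ((hu true).1.trans (hc.mono (by omega)))
    · rw [← ha.2 j (by omega)]; exact (hu false).2
    · rw [← hc.2 j (by omega)]; exact (hu true).2
    · exact fun i hi => lastEnd_of_le _ hi
    · exact fun i hi => firstEnd_of_le _ hi
  let q : Bdry := ((g a).1, fun i => if i < p false then (g a).2 i else decide (i = p false))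
  have hq : Agree (g a) q (p false) := ⟨rfl, fun i hi => by simp [q, hi]⟩
  have hgq : g c = q := by
    refine (hac.map hg).unique (succ_of_agree hq (key _ _ ha) ?_ ha' ?_)
    · simp [q]
    · intro i hi
      have : ¬ i < p false := by omega
      simp [q, hi.ne', this]
  have hpp : p true = p false := by
    rcases lt_trichotomy (p true) (p false) with hlt | heq | hlt
    · have h1 := hc' _ hlt
      rw [hgq] at h1
      simp [q] at h1
    · exact heq
    · have h1 := key _ _ hc
      rw [hgq] at h1
      have h2 : ¬ p true < p false := by omega
      simp [q, hlt.ne', h2] at h1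
  have hpp' : ∀ b, p b = p false := fun b => by cases b <;> simp [hpp]
  have hga : ∀ b z, Agree (u b) z (j + 1) → Agree (g a) (g z) (p false) := by
    intro b z hz
    cases b
    · exact (((hp false) a ha).1.symm.trans ((hp false) z hz).1).mono (by omega)
    · refine hq.trans ?_
      rw [← hgq]
      exact (((hp true) c hc).1.symm.trans ((hp true) z hz).1).mono (by omega)
  have hmem : ∀ z, Agree w z j → Agree (u (z.2 j)) z (j + 1) := fun z hz => by
    have h1 : z ∈ half w j (z.2 j) := ⟨hz, rfl⟩
    rwa [half_eq_cone_of_mem (hu (z.2 j))] at h1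
  refine ⟨p false, fun z hz => ⟨(hga _ _ (hmem w (Agree.refl _ _))).symm.trans
    (hga _ _ (hmem z hz)), fun k => ?_⟩⟩
  rcases k with _ | k
  · have := key _ _ (hmem z hz)
    rwa [hpp'] at this
  · have := ((hp _) z (hmem z hz)).2 k
    rw [hpp'] at this
    rw [show p false + (k + 1) = p false + 1 + k by omega, this,
      show j + 1 + k = j + (k + 1) by omega]

/-- Unlike in `exists_isCone_image`, the bound `d` is uniform in `g`. Planarity of the conjugate
`G`, known at some depth depending on `g`, climbs from halves to cones: as `g` is planar on the
given cone, `G` induces a similarity for `h⁻¹` on each half, and separation of turns forces the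
image to end in the same turn, so that `isPlanarAt_of_halves` applies. -/
lemma exists_isCone_image_of_separatesTurns (hh : Normalizes h)
    (hs : SeparatesTurns h⁻¹) : ∃ d, ∀ g x n m, IsThompsonT g → IsPlanarAt g x n m → d ≤ n →
      d ≤ m → ∀ E ⊆ cone x n, IsCone (h '' E) → IsCone (h '' (g '' E)) := by
  obtain ⟨s, hs⟩ := hs
  obtain ⟨d, hd⟩ := exists_small h (s + 1)
  have deep : ∀ z k, d ≤ k → ∀ E ⊆ cone z k, ∀ w j, h '' E = cone w j → s + 1 < j := by
    intro z k hk E hE w j hw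
    by_contra hcon
    refine hd w z k hk E hE ?_
    rw [hw]
    exact cone_subset_of_agree (Agree.refl _ _) (by omega)
  refine ⟨d, fun g x n m hg hp hn hm E hE ⟨w, j, hw⟩ => ?_⟩
  have hG := hh g hg
  set G := h * g * h⁻¹ with hGdef
  have e : ∀ F : Set Bdry, h '' (g '' (⇑h⁻¹ '' F)) = G '' F := fun F => by
    simp [hGdef, Set.image_image]
  have e' : ∀ F : Set Bdry, h '' (⇑h⁻¹ '' F) = F := fun F => by
    rw [Set.image_image]; exact image_eq_self fun z _ => by simp
  obtain ⟨N, hN⟩ := hG.isCyclicPlanar.1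
  -- Here `i` bounds the number of levels by which `j` falls short of the depth `N` where `G` is
  -- known to be planar.
  have climb : ∀ i w j, N ≤ i + j → ⇑h⁻¹ '' cone w j ⊆ cone x n → ∃ m', IsPlanarAt G w j m' := by
    intro i
    induction i with
    | zero =>
      intro w j hj _
      obtain ⟨k, rfl⟩ := Nat.exists_eq_add_of_le (show N ≤ j by omega)
      obtain ⟨m', hm'⟩ := hN w
      exact ⟨_, hm'.shift k⟩
    | succ i ih =>
      intro w j hj hsub
      let u : Bool → Bdry := fun b => (w.1, Function.update w.2 j b)
      have hu : ∀ b, u b ∈ half w j b := fun b => by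
        rw [half_eq_cone]; exact self_mem_cone _ _
      have hcu : ∀ b, cone (u b) (j + 1) ⊆ cone w j := fun b =>
        cone_subset_of_agree (hu b).1 (by omega)
      have hsu : ∀ b, ⇑h⁻¹ '' cone (u b) (j + 1) ⊆ cone x n := fun b =>
        (Set.image_mono (hcu b)).trans hsub
      choose p hp' using fun b => ih (u b) (j + 1) (by omega) (hsu b)
      -- The halves and their images come from sets inside cones of depth at least `d`, hence are
      -- deep enough for the turns to be separated.
      have hj' : s + 1 < j + 1 := deep x n hn _ (hsu false) (u false) (j + 1) (e' _)
      have hps : ∀ b, s + 1 < p b := fun b => by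
        refine deep (g x) m hm (g '' (⇑h⁻¹ '' cone (u b) (j + 1))) ?_ (G (u b)) (p b) ?_
        · rintro _ ⟨z, hz, rfl⟩
          exact (hp z (hsu b hz)).1
        · rw [e]
          exact (hp' b).isTreeIsoAt.image_cone
      choose r hr using fun b => Nat.exists_eq_add_of_le' (show 1 ≤ p b by have := hps b; omega)
      -- Under `h⁻¹` the map `G` becomes `g`, which is planar on `cone x n` and so sends exactly the
      -- cones there to cones.
      have hsim : ∀ b, Sim h⁻¹ (u b) (j + 1) (G (u b)) (r b + 1) := by
        intro b F hF
        have hF' : ⇑h⁻¹ '' F ⊆ cone x n := (Set.image_mono hF).trans (hsu b)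
        rw [← hr, (hp' b).image_eq hF, ← e, inv_image_image, hp.isCone_iff hF']
      refine isPlanarAt_of_halves hG.preservesCyc hu (p := r) (fun b => hr b ▸ hp' b) fun b => ?_
      have hub := (hu b).2
      have hrb : s ≤ r b := by have := hps b; have := hr b; omega
      by_contra hcon
      cases b
      · exact hs _ j _ _ (by omega) hrb hub (by simpa using hcon) (hsim _)
      · exact hs _ _ _ j hrb (by omega) (by simpa using hcon) hub (hsim _).symm
  have hE' : ⇑h⁻¹ '' cone w j = E := by rw [← hw, inv_image_image]
  obtain ⟨m', hm'⟩ := climb N w j (by omega) (hE'.le.trans hE)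
  refine ⟨G w, m', ?_⟩
  rw [← hm'.isTreeIsoAt.image_cone, ← e, hE']

/-- Any two deep cones are related by an element `g` of Thompson's group that is planar between
them; the uniform bound applies to `g` and to `g⁻¹`. -/
lemma hasMemory_zero_of_separatesTurns (hh : Normalizes h)
    (hs : SeparatesTurns h⁻¹) : HasMemory h 0 := by
  obtain ⟨d, hd⟩ := exists_isCone_image_of_separatesTurns hh hs
  refine ⟨d, fun x n y m hn hm _ E hE => ?_⟩
  obtain ⟨g, hg, hp, hy⟩ := exists_isPlanarAt x n y m
  simp only [add_zero] at *
  rw [show graft y m n = graft (g x) m n from funext (graft_congr hy n), hp.image_eq hE]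
  refine ⟨hd g x n m hg hp hn hm E hE, fun hc => ?_⟩
  have := hd g⁻¹ (g x) m n hg.inv hp.inv hm hn (g '' E) (by
    rintro _ ⟨w, hw, rfl⟩; exact (hp w (hE hw)).1) hc
  rwa [inv_image_image] at this

end Climb

/-- If the type of small cones does not depend on their turns, then small sets whose images are
cones are cones. -/
lemma HasMemory.exists_isCone {h : Equiv.Perm Bdry} (hc : PreservesCyc h) (hm : HasMemory h 0) :
    ∃ d, ∀ x n, d ≤ n → ∀ E ⊆ cone x n, IsCone (h '' E) → IsCone E := by
  obtain ⟨d, hd⟩ := hm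
  refine ⟨d, fun x n hn E hE ⟨w, j, hw⟩ => ?_⟩
  have hmem : ∀ z, z ∈ E ↔ Agree w (h z) j := fun z => by
    change _ ↔ h z ∈ cone w j
    rw [← hw, h.injective.mem_set_image]
  obtain ⟨v, hv⟩ := exists_notMem_cone x n
  have hv' : h v ∉ cone w j := fun h' => hv (hE ((hmem v).2 h'))
  have hlt : ∀ y ∈ E, ∀ z ∈ E, (PlanarLT y z ↔ PlanarLT (h y) (h z)) := fun y hy z hz => by
    rw [← cyc_outside_iff (hE hy) (hE hz) hv, ← hc.iff,
      cyc_outside_iff ((hmem y).1 hy) ((hmem z).1 hz) hv']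
  -- `E` is the order interval from `a` to `b`, and with `p` the depth where these part, `cone a p`
  -- is the least cone containing `E`. It remains to see that `a` and `b` are its extreme ends.
  set a := h⁻¹ (firstEnd w j) with ha
  set b := h⁻¹ (lastEnd w j) with hb
  have ha' : h a = firstEnd w j := by simp [ha]
  have hb' : h b = lastEnd w j := by simp [hb]
  have haE : a ∈ E := (hmem a).2 (ha' ▸ agree_firstEnd _ _)
  have hbE : b ∈ E := (hmem b).2 (hb' ▸ agree_lastEnd _ _)
  have hale : ∀ z ∈ E, z ≠ a → PlanarLT a z := fun z hz hne => by
    rw [hlt a haE z hz, ha']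
    exact firstEnd_lt ((hmem z).1 hz) (ha' ▸ h.injective.ne hne)
  have hble : ∀ z ∈ E, z ≠ b → PlanarLT z b := fun z hz hne => by
    rw [hlt z hz b hbE, hb']
    exact lt_lastEnd ((hmem z).1 hz) (hb' ▸ h.injective.ne hne)
  have hab : a ≠ b := fun e => by
    have h1 := congrArg (fun z => z.2 j) (ha'.symm.trans ((congrArg h e).trans hb'))
    simp [firstEnd_of_le, lastEnd_of_le] at h1
  have hltab := hble a haE hab
  have hbetween : ∀ z, PlanarLT a z → PlanarLT z b → z ∈ E := fun z h1 h2 => by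
    rw [hmem]
    by_contra hcon
    have h3 : Cyc (h b) (h a) (h z) := hc _ _ _ (Or.inr (Or.inl ⟨h1, h2⟩))
    rw [cyc_outside_iff ((hmem b).1 hbE) ((hmem a).1 haE) hcon, ← hlt b hbE a haE] at h3
    exact h3.asymm hltab
  obtain ⟨p, hp, hap, hbp⟩ := hltab.exists_agree ((Agree.symm (hE haE)).trans (hE hbE)).1
  have hnp : n ≤ p := by
    by_contra hcon
    have := ((Agree.symm (hE haE)).trans (hE hbE)).2 p (by omega)
    simp_all
  have hEK : E ⊆ cone a p := fun z hz => by
    by_cases h1 : z = a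
    · rw [h1]; exact self_mem_cone _ _
    · by_cases h2 : z = b
      · rw [h2]; exact hp
      · exact agree_of_between hp (hale z hz h1) (hble z hz h2)
  -- Otherwise let `r` be the last left turn of `b`, and copy `E` by the planar map into `cone b r`.
  -- The image of the copy is a cone too, and the copy contains `b`, so one of the two sets contains
  -- the other. But the copy misses `a` and also contains an end after `b`.
  have hbl : b = lastEnd a p := by
    by_contra hne
    obtain ⟨q, hq⟩ := exists_succ (p := h b) ⟨j, fun i hi => by rw [hb', lastEnd_of_le _ hi]⟩
    obtain ⟨N, hN⟩ : ∃ N, ∀ i, N ≤ i → b.2 i = true := by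
      have := (hq.map hc.inv).finallyRight
      simpa using this
    obtain ⟨i, hi, hbi⟩ : ∃ i, p ≤ i ∧ b.2 i = false := by
      by_contra! hcon
      refine hne (eq_of_agree (hp.symm.trans (agree_lastEnd _ _)) fun k => ?_)
      rw [lastEnd_of_le _ (by omega)]
      simpa using hcon (p + k) (by omega)
    obtain ⟨r, hpr, hr, hr'⟩ := exists_last (b := false) hN hi hbi
    have hpr : p < r := lt_of_le_of_ne hpr (by rintro rfl; simp_all)
    have hcone : IsCone (h '' (graft b r p '' E)) :=
      ((hd a p b r (by omega) (by omega) (by simp)) E hEK).1 ⟨w, j, hw⟩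
    -- The last end of the left half of `cone a p`; it belongs to `E` and is copied onto `b`.
    let c := lastEnd (a.1, Function.update a.2 p false) (p + 1)
    have hca : Agree a c p := ⟨rfl, fun i hi => by
      simp only [c, lastEnd, if_pos (show i < p + 1 by omega), Function.update_of_ne hi.ne]⟩
    have hcp : c.2 p = false := by simp [c, lastEnd]
    have hcE : c ∈ E := by
      by_cases h1 : c = a
      · rwa [h1]
      · refine hbetween c ?_ (planarLT_of_agree (hca.symm.trans hp) hcp hbp)
        refine lt_lastEnd ⟨rfl, fun i hi => ?_⟩ (Ne.symm h1)
        rcases Nat.lt_succ_iff_lt_or_eq.1 hi with hi | rfl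
        · simp [hi.ne]
        · simp [hap]
    have hbE' : b ∈ graft b r p '' E := ⟨c, hcE, (eq_graft (Agree.refl _ _) fun k => by
      rcases k with _ | k
      · simp [hr, hcp]
      · rw [hr' _ (by omega)]
        exact (lastEnd_of_le _ (by omega)).symm).symm⟩
    rcases IsCone.subset_or ⟨w, j, hw⟩ hcone ⟨b, hbE, rfl⟩ ⟨b, hbE', rfl⟩ with hsub | hsub
    · obtain ⟨z, hz, hza⟩ := (Set.image_subset_image_iff h.injective).1 hsub haE
      have := (agree_graft b r p z).2 p hpr
      rw [hza] at this
      simp_all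
    · have h1 : graft b r p b ∈ E :=
        (Set.image_subset_image_iff h.injective).1 hsub ⟨b, hbE, rfl⟩
      have h2 : (graft b r p b).2 r = true := by simpa [hbp] using graft_add b r p b 0
      have h3 := planarLT_of_agree (agree_graft b r p b) hr h2
      exact h3.asymm (hble _ h1 h3.ne.symm)
  -- The mirror image of the preceding argument, with predecessors and the last right turn of `a`.
  have haf : a = firstEnd a p := by
    by_contra hne
    obtain ⟨q, hq⟩ := exists_pred (q := h a) ⟨j, fun i hi => by rw [ha', firstEnd_of_le _ hi]⟩
    obtain ⟨N, hN⟩ : FinallyLeft a := by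
      have := (hq.map hc.inv).finallyLeft
      simpa using this
    obtain ⟨i, hi, hai⟩ : ∃ i, p ≤ i ∧ a.2 i = true := by
      by_contra! hcon
      refine hne (eq_of_agree (agree_firstEnd _ _) fun k => ?_)
      rw [firstEnd_of_le _ (by omega)]
      simpa using hcon (p + k) (by omega)
    obtain ⟨r, hpr, hr, hr'⟩ := exists_last (b := true) hN hi hai
    have hpr : p < r := lt_of_le_of_ne hpr (by rintro rfl; simp_all)
    have hcone : IsCone (h '' (graft a r p '' E)) :=
      ((hd a p a r (by omega) (by omega) (by simp)) E hEK).1 ⟨w, j, hw⟩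
    let c := firstEnd (a.1, Function.update a.2 p true) (p + 1)
    have hca : Agree a c p := ⟨rfl, fun i hi => by
      simp only [c, firstEnd, if_pos (show i < p + 1 by omega), Function.update_of_ne hi.ne]⟩
    have hcp : c.2 p = true := by simp [c, firstEnd]
    have hcE : c ∈ E := by
      by_cases h1 : c = b
      · rwa [h1]
      · refine hbetween c (planarLT_of_agree hca hap hcp) ?_
        refine firstEnd_lt ⟨hp.1, fun i hi => ?_⟩ (Ne.symm h1)
        rcases Nat.lt_succ_iff_lt_or_eq.1 hi with hi | rfl
        · simp [hi.ne, hp.2 i hi]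
        · simp [hbp]
    have haE' : a ∈ graft a r p '' E := ⟨c, hcE, (eq_graft (Agree.refl _ _) fun k => by
      rcases k with _ | k
      · simp [hr, hcp]
      · rw [hr' _ (by omega)]
        exact (firstEnd_of_le _ (by omega)).symm).symm⟩
    rcases IsCone.subset_or ⟨w, j, hw⟩ hcone ⟨a, haE, rfl⟩ ⟨a, haE', rfl⟩ with hsub | hsub
    · obtain ⟨z, hz, hzb⟩ := (Set.image_subset_image_iff h.injective).1 hsub hbE
      have := (agree_graft a r p z).2 p hpr
      rw [hzb] at this
      simp_all
    · have h1 : graft a r p a ∈ E :=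
        (Set.image_subset_image_iff h.injective).1 hsub ⟨a, haE, rfl⟩
      have h2 : (graft a r p a).2 r = false := by simpa [hap] using graft_add a r p a 0
      have h3 := planarLT_of_agree (agree_graft a r p a).symm h2 hr
      exact h3.asymm (hale _ h1 h3.ne)
  refine ⟨a, p, hEK.antisymm fun z hz => ?_⟩
  by_cases h1 : z = a
  · rwa [h1]
  · by_cases h2 : z = b
    · rwa [h2]
    · refine hbetween z ?_ ?_
      · rw [haf]; exact firstEnd_lt hz (haf ▸ h1)
      · rw [hbl]; exact lt_lastEnd hz (hbl ▸ h2)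

/-- A cyclic transformation which maps the cones in a given cone to cones is planar there. -/
lemma PreservesCyc.exists_isPlanarAt {g : Equiv.Perm Bdry} (hg : PreservesCyc g) {w : Bdry} {n : ℕ}
    (hU : ∀ U ⊆ cone w n, IsCone U → IsCone (g '' U)) : ∃ m, IsPlanarAt g w n m := by
  -- The image of a half is a cone properly inside, hence lies in a half. By surjectivity the two
  -- halves go to different halves, and the order seen from an end outside forbids an exchange.
  have step : ∀ z k p, cone z k ⊆ cone w n → g '' cone z k = cone (g z) p →
      ∀ b, g '' half z k b = half (g z) p b := by
    intro z k p hsub himg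
    have hone : ∀ b, ∃ c, g '' half z k b ⊆ half (g z) p c ∧ ∀ y ∈ half z k b, (g y).2 p = c := by
      intro b
      obtain ⟨y, q, hq⟩ := hU (half z k b) ((half_subset _ _ _).trans hsub) ⟨_, _, half_eq_cone _ _ _⟩
      have h1 : cone y q ⊆ cone (g z) p := by
        rw [← hq, ← himg]; exact Set.image_mono (half_subset _ _ _)
      obtain ⟨h2, h3⟩ := cone_subset h1
      have h4 : p ≠ q := by
        rintro rfl
        rw [← cone_congr h3, ← himg] at hq
        obtain ⟨a, ha⟩ := half_nonempty z k (!b)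
        have h5 : a ∈ half z k b := by
          rw [g.injective.image_injective hq]; exact ha.1
        have := h5.2.symm.trans ha.2
        simp at this
      have h5 : ∀ y' ∈ cone y q, y' ∈ half (g z) p (y.2 p) := fun y' hy' =>
        ⟨h1 hy', (hy'.2 p (by omega)).symm⟩
      refine ⟨y.2 p, by rw [hq]; exact h5, fun a ha => (h5 (g a) ?_).2⟩
      rw [← hq]; exact ⟨a, ha, rfl⟩
    choose c hc hc' using hone
    obtain ⟨y₀, hy₀⟩ := half_nonempty z k false
    obtain ⟨y₁, hy₁⟩ := half_nonempty z k true
    have hlt : PlanarLT (g y₀) (g y₁) := by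
      obtain ⟨v, hv⟩ := exists_notMem_cone z k
      have hv' : g v ∉ cone (g z) p := by
        rw [← himg, g.injective.mem_set_image]; exact hv
      have hi : ∀ y ∈ cone z k, g y ∈ cone (g z) p := fun y hy => himg ▸ ⟨y, hy, rfl⟩
      rw [← cyc_outside_iff (hi _ hy₀.1) (hi _ hy₁.1) hv', hg.iff, cyc_outside_iff hy₀.1 hy₁.1 hv]
      exact planarLT_of_agree (Agree.trans (Agree.symm hy₀.1) hy₁.1) hy₀.2 hy₁.2
    have hne : c false ≠ c true := by
      intro he
      obtain ⟨a, ha⟩ := half_nonempty (g z) p (!(c true))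
      obtain ⟨y, hy, rfl⟩ := himg.symm.le ha.1
      have h1 := hc' (y.2 k) y ⟨hy, rfl⟩
      rw [ha.2] at h1
      cases h2 : y.2 k <;> simp [h2, he] at h1
    have hc0 : c false = false := by
      by_contra hcon
      have h0 : c false = true := by simpa using hcon
      have h1 : c true = false := by cases h : c true <;> simp_all
      exact hlt.asymm (planarLT_of_agree
        (Agree.trans (Agree.symm (hc true ⟨_, hy₁, rfl⟩).1) (hc false ⟨_, hy₀, rfl⟩).1)
        ((hc' true y₁ hy₁).trans h1) ((hc' false y₀ hy₀).trans h0))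
    have hcb : ∀ b, c b = b := by
      intro b; cases b
      · exact hc0
      · cases h : c true <;> simp_all
    intro b
    refine Set.Subset.antisymm (by simpa [hcb] using hc b) fun a ha => ?_
    obtain ⟨y, hy, rfl⟩ := himg.symm.le ha.1
    refine ⟨y, ⟨hy, ?_⟩, rfl⟩
    have h1 := hc' (y.2 k) y ⟨hy, rfl⟩
    rw [hcb] at h1
    rw [← h1, ha.2]
  obtain ⟨y, m, hm⟩ := hU _ subset_rfl ⟨w, n, rfl⟩
  have hw : g '' cone w n = cone (g w) m := by
    have h1 : g w ∈ cone y m := hm ▸ ⟨w, self_mem_cone _ _, rfl⟩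
    rw [hm, cone_congr h1]
  have main : ∀ k z, Agree w z n → g '' cone z (n + k) = cone (g z) (m + k) := by
    intro k
    induction k with
    | zero =>
      intro z hz
      have h1 : g z ∈ cone (g w) m := by rw [← hw]; exact ⟨z, hz, rfl⟩
      rw [add_zero, add_zero, ← cone_congr hz, hw, cone_congr h1]
    | succ k ih =>
      intro z hz
      have h1 := step z _ _ (cone_subset_of_agree hz (by omega)) (ih z hz) (z.2 (n + k))
      have h2 : z ∈ half z (n + k) (z.2 (n + k)) := ⟨Agree.refl _ _, rfl⟩
      have h3 : g z ∈ half (g z) (m + k) (z.2 (n + k)) := h1 ▸ ⟨z, h2, rfl⟩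
      rwa [half_eq_cone_of_mem h2, half_eq_cone_of_mem h3] at h1
  refine ⟨m, fun z hz => ⟨?_, fun k => ?_⟩⟩
  · have : g z ∈ cone (g w) m := by rw [← hw]; exact ⟨z, hz, rfl⟩
    exact this
  · have h1 := step z _ _ (cone_subset_of_agree hz (by omega)) (main k z hz) (z.2 (n + k))
    have h3 : g z ∈ half (g z) (m + k) (z.2 (n + k)) := h1 ▸ ⟨z, ⟨Agree.refl _ _, rfl⟩, rfl⟩
    exact h3.2

/-! ### The topology of the boundary in terms of cones. -/

lemma isOpen_cone (x : Bdry) (n : ℕ) : IsOpen (cone x n) := by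
  have : cone x n = (Prod.fst ⁻¹' {x.1}) ∩ ⋂ k ∈ Finset.range n, {y : Bdry | y.2 k = x.2 k} := by
    ext y
    simp [cone, Agree, eq_comm]
  rw [this]
  refine ((isOpen_discrete _).preimage continuous_fst).inter
    (isOpen_biInter_finset fun k _ => ?_)
  exact (isOpen_discrete ({x.2 k} : Set Bool)).preimage
    ((continuous_apply (A := fun _ : ℕ => Bool) k).comp (continuous_snd (X := Fin 3)))

lemma cone_mem_nhds (x : Bdry) (n : ℕ) : cone x n ∈ nhds x :=
  (isOpen_cone x n).mem_nhds (self_mem_cone x n)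

lemma exists_cone_subset {U : Set Bdry} (hU : IsOpen U) {x : Bdry} (hx : x ∈ U) :
    ∃ m, cone x m ⊆ U := by
  obtain ⟨u, v, -, hv, h1, h2, huv⟩ := isOpen_prod_iff.1 hU x.1 x.2 hx
  obtain ⟨I, w, hw, hI⟩ := isOpen_pi_iff.1 hv x.2 h2
  refine ⟨I.sup id + 1, fun y hy => huv ⟨hy.1 ▸ h1, hI fun a ha => ?_⟩⟩
  rw [← hy.2 a (Nat.lt_succ_of_le (Finset.le_sup (f := id) ha))]
  exact (hw a ha).2

/-- Uniform continuity on the compact boundary, measured by depths of cones. -/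
lemma exists_uniform_cone {f : Bdry → Bdry} (hf : Continuous f) (n : ℕ) :
    ∃ m, ∀ x, f '' cone x m ⊆ cone (f x) n := by
  have hloc : ∀ x, ∃ m, f '' cone x m ⊆ cone (f x) n := by
    intro x
    obtain ⟨m, hm⟩ := exists_cone_subset ((isOpen_cone (f x) n).preimage hf) (self_mem_cone (f x) n)
    exact ⟨m, Set.image_subset_iff.2 hm⟩
  choose m hm using hloc
  obtain ⟨t, ht⟩ := CompactSpace.elim_nhds_subcover (fun x => cone x (m x))
    (fun x => cone_mem_nhds x _)
  refine ⟨t.sup m, fun x => ?_⟩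
  have hx : x ∈ ⋃ y ∈ t, cone y (m y) := ht ▸ Set.mem_univ x
  simp only [Set.mem_iUnion] at hx
  obtain ⟨y, hy, hxy⟩ := hx
  have h1 : f x ∈ cone (f y) n := hm y ⟨x, hxy, rfl⟩
  rw [← cone_congr h1]
  exact (Set.image_mono (cone_subset_of_agree hxy (Finset.le_sup hy))).trans (hm y)

/-- Continuity makes the preimages of small cones lie in deep cones, so by `HasMemory.exists_isCone`
they are cones. Hence `h⁻¹` sends small cones to cones and is piecewise planar. -/
lemma HasMemory.isThompsonT {h : Equiv.Perm Bdry} (hc : PreservesCyc h) (hm : HasMemory h 0)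
    (hcont : Continuous ⇑h⁻¹) : IsThompsonT h := by
  obtain ⟨d, hd⟩ := hm.exists_isCone hc
  obtain ⟨n, hn⟩ := exists_uniform_cone hcont d
  rw [← inv_inv h]
  refine (IsCyclicPlanar.isThompsonT ⟨⟨n, fun x => hc.inv.exists_isPlanarAt fun U hU hUc =>
    hd (h⁻¹ x) d le_rfl _ ((Set.image_mono hU).trans (hn x)) ?_⟩, hc.inv⟩).inv
  rwa [Set.image_image, image_eq_self fun z _ => by simp]

/-- Homeomorphisms which preserve the cyclic order and normalize Thompson's group belong to it. -/
theorem isThompsonT_of_normalizes {h : Equiv.Perm Bdry} (hc : PreservesCyc h) (hh : Normalizes h)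
    (hh' : Normalizes h⁻¹) (hcont : Continuous ⇑h) (hcont' : Continuous ⇑h⁻¹) : IsThompsonT h := by
  -- The dichotomy is applied to the inverse: no turn matters either for `h⁻¹`, or, by climbing, for
  -- `h`.
  rcases hh'.hasMemory_or_separatesTurns with h1 | h1
  · rw [← inv_inv h]
    exact (h1.isThompsonT hc.inv (by simpa using hcont)).inv
  · exact (hasMemory_zero_of_separatesTurns hh h1).isThompsonT hc hcont'

/-! ### Automorphisms of Thompson's group -/

lemma IsThompsonT.continuous {g : Equiv.Perm Bdry} (hg : IsThompsonT g) : Continuous g := by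
  obtain ⟨n, hn⟩ := hg.isCyclicPlanar.1
  refine continuous_def.2 fun U hU => isOpen_iff_mem_nhds.2 fun x hx => ?_
  obtain ⟨k, hk⟩ := exists_cone_subset hU hx
  obtain ⟨m, hm⟩ := hn x
  refine Filter.mem_of_superset (cone_mem_nhds x (n + k)) fun y hy => hk ?_
  exact ((hm.shift k) y hy).1.mono (by omega)

instance : ContinuousConstSMul ThompsonT Bdry where
  continuous_const_smul t := IsThompsonT.continuous t.2

instance : FaithfulSMul ThompsonT Bdry where
  eq_of_smul_eq_smul h := Subtype.ext (Subtype.ext (Equiv.ext h))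

lemma exists_thompsonT_cone (x : Bdry) (n : ℕ) : ∃ g : ThompsonT,
    (∀ z, z ∉ cone x n → g • z = z) ∧ (∀ z ∈ half x n false, g • z = graft z (n + 1) n z) ∧
    ∀ z ∈ cone x n, ∀ k, ∃ w ∈ cone z k, g • w ≠ w := by
  obtain ⟨g, hg, h⟩ := exists_isThompsonT_cone x n
  obtain ⟨N, hN⟩ := hg.isCyclicPlanar.1
  exact ⟨⟨⟨g, N, fun x => (hN x).imp fun _ h => h.isTreeIsoAt⟩, hg⟩, h⟩

/-- The element supported in a cone has infinite order: it inserts a left turn in the left half, and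
so it pushes each `z i`, with `i + 1` left turns from depth `n` on, to `z (i + 1)`. -/
lemma locallyMoving_thompsonT : LocallyMoving ThompsonT Bdry := by
  rintro U hU ⟨x, hx⟩
  obtain ⟨n, hn⟩ := exists_cone_subset hU hx
  obtain ⟨g, h1, h2, -⟩ := exists_thompsonT_cone x n
  refine ⟨g, fun z hz => h1 z fun h => hz (hn h), fun he => ?_⟩
  let z : ℕ → Bdry := fun i => (x.1, fun k => if k < n then x.2 k else decide (n + i < k))
  have hz : ∀ i, z i ∈ half x n false := fun i =>
    ⟨⟨rfl, fun k hk => by simp [z, hk]⟩, by simp [z]⟩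
  have hstep : ∀ i, g • z i = z (i + 1) := fun i => by
    rw [h2 _ (hz i)]
    refine (eq_graft (y := z i) (w := z (i + 1)) ⟨rfl, fun k hk => ?_⟩ fun k => ?_).symm
    · by_cases hkn : k < n
      · simp [z, hkn]
      · obtain rfl : k = n := by omega
        simp [z]
    · have : ¬ n + 1 + k < n := by omega
      simp [z, this]
      omega
  have hpow : ∀ i, g ^ i • z 0 = z i := fun i => by
    induction i with
    | zero => simp
    | succ i ih => rw [pow_succ', mul_smul, ih, hstep]
  have h3 := hpow 12
  rw [he, one_smul] at h3
  have h4 := congrFun (congrArg Prod.snd h3) (n + 1)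
  simp [z] at h4

lemma mem_closedSupport_iff (f : ThompsonT) (x : Bdry) :
    x ∈ closedSupport Bdry f ↔ ∀ k, ∃ w ∈ cone x k, f • w ≠ w := by
  rw [closedSupport, mem_closure_iff]
  constructor
  · intro h k
    obtain ⟨w, hw, hw'⟩ := h _ (isOpen_cone x k) (self_mem_cone x k)
    exact ⟨w, hw, hw'⟩
  · intro h U hU hx
    obtain ⟨k, hk⟩ := exists_cone_subset hU hx
    obtain ⟨w, hw, hw'⟩ := h k
    exact ⟨w, hk hw, hw'⟩

/-- A change of depth would be visible in the subcone through one altered turn, so the depths agree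
and the planar map is trivial. Thus a cone of planarity is either fixed pointwise or inside the
closed support, which makes closed supports open. -/
lemma IsPlanarAt.eq_self_of_eq_self {g : Equiv.Perm Bdry} {x z : Bdry} {n m k : ℕ}
    (h : IsPlanarAt g x n m) (hz : z ∈ cone x n) (hid : ∀ w ∈ cone z k, g w = w) :
    ∀ w ∈ cone x n, g w = w := by
  have hp := h.congr hz
  have hgz := hid z (self_mem_cone z k)
  have hnm : m = n := by
    by_contra hne
    let w : Bdry := (z.1, Function.update z.2 (m + (n + k)) (!(z.2 (n + (n + k)))))
    have hw : ∀ i, i ≤ n + k → Agree z w i := fun i hi => ⟨rfl, fun j hj => by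
      simp [w, show j ≠ m + (n + k) by omega]⟩
    have h1 := (hp w (hw n (by omega))).2 (n + k)
    rw [hid w (hw k (by omega))] at h1
    simp [w, Ne.symm hne] at h1
  subst hnm
  intro w hw
  have hzw : Agree z w m := Agree.trans (Agree.symm hz) hw
  rw [isPlanarAt_iff.1 hp w hzw, hgz, graft_self hzw]

lemma clopenSupports_thompsonT : ClopenSupports ThompsonT Bdry where
  isOpen f := by
    obtain ⟨n, hn⟩ := f.2.isCyclicPlanar.1
    refine isOpen_iff_mem_nhds.2 fun x hx => ?_
    refine Filter.mem_of_superset (cone_mem_nhds x n) fun z hz => ?_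
    rw [mem_closedSupport_iff] at hx ⊢
    by_contra! hcon
    obtain ⟨k, hk⟩ := hcon
    obtain ⟨m, hm⟩ := hn x
    obtain ⟨w, hw, hw'⟩ := hx n
    exact hw' (hm.eq_self_of_eq_self hz hk w hw)
  basis x U hU hx := by
    obtain ⟨n, hn⟩ := exists_cone_subset hU hx
    obtain ⟨g, h1, -, h2⟩ := exists_thompsonT_cone x n
    refine ⟨g, (mem_closedSupport_iff _ _).2 (h2 x (self_mem_cone x n)), fun z hz => ?_⟩
    by_contra hzU
    obtain ⟨w, hw, hw'⟩ := (mem_closedSupport_iff _ _).1 hz n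
    exact hw' (h1 w fun h => hzU (hn (Agree.trans h (Agree.symm hw))))

lemma exists_homeomorph_of_mulAut (φ : MulAut ThompsonT) : ∃ h : Bdry ≃ₜ Bdry,
    ∀ t : ThompsonT, (((φ t : ThompsonT) : Neretin) : Equiv.Perm Bdry) =
      h.toEquiv * ((t : Neretin) : Equiv.Perm Bdry) * (h.toEquiv : Equiv.Perm Bdry)⁻¹ := by
  obtain ⟨h, hh⟩ := clopenSupports_thompsonT.exists_homeomorph locallyMoving_thompsonT φ
  refine ⟨h, fun t => Equiv.ext fun x => ?_⟩
  have h1 := hh t (h.symm x)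
  rw [h.apply_symm_apply] at h1
  exact h1.symm

lemma IsThompsonT.conj_invPerm {g : Equiv.Perm Bdry} (hg : IsThompsonT g) :
    IsThompsonT (invPerm * g * invPerm⁻¹) := by
  have hinv : invPerm⁻¹ = invPerm := rfl
  obtain ⟨⟨n, hn⟩, hc⟩ := hg.isCyclicPlanar
  rw [hinv]
  refine IsCyclicPlanar.isThompsonT ⟨⟨n, fun x => ?_⟩, fun x y z h => ?_⟩
  · obtain ⟨m, hm⟩ := hn (invPerm x)
    refine ⟨m, fun y hy => ?_⟩
    obtain ⟨h1, h2⟩ := hm (invPerm y) ⟨by simp [invPerm, hy.1], fun k hk => by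
      simp [invPerm, hy.2 k hk]⟩
    refine ⟨⟨by simpa [invPerm] using h1.1, fun k hk => by simpa [invPerm] using h1.2 k hk⟩,
      fun k => ?_⟩
    have := h2 k
    simp only [invPerm, Equiv.Perm.coe_mul, Function.comp_apply, Equiv.coe_fn_mk] at this ⊢
    rw [this, Bool.not_not]
  · simp only [Equiv.Perm.coe_mul, Function.comp_apply]
    rw [cyc_invPerm]
    have h1 : Cyc (invPerm x) (invPerm z) (invPerm y) := cyc_invPerm.2 h
    exact hc _ _ _ h1

/-! ### Orientation of the normalizing homeomorphisms. -/

lemma planarLT_congr {x y x' y' : Bdry} {n : ℕ} (h : PlanarLT x y) (hn : ¬ Agree x y n)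
    (hx : Agree x x' n) (hy : Agree y y' n) : PlanarLT x' y' :=
  (h.congr_left hx hn).congr_right hy fun h' => hn (hx.trans h'.symm)

lemma Cyc.exists_congr {x y z : Bdry} (h : Cyc x y z) : ∃ N, ∀ x' y' z', Agree x x' N →
    Agree y y' N → Agree z z' N → Cyc x' y' z' := by
  obtain ⟨n₁, h₁⟩ := exists_not_agree h.ne
  obtain ⟨n₂, h₂⟩ := exists_not_agree h.rotate.ne
  obtain ⟨n₃, h₃⟩ := exists_not_agree h.rotate.rotate.ne
  let N := n₁ + n₂ + n₃
  have k₁ := h₁ N (by omega)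
  have k₂ := h₂ N (by omega)
  have k₃ := h₃ N (by omega)
  refine ⟨N, fun x' y' z' hx hy hz => ?_⟩
  rcases h with ⟨a, b⟩ | ⟨a, b⟩ | ⟨a, b⟩
  · exact Or.inl ⟨planarLT_congr a k₁ hx hy, planarLT_congr b k₂ hy hz⟩
  · exact Or.inr (Or.inl ⟨planarLT_congr a k₂ hy hz, planarLT_congr b k₃ hz hx⟩)
  · exact Or.inr (Or.inr ⟨planarLT_congr a k₃ hz hx, planarLT_congr b k₁ hx hy⟩)

/-- Dyadic ends are dense, and the cyclic position of a triple and of its image are open conditions.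
A reversed triple would yield a reversed dyadic one. -/
lemma preservesCyc_of_finallyLeft {g : Equiv.Perm Bdry} (hg : Continuous g)
    (h : ∀ x y z, FinallyLeft x → FinallyLeft y → FinallyLeft z → Cyc x y z →
      Cyc (g x) (g y) (g z)) : PreservesCyc g := by
  intro x y z hc
  rcases Cyc.total (g.injective.ne hc.ne) (g.injective.ne hc.rotate.ne)
    (g.injective.ne hc.rotate.rotate.ne.symm) with h1 | h1
  · exact h1
  · obtain ⟨N, hN⟩ := hc.exists_congr
    obtain ⟨M, hM⟩ := h1.exists_congr
    obtain ⟨m, hm⟩ := exists_uniform_cone hg M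
    have hf : ∀ x n, FinallyLeft (firstEnd x n) := fun x n => ⟨n, fun j hj => firstEnd_of_le x hj⟩
    have ha : ∀ x, Agree x (firstEnd x (N + m)) N := fun x => (agree_firstEnd x _).mono (by omega)
    have hb : ∀ x, Agree (g x) (g (firstEnd x (N + m))) M := fun x =>
      hm x ⟨_, (agree_firstEnd x _).mono (by omega), rfl⟩
    exact ((h _ _ _ (hf x (N + m)) (hf y (N + m)) (hf z (N + m))
      (hN _ _ _ (ha x) (ha y) (ha z))).asymm (hM _ _ _ (hb x) (hb z) (hb y))).elim

lemma continuous_invPerm : Continuous invPerm :=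
  ((continuous_of_discreteTopology (f := Fin.rev (n := 3))).comp
    (continuous_fst (Y := ℕ → Bool))).prodMk (continuous_pi fun k =>
      (continuous_of_discreteTopology (f := Bool.not)).comp
        ((continuous_apply (A := fun _ : ℕ => Bool) k).comp (continuous_snd (X := Fin 3))))

/-- Every positive dyadic triple is `t` applied to a fixed one, and the conjugate of `t` by `g`
preserves the cyclic order. So the image of the fixed triple decides the orientation of all images.
-/
lemma preservesCyc_or {g : Equiv.Perm Bdry} (hg : Continuous g) (hn : Normalizes g) :
    PreservesCyc g ∨ PreservesCyc (invPerm * g) := by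
  let p : Fin 3 → Bdry := fun i => (i, fun _ => false)
  have hp : ∀ i, FinallyLeft (p i) := fun i => ⟨0, fun _ _ => rfl⟩
  have hc : Cyc (p 0) (p 1) (p 2) := Or.inl ⟨Or.inl (by decide), Or.inl (by decide)⟩
  have hg' : Continuous (invPerm * g) := continuous_invPerm.comp hg
  have key : ∀ x y z, FinallyLeft x → FinallyLeft y → FinallyLeft z → Cyc x y z →
      ∃ t, IsThompsonT t ∧ g x = t (g (p 0)) ∧ g y = t (g (p 1)) ∧ g z = t (g (p 2)) := by
    intro x y z hx hy hz hxyz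
    obtain ⟨t, ht, h0, h1, h2⟩ :=
      exists_isThompsonT_triple hc hxyz (hp 0) (hp 1) (hp 2) hx hy hz
    exact ⟨_, hn t ht, by simp [h0], by simp [h1], by simp [h2]⟩
  rcases Cyc.total (g.injective.ne hc.ne) (g.injective.ne hc.rotate.ne)
    (g.injective.ne hc.rotate.rotate.ne.symm) with h1 | h1
  · refine Or.inl (preservesCyc_of_finallyLeft hg fun x y z hx hy hz hxyz => ?_)
    obtain ⟨t, ht, e1, e2, e3⟩ := key x y z hx hy hz hxyz
    rw [e1, e2, e3]
    exact ht.preservesCyc _ _ _ h1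
  · refine Or.inr (preservesCyc_of_finallyLeft hg' fun x y z hx hy hz hxyz => ?_)
    obtain ⟨t, ht, e1, e2, e3⟩ := key x y z hx hy hz hxyz
    simp only [Equiv.Perm.coe_mul, Function.comp_apply]
    rw [cyc_invPerm, e1, e2, e3]
    exact ht.preservesCyc _ _ _ h1

lemma isThompsonT_or {g : Equiv.Perm Bdry} (hg : Continuous g) (hg' : Continuous ⇑g⁻¹)
    (hn : Normalizes g) (hn' : Normalizes g⁻¹) : IsThompsonT g ∨ IsThompsonT (invPerm * g) := by
  have hinv : invPerm⁻¹ = invPerm := rfl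
  refine (preservesCyc_or hg hn).imp (fun h => isThompsonT_of_normalizes h hn hn' hg hg') fun h => ?_
  refine isThompsonT_of_normalizes h (fun t ht => ?_) (fun t ht => ?_)
    (continuous_invPerm.comp hg) ?_
  · have := (hn t ht).conj_invPerm
    simpa only [mul_inv_rev, mul_assoc] using this
  · have := hn' _ ht.conj_invPerm
    simpa only [mul_inv_rev, mul_assoc, inv_inv, hinv] using this
  · rw [mul_inv_rev]
    exact hg'.comp continuous_invPerm

lemma inversion_inv : inversion⁻¹ = inversion := rfl

lemma inversion_mul_self : inversion * inversion = 1 :=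
  Subtype.ext (Equiv.ext invPerm_invPerm)

lemma conj_inversion_mem {t : Neretin} (ht : t ∈ ThompsonT) :
    inversion * t * inversion⁻¹ ∈ ThompsonT := IsThompsonT.conj_invPerm ht

/-- The automorphism of Thompson's group induced by the orientation-reversing involution. -/
def inversionAut : MulAut ThompsonT where
  toFun t := ⟨inversion * t * inversion⁻¹, conj_inversion_mem t.2⟩
  invFun t := ⟨inversion * t * inversion⁻¹, conj_inversion_mem t.2⟩
  left_inv t := Subtype.ext (by
    simp only [inversion_inv, mul_assoc, inversion_mul_self, mul_one]
    rw [← mul_assoc, inversion_mul_self, one_mul])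
  right_inv t := Subtype.ext (by
    simp only [inversion_inv, mul_assoc, inversion_mul_self, mul_one]
    rw [← mul_assoc, inversion_mul_self, one_mul])
  map_mul' s t := Subtype.ext (by simp)

lemma coe_inversionAut (t : ThompsonT) :
    ((inversionAut t : ThompsonT) : Neretin) = inversion * t * inversion⁻¹ := rfl

lemma inversionAut_mul_self : inversionAut * inversionAut = 1 :=
  MulEquiv.ext fun t => inversionAut.left_inv t

/-- Every automorphism of Thompson's group is a conjugation by an element of this group, possibly
followed by the conjugation by the involution. -/
theorem mulAut_thompsonT (φ : MulAut ThompsonT) :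
    ∃ k : ThompsonT, φ = MulAut.conj k ∨ φ = inversionAut * MulAut.conj k := by
  obtain ⟨h, hh⟩ := exists_homeomorph_of_mulAut φ
  obtain ⟨h', hh'⟩ : ∃ h' : Equiv.Perm Bdry, h' = h.toEquiv := ⟨_, rfl⟩
  rw [← hh'] at hh
  have lift : ∀ g, IsThompsonT g → ∃ t : ThompsonT, ((t : Neretin) : Equiv.Perm Bdry) = g :=
    fun g hg => by
      obtain ⟨N, hN⟩ := hg.isCyclicPlanar.1
      exact ⟨⟨⟨g, N, fun x => (hN x).imp fun _ h => h.isTreeIsoAt⟩, hg⟩, rfl⟩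
  have hn : Normalizes h' := fun g hg => by
    obtain ⟨t, rfl⟩ := lift g hg
    rw [← hh]
    exact (φ t).2
  have hn' : Normalizes h'⁻¹ := fun g hg => by
    obtain ⟨t, rfl⟩ := lift g hg
    have h1 := hh (φ.symm t)
    rw [MulEquiv.apply_symm_apply] at h1
    rw [h1]
    have h2 : IsThompsonT ((φ.symm t : ThompsonT) : Neretin).1 := (φ.symm t).2
    simpa [mul_assoc] using h2
  have hc : Continuous h' := hh' ▸ h.continuous
  have hc' : Continuous ⇑h'⁻¹ := by rw [hh']; exact h.symm.continuous
  rcases isThompsonT_or hc hc' hn hn' with h1 | h1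
  · obtain ⟨k, hk⟩ := lift _ h1
    refine ⟨k, Or.inl (MulEquiv.ext fun t => Subtype.ext (Subtype.ext ?_))⟩
    rw [hh, ← hk]
    rfl
  · obtain ⟨k, hk⟩ := lift _ h1
    refine ⟨k, Or.inr (MulEquiv.ext fun t => Subtype.ext (Subtype.ext ?_))⟩
    have : h' = invPerm * ((k : Neretin) : Equiv.Perm Bdry) := by
      rw [hk, ← mul_assoc, show invPerm * invPerm = 1 from Equiv.ext invPerm_invPerm, one_mul]
    rw [hh, this]
    rfl

/-- Otherwise `c`, the involution followed by the inverse of `k`, commutes with Thompson's group and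
so maps the ends moved by any element to ends moved by it. Elements supported in the three cones at
the central vertex then yield a positive triple with a positive image, although `c` reverses the
cyclic order. -/
lemma inversionAut_notMem_range :
    inversionAut ∉ (MulAut.conj : ThompsonT →* MulAut ThompsonT).range := by
  rintro ⟨k, hk⟩
  let c : Equiv.Perm Bdry := ((k : Neretin) : Equiv.Perm Bdry)⁻¹ * invPerm
  have hcomm : ∀ t : ThompsonT, ∀ x, c (t • x) = t • c x := by
    intro t x
    have h1 := congrArg (fun s : ThompsonT => s • invPerm x) (DFunLike.congr_fun hk t)
    have h2 : k • t • k⁻¹ • invPerm x = invPerm (t • invPerm (invPerm x)) := h1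
    rw [invPerm_invPerm] at h2
    change k⁻¹ • invPerm (t • x) = t • k⁻¹ • invPerm x
    rw [← h2, inv_smul_smul]
  have hex : ∀ i : Fin 3, ∃ x : Bdry, x.1 = i ∧ (c x).1 = i := by
    intro i
    obtain ⟨t, h1, -, h2⟩ := exists_thompsonT_cone (i, fun _ => false) 0
    obtain ⟨x, hx, hx'⟩ := h2 _ (self_mem_cone _ _) 0
    refine ⟨x, hx.1.symm, ?_⟩
    by_contra hne
    have h3 := h1 (c x) fun h => hne h.1.symm
    rw [← hcomm] at h3
    exact hx' (c.injective h3)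
  choose p hp hp' using hex
  have hlt : ∀ x y : Bdry, x.1 < y.1 → PlanarLT x y := fun x y h => Or.inl h
  have h1 : Cyc (p 0) (p 1) (p 2) :=
    Or.inl ⟨hlt _ _ (by rw [hp, hp]; decide), hlt _ _ (by rw [hp, hp]; decide)⟩
  have h2 : Cyc (c (p 0)) (c (p 1)) (c (p 2)) :=
    Or.inl ⟨hlt _ _ (by rw [hp', hp']; decide), hlt _ _ (by rw [hp', hp']; decide)⟩
  have h3 : Cyc (c (p 0)) (c (p 2)) (c (p 1)) :=
    (IsThompsonT.preservesCyc (k : ThompsonT).2).inv _ _ _ (cyc_invPerm.2 h1)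
  exact h2.asymm h3

/-! ### The cyclic order given by a list of leaves -/

/-- The leaf of `x` precedes the leaf of `y` in the list. -/
def ListLT : List (Set Bdry) → Bdry → Bdry → Prop
  | [], _, _ => False
  | U :: l, x, y => (x ∈ U ∧ y ∈ support l) ∨ ListLT l x y

lemma support_cons (U : Set Bdry) (l : List (Set Bdry)) : support (U :: l) = U ∪ support l := by
  ext; simp [support]

lemma support_nil : support [] = ∅ := by
  ext; simp [support]

lemma ListLT.mem {l : List (Set Bdry)} {x y : Bdry} (h : ListLT l x y) :
    x ∈ support l ∧ y ∈ support l := by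
  induction l with
  | nil => exact h.elim
  | cons U l ih =>
    rw [support_cons]
    rcases h with h | h
    · exact ⟨Or.inl h.1, Or.inr h.2⟩
    · exact ⟨Or.inr (ih h).1, Or.inr (ih h).2⟩

lemma listLT_append {a b : List (Set Bdry)} {x y : Bdry} :
    ListLT (a ++ b) x y ↔ ListLT a x y ∨ ListLT b x y ∨ (x ∈ support a ∧ y ∈ support b) := by
  induction a with
  | nil => simp [ListLT, support_nil]
  | cons U a ih =>
    simp only [List.cons_append, ListLT, ih, support_append, support_cons, Set.mem_union]
    tauto

lemma listLT_reverse {l : List (Set Bdry)} {x y : Bdry} :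
    ListLT l.reverse x y ↔ ListLT l y x := by
  induction l with
  | nil => simp [ListLT]
  | cons U l ih =>
    simp only [List.reverse_cons, listLT_append, ih, ListLT, support_reverse, support_cons,
      support_nil, Set.union_empty]
    simp only [Set.mem_empty_iff_false, and_false, or_false, false_or]
    tauto

lemma listLT_map (g : Equiv.Perm Bdry) {l : List (Set Bdry)} {x y : Bdry} :
    ListLT (l.map (g '' ·)) (g x) (g y) ↔ ListLT l x y := by
  induction l with
  | nil => simp [ListLT]
  | cons U l ih =>
    simp only [List.map_cons, ListLT, ih, support_image, g.injective.mem_set_image]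

lemma ListLT.flatMap_splitLeaf {l : List (Set Bdry)} {x y : Bdry} (h : ListLT l x y) (a : Bdry)
    (n : ℕ) (b : Bool) : ListLT (l.flatMap (splitLeaf a n b)) x y := by
  induction l with
  | nil => exact h.elim
  | cons U l ih =>
    rw [List.flatMap_cons, listLT_append, support_splitLeaf, support_flatMap]
    rcases h with h | h
    · exact Or.inr (Or.inr h)
    · exact Or.inr (Or.inl (ih h))

lemma ListLT.planarLT {l : List (Set Bdry)} (hl : l.Pairwise Before) {x y : Bdry}
    (h : ListLT l x y) : PlanarLT x y := by
  induction l with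
  | nil => exact h.elim
  | cons U l ih =>
    rw [List.pairwise_cons] at hl
    rcases h with ⟨hx, V, hV, hy⟩ | h
    · exact hl.1 V hV x hx y hy
    · exact ih hl.2 h

/-- No member of the list contains both `x` and `y`. -/
def Separated (l : List (Set Bdry)) (x y : Bdry) : Prop := ∀ U ∈ l, x ∈ U → y ∉ U

lemma ListLT.total {l : List (Set Bdry)} {x y : Bdry} (hs : Separated l x y) (hx : x ∈ support l)
    (hy : y ∈ support l) : ListLT l x y ∨ ListLT l y x := by
  induction l with
  | nil => simp [support_nil] at hx
  | cons U l ih =>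
    rw [support_cons] at hx hy
    have hU := hs U List.mem_cons_self
    rcases hx with hx | hx
    · exact Or.inl (Or.inl ⟨hx, hy.resolve_left (hU hx)⟩)
    · rcases hy with hy | hy
      · exact Or.inr (Or.inl ⟨hy, hx⟩)
      · exact (ih (fun V hV => hs V (List.mem_cons_of_mem _ hV)) hx hy).imp Or.inr Or.inr

/-- The leaves of `x`, `y`, `z` are in this cyclic order in the list. -/
def ListCyc (l : List (Set Bdry)) (x y z : Bdry) : Prop :=
  (ListLT l x y ∧ ListLT l y z) ∨ (ListLT l y z ∧ ListLT l z x) ∨ (ListLT l z x ∧ ListLT l x y)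

lemma listCyc_reverse {l : List (Set Bdry)} {x y z : Bdry} :
    ListCyc l.reverse x y z ↔ ListCyc l x z y := by
  simp only [ListCyc, listLT_reverse]
  tauto

lemma listCyc_map (g : Equiv.Perm Bdry) {l : List (Set Bdry)} {x y z : Bdry} :
    ListCyc (l.map (g '' ·)) (g x) (g y) (g z) ↔ ListCyc l x y z := by
  simp only [ListCyc, listLT_map]

lemma ListCyc.flatMap_splitLeaf {l : List (Set Bdry)} {x y z : Bdry} (h : ListCyc l x y z)
    (a : Bdry) (n : ℕ) (b : Bool) : ListCyc (l.flatMap (splitLeaf a n b)) x y z :=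
  h.imp (And.imp (·.flatMap_splitLeaf a n b) (·.flatMap_splitLeaf a n b))
    (Or.imp (And.imp (·.flatMap_splitLeaf a n b) (·.flatMap_splitLeaf a n b))
      (And.imp (·.flatMap_splitLeaf a n b) (·.flatMap_splitLeaf a n b)))

lemma listLT_left {l : List (Set Bdry)} {x y : Bdry} (h : x ∉ support l) : ¬ ListLT l x y :=
  fun h' => h h'.mem.1

lemma listLT_right {l : List (Set Bdry)} {x y : Bdry} (h : y ∉ support l) : ¬ ListLT l x y :=
  fun h' => h h'.mem.2

lemma ListCyc.of_isRotated {l l' : List (Set Bdry)} (hl : IsLeafList l) (hr : l.IsRotated l')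
    {x y z : Bdry} (h : ListCyc l x y z) : ListCyc l' x y z := by
  obtain ⟨k, hk, rfl⟩ := List.isRotated_iff_mod.1 hr
  rw [List.rotate_eq_drop_append_take hk]
  rw [← List.take_append_drop k l] at h hl
  generalize l.take k = a at *
  generalize l.drop k = b at *
  have hb : ∀ w, (w ∈ support a ∧ w ∉ support b) ∨ (w ∉ support a ∧ w ∈ support b) := fun w => by
    rw [← hl.support_compl, Set.mem_compl_iff]; tauto
  simp only [ListCyc, listLT_append] at h ⊢
  rcases hb x with ⟨hx, hx'⟩ | ⟨hx, hx'⟩ <;> rcases hb y with ⟨hy, hy'⟩ | ⟨hy, hy'⟩ <;>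
    rcases hb z with ⟨hz, hz'⟩ | ⟨hz, hz'⟩ <;>
    simp [listLT_left, listLT_right, hx, hx', hy, hy', hz, hz'] at h ⊢ <;> tauto

lemma mem_three {a b c : List (Set Bdry)} (hl : IsLeafList (a ++ b ++ c)) (w : Bdry) :
    (w ∈ support a ∧ w ∉ support b ∧ w ∉ support c) ∨
    (w ∉ support a ∧ w ∈ support b ∧ w ∉ support c) ∨
    (w ∉ support a ∧ w ∉ support b ∧ w ∈ support c) := by
  have h1 := hl.support_compl
  rw [List.append_assoc] at hl
  have h2 := hl.support_compl
  have e1 : w ∈ support c ↔ w ∉ support (a ++ b) := by rw [← h1]; rfl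
  have e2 : w ∈ support (b ++ c) ↔ w ∉ support a := by rw [← h2]; rfl
  rw [support_append, Set.mem_union] at e1 e2
  tauto

/-- At most one of the three ends lies in the reversed block, so none of their mutual positions
changes. -/
lemma ListCyc.flip {a b c : List (Set Bdry)} (hl : IsLeafList (a ++ b ++ c)) {x y z : Bdry}
    (hxy : ¬ (x ∈ support b ∧ y ∈ support b)) (hyz : ¬ (y ∈ support b ∧ z ∈ support b))
    (hxz : ¬ (x ∈ support b ∧ z ∈ support b)) (h : ListCyc (a ++ b ++ c) x y z) :
    ListCyc (a ++ b.reverse ++ c) x y z := by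
  simp only [ListCyc, listLT_append, listLT_reverse, support_append, support_reverse,
    Set.mem_union] at h ⊢
  rcases mem_three hl x with ⟨hx, hx', hx''⟩ | ⟨hx, hx', hx''⟩ | ⟨hx, hx', hx''⟩ <;>
    rcases mem_three hl y with ⟨hy, hy', hy''⟩ | ⟨hy, hy', hy''⟩ | ⟨hy, hy', hy''⟩ <;>
    rcases mem_three hl z with ⟨hz, hz', hz''⟩ | ⟨hz, hz', hz''⟩ | ⟨hz, hz', hz''⟩ <;>
    simp [listLT_left, listLT_right, hx, hx', hx'', hy, hy', hy'', hz, hz', hz'']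
      at h hxy hyz hxz ⊢ <;> tauto

/-- Up to rotation, reversing a block is reversing the whole list and then the complementary block;
the latter does not matter when at most one of the ends lies there. -/
lemma ListCyc.flip_compl {a b c : List (Set Bdry)} (hl : IsLeafList (a ++ b ++ c)) {x y z : Bdry}
    (hxy : ¬ (x ∉ support b ∧ y ∉ support b)) (hyz : ¬ (y ∉ support b ∧ z ∉ support b))
    (hxz : ¬ (x ∉ support b ∧ z ∉ support b)) (h : ListCyc (a ++ b ++ c) x y z) :
    ListCyc (a ++ b.reverse ++ c) x z y := by
  simp only [ListCyc, listLT_append, listLT_reverse, support_append, support_reverse,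
    Set.mem_union] at h ⊢
  rcases mem_three hl x with ⟨hx, hx', hx''⟩ | ⟨hx, hx', hx''⟩ | ⟨hx, hx', hx''⟩ <;>
    rcases mem_three hl y with ⟨hy, hy', hy''⟩ | ⟨hy, hy', hy''⟩ | ⟨hy, hy', hy''⟩ <;>
    rcases mem_three hl z with ⟨hz, hz', hz''⟩ | ⟨hz, hz', hz''⟩ | ⟨hz, hz', hz''⟩ <;>
    simp [listLT_left, listLT_right, hx, hx', hx'', hy, hy', hy'', hz, hz', hz'']
      at h hxy hyz hxz ⊢ <;> tauto

lemma IsCyclicLeafList.cyc {l : List (Set Bdry)} (hl : IsCyclicLeafList l) {x y z : Bdry}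
    (h : ListCyc l x y z) : Cyc x y z := by
  obtain ⟨h1, l', hr, hb⟩ := hl
  exact (h.of_isRotated h1 hr).imp (And.imp (·.planarLT hb) (·.planarLT hb))
    (Or.imp (And.imp (·.planarLT hb) (·.planarLT hb)) (And.imp (·.planarLT hb) (·.planarLT hb)))

/-- A list of leaves is cyclic if its cyclic order is the cyclic order of ends. -/
lemma isCyclicList_of_cyc {l : List (Set Bdry)} (hl : IsLeafList l)
    (h : ∀ x y z, ListCyc l x y z → Cyc x y z) : IsCyclicList l := by
  let x₀ : Bdry := (0, fun _ => false)
  have hx₀ : ∀ y, y ≠ x₀ → PlanarLT x₀ y := by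
    intro y hy
    rcases PlanarLT.total hy with (h | ⟨-, k, -, -, h⟩) | h
    · exact absurd h (by simp [x₀])
    · exact absurd h (by simp [x₀])
    · exact h
  obtain ⟨U, hU, hU₀⟩ := hl.cover x₀
  obtain ⟨p, q, rfl⟩ := List.append_of_mem hU
  have hr : List.IsRotated (p ++ U :: q) ((U :: q) ++ p) := List.isRotated_append
  -- With the leaf of the very first end `x₀` in front, cyclic triples starting at `x₀` read off the
  -- planar order.
  refine ⟨U :: q ++ p, hr, ?_⟩
  have hl' := hl.perm hr.perm
  have hcyc : ∀ x y z, ListCyc (U :: (q ++ p)) x y z → Cyc x y z := fun x y z hc =>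
    h x y z (hc.of_isRotated hl' hr.symm)
  rw [List.cons_append] at hl' ⊢
  generalize q ++ p = r at hl' hcyc
  have hd := hl'.disj
  rw [List.pairwise_cons] at hd ⊢
  refine ⟨fun V hV a ha b hb => ?_, ?_⟩
  · have hbU : b ∉ U := fun h => Set.disjoint_left.1 (hd.1 V hV) h hb
    obtain ⟨y, k, rfl⟩ := hl'.isCone U List.mem_cons_self
    exact PlanarLT.congr_left (Agree.trans (Agree.symm hU₀) ha) (fun h => hbU (Agree.trans hU₀ h))
      (hx₀ b fun e => hbU (e ▸ hU₀))
  · refine List.pairwise_iff_getElem.2 fun i j hi hj hij v hv w hw => ?_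
    have hlt : ListLT r v w := by
      rw [← List.take_append_drop j r, listLT_append]
      refine Or.inr (Or.inr ⟨⟨r[i], ?_, hv⟩, ⟨r[j], ?_, hw⟩⟩)
      · exact List.mem_take_iff_getElem.2 ⟨i, by omega, rfl⟩
      · exact List.mem_drop_iff_getElem.2 ⟨0, by omega, by simp⟩
    have hne : ∀ w V, V ∈ r → w ∈ V → w ≠ x₀ := fun w V hV hw e =>
      Set.disjoint_left.1 (hd.1 V hV) hU₀ (e ▸ hw)
    have hc := hcyc x₀ v w (Or.inl ⟨Or.inl ⟨hU₀, _, List.getElem_mem hi, hv⟩, Or.inr hlt⟩)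
    rcases hc with ⟨-, h⟩ | ⟨h, -⟩ | ⟨h, -⟩
    · exact h
    · exact h
    · exact absurd ((hx₀ w (hne w _ (List.getElem_mem hj) hw)).trans h) (PlanarLT.irrefl _)

/-! ### Labels refining a given list of leaves -/

lemma Move.symm {T T' : PlanarTree} (h : Move T T') : Move T' T := by
  cases h with
  | rotate he hr => exact .rotate _ _ he.symm hr.symm
  | mirror he hr => exact .mirror _ _ he.symm (by rw [hr, List.reverse_reverse])
  | flip a b c he h1 hs h2 =>
    exact .flip _ _ a b.reverse c he.symm h2 (by rw [support_reverse, he]; exact hs)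
      (by rw [h1, List.reverse_reverse])

/-- Labels with the same stratum have expansions which differ by moves. -/
lemma exists_expansions_of_mk_eq {T T' : PlanarTree} (h : Stratum.mk T = Stratum.mk T') :
    ∃ T₁ T₁', Expansions T T₁ ∧ Expansions T' T₁' ∧ Relation.EqvGen Move T₁ T₁' := by
  replace h := Quot.eqvGen_exact h
  induction h with
  | rel T T' h =>
    rcases h with h | h
    · exact ⟨T, T', .refl, .refl, .rel _ _ h⟩
    · exact ⟨T', T', .single h, .refl, .refl _⟩
  | refl T => exact ⟨T, T, .refl, .refl, .refl _⟩
  | symm _ _ _ ih =>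
    obtain ⟨T₁, T₁', h1, h2, h3⟩ := ih
    exact ⟨T₁', T₁, h2, h1, h3.symm⟩
  | trans _ _ _ _ _ ih ih' =>
    obtain ⟨A, B, hA, hB, hAB⟩ := ih
    obtain ⟨C, D, hC, hD, hCD⟩ := ih'
    -- The two expansions of the middle label get a common expansion, which is then carried along
    -- the moves on both sides.
    obtain ⟨E, hBE, hCE⟩ := expansions_confluent hB hC
    obtain ⟨F, hAF, hEF⟩ := moves_expansions hAB.symm hBE
    obtain ⟨G, hDG, hEG⟩ := moves_expansions hCD hCE
    exact ⟨F, G, hA.trans hAF, hD.trans hDG, hEF.symm.trans _ _ _ hEG⟩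

/-- The leaves of `T` lie in members of `l`, one of the two sides of each inner edge lies in
a member of `l`, and the cyclic order of the members of `l` is kept or reversed. -/
structure Refines (l : List (Set Bdry)) (T : PlanarTree) : Prop where
  leaf : ∀ V ∈ T.leaves, ∃ U ∈ l, V ⊆ U
  edge : ∀ S ∈ T.edges, ∃ U ∈ l, S ⊆ U ∨ Sᶜ ⊆ U
  order : (∀ x y z, Separated l x y → Separated l y z → Separated l x z → ListCyc l x y z →
      ListCyc T.leaves x y z) ∨
    (∀ x y z, Separated l x y → Separated l y z → Separated l x z → ListCyc l x y z →
      ListCyc T.leaves x z y)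

/-- For a flip, one side of the edge lies in a member of `l` and so contains at most one of three
separated ends. If that side is reversed, the order of the three is kept; if the other side is, it
is reversed as under a mirror move. -/
lemma Refines.move {l : List (Set Bdry)} {T T' : PlanarTree} (h : Refines l T) (hm : Move T T') :
    Refines l T' := by
  have hleaf : ∀ V ∈ T'.leaves, ∃ U ∈ l, V ⊆ U := fun V hV => h.leaf V (hm.perm.mem_iff.2 hV)
  have hT := T.isLeafList
  cases hm with
  | rotate he hr =>
    refine ⟨hleaf, he ▸ h.edge, h.order.imp (fun h x y z a b c d => ?_) fun h x y z a b c d => ?_⟩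
    · exact (h x y z a b c d).of_isRotated hT hr
    · exact (h x y z a b c d).of_isRotated hT hr
  | mirror he hr =>
    refine ⟨hleaf, he ▸ h.edge, h.order.symm.imp (fun h x y z a b c d => ?_)
      fun h x y z a b c d => ?_⟩
    · rw [hr, listCyc_reverse]; exact h x y z a b c d
    · rw [hr, listCyc_reverse]; exact h x y z a b c d
  | flip a b c he h1 hs h2 =>
    obtain ⟨U, hU, hbU⟩ := h.edge _ hs
    rw [h1] at hT
    have hsep : ∀ x y, Separated l x y → ¬ (x ∈ U ∧ y ∈ U) := fun x y h h' => h U hU h'.1 h'.2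
    rcases hbU with hbU | hbU
    · have hsep' : ∀ x y, Separated l x y → ¬ (x ∈ support b ∧ y ∈ support b) := fun x y h h' =>
        hsep x y h ⟨hbU h'.1, hbU h'.2⟩
      have hsep'' : ∀ x y, Separated l x y → ¬ (y ∈ support b ∧ x ∈ support b) := fun x y h h' =>
        hsep x y h ⟨hbU h'.2, hbU h'.1⟩
      refine ⟨hleaf, he ▸ h.edge, h.order.imp (fun h x y z p q r s => ?_) fun h x y z p q r s => ?_⟩
      · rw [h2]
        exact (h1 ▸ h x y z p q r s).flip hT (hsep' _ _ p) (hsep' _ _ q) (hsep' _ _ r)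
      · rw [h2]
        exact (h1 ▸ h x y z p q r s).flip hT (hsep' _ _ r) (hsep'' _ _ q) (hsep' _ _ p)
    · have hsep' : ∀ x y, Separated l x y → ¬ (x ∉ support b ∧ y ∉ support b) := fun x y h h' =>
        hsep x y h ⟨hbU h'.1, hbU h'.2⟩
      have hsep'' : ∀ x y, Separated l x y → ¬ (y ∉ support b ∧ x ∉ support b) := fun x y h h' =>
        hsep x y h ⟨hbU h'.2, hbU h'.1⟩
      refine ⟨hleaf, he ▸ h.edge,
        h.order.symm.imp (fun h x y z p q r s => ?_) fun h x y z p q r s => ?_⟩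
      · rw [h2]
        exact (h1 ▸ h x y z p q r s).flip_compl hT (hsep' _ _ r) (hsep'' _ _ q) (hsep' _ _ p)
      · rw [h2]
        exact (h1 ▸ h x y z p q r s).flip_compl hT (hsep' _ _ p) (hsep' _ _ q) (hsep' _ _ r)

lemma Refines.moves {l : List (Set Bdry)} {T T' : PlanarTree} (h : Refines l T)
    (hm : Relation.EqvGen Move T T') : Refines l T' := by
  have key : Refines l T ↔ Refines l T' := by
    clear h
    induction hm with
    | rel _ _ h => exact ⟨fun h' => h'.move h, fun h' => h'.move h.symm⟩
    | refl _ => exact Iff.rfl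
    | symm _ _ _ ih => exact ih.symm
    | trans _ _ _ _ _ ih ih' => exact ih.trans ih'
  exact key.1 h

/-- The only new edge cuts off a leaf, and leaves lie in members of `l`. -/
lemma Refines.expansions {l : List (Set Bdry)} {T T' : PlanarTree} (h : Refines l T)
    (he : Expansions T T') : Refines l T' := by
  induction he with
  | refl => exact h
  | tail _ he ih =>
    obtain ⟨a, n, ha, rfl⟩ := he
    obtain ⟨U, hU, haU⟩ := ih.leaf _ ha
    refine ⟨fun V hV => ?_, ?_, ih.order.imp (fun h x y z p q r s => ?_) fun h x y z p q r s => ?_⟩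
    · obtain ⟨W, hW, hVW⟩ := List.mem_flatMap.1 hV
      obtain ⟨U, hU, hWU⟩ := ih.leaf W hW
      exact ⟨U, hU, (subset_of_mem_splitLeaf hVW).trans hWU⟩
    · rintro S (hS | rfl | rfl)
      · exact ih.edge S hS
      · exact ⟨U, hU, Or.inl haU⟩
      · exact ⟨U, hU, Or.inr (by rwa [compl_compl])⟩
    · exact (h x y z p q r s).flatMap_splitLeaf _ _ _
    · exact (h x y z p q r s).flatMap_splitLeaf _ _ _

lemma refines_of_edges_eq_empty {T : PlanarTree} (h : T.edges = ∅) : Refines T.leaves T where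
  leaf V hV := ⟨V, hV, subset_rfl⟩
  edge S hS := by simp [h] at hS
  order := Or.inl fun _ _ _ _ _ _ h => h

lemma isCyclicList_expansions {T T' : PlanarTree} (h : IsCyclicList T.leaves)
    (he : Expansions T T') : IsCyclicList T'.leaves := by
  induction he with
  | refl => exact h
  | @tail T₁ _ _ he ih =>
    obtain ⟨a, n, ha, rfl⟩ := he
    obtain ⟨p, q, hpq⟩ := List.append_of_mem ha
    have hnd := T₁.isLeafList.nodup
    have h1 : IsCyclicLeafList (p ++ cone a n :: q) := hpq ▸ ⟨T₁.isLeafList, ih⟩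
    have h2 := h1.split.2
    rw [hpq] at hnd
    simp only [expand, hpq, flatMap_splitLeaf_of_nodup hnd]
    simpa using h2

/-- If a stratum with a label without inner edges is a cyclic stratum, then the order of its leaves
agrees with the cyclic order of ends or is opposite to it. -/
lemma cyc_of_isCyclicStratum {T : PlanarTree} (hT : T.edges = ∅)
    (hc : IsCyclicStratum (Stratum.mk T)) :
    (∀ x y z, Separated T.leaves x y → Separated T.leaves y z → Separated T.leaves x z →
      ListCyc T.leaves x y z → Cyc x y z) ∨
    (∀ x y z, Separated T.leaves x y → Separated T.leaves y z → Separated T.leaves x z →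
      ListCyc T.leaves x y z → Cyc x z y) := by
  obtain ⟨T', hT', hcyc⟩ := hc
  obtain ⟨A, B, hA, hB, hm⟩ := exists_expansions_of_mk_eq hT'
  have h := ((refines_of_edges_eq_empty hT).expansions hB).moves hm.symm
  have hA' : IsCyclicLeafList A.leaves := ⟨A.isLeafList, isCyclicList_expansions hcyc hA⟩
  exact h.order.imp (fun h x y z a b c d => hA'.cyc (h x y z a b c d))
    fun h x y z a b c d => hA'.cyc (h x y z a b c d)

/-! ### The stabilizer of the distinguished associahedron -/

/-- Spheromorphisms send deep cones to cones, and the cyclic order excludes the exchange of halves.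
-/
lemma isThompsonT_of_preservesCyc {g : Neretin} (h : PreservesCyc g) : IsThompsonT g := by
  obtain ⟨n, hn⟩ := g.2
  refine IsCyclicPlanar.isThompsonT ⟨⟨n, fun x => h.exists_isPlanarAt ?_⟩, h⟩
  rintro _ hU ⟨z, k, rfl⟩
  obtain ⟨hk, hz⟩ := cone_subset hU
  obtain ⟨j, rfl⟩ := Nat.exists_eq_add_of_le hk
  obtain ⟨m, hm⟩ := hn x
  exact ⟨_, _, ((hm.congr hz).shift j).image_cone⟩

/-- It suffices to test strata of trees with one inner vertex over uniform trees: their images are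
again of this kind, and being cyclic they keep or reverse the order of all triples separated at that
depth. Any triple is separated at some depth, and the triple `p`, separated at every depth, forces
the same orientation throughout. -/
lemma mem_thompsonT_or {g : Neretin}
    (h : ∀ s, IsCyclicStratum s → IsCyclicStratum (g • s)) :
    g ∈ ThompsonT ∨ inversion * g ∈ ThompsonT := by
  obtain ⟨n₀, hn₀⟩ := g.2
  have key : ∀ n, (∀ x y z, ¬ Agree x y (n₀ + n) → ¬ Agree y z (n₀ + n) → ¬ Agree x z (n₀ + n) →
      Cyc x y z → Cyc (g.1 x) (g.1 y) (g.1 z)) ∨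
      (∀ x y z, ¬ Agree x y (n₀ + n) → ¬ Agree y z (n₀ + n) → ¬ Agree x z (n₀ + n) →
      Cyc x y z → Cyc (g.1 x) (g.1 z) (g.1 y)) := by
    intro n
    obtain ⟨l, h1, h2, h3⟩ := exists_uniform (n₀ + n)
    have hl : IsLeafList l := ⟨fun U hU => (h1 U hU).imp fun _ h => ⟨_, h⟩,
      h2.imp Before.disjoint, h3⟩
    have hg : Good g.1 (starTree l hl) := Deep.good (N := n₀) hn₀ fun U hU => by
      obtain ⟨x, rfl⟩ := h1 U hU
      exact ⟨x, n₀ + n, by omega, rfl⟩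
    have hc := h (Stratum.mk (starTree l hl)) ⟨_, rfl, l, List.IsRotated.refl _, h2⟩
    have he : g • Stratum.mk (starTree l hl) = Stratum.mk ((starTree l hl).relabel g.1 hg) :=
      act_mk g .refl hg
    rw [he] at hc
    have hs : ∀ x y, ¬ Agree x y (n₀ + n) → Separated l x y := by
      intro x y hxy U hU hx hy
      obtain ⟨a, rfl⟩ := h1 U hU
      exact hxy (Agree.trans (Agree.symm hx) hy)
    have hs' : ∀ x y, ¬ Agree x y (n₀ + n) →
        Separated ((starTree l hl).relabel g.1 hg).leaves (g.1 x) (g.1 y) := by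
      intro x y hxy V hV hx hy
      obtain ⟨U, hU, rfl⟩ := List.mem_map.1 hV
      exact hs x y hxy U hU (g.1.injective.mem_set_image.1 hx) (g.1.injective.mem_set_image.1 hy)
    have hlt : ∀ x y, ¬ Agree x y (n₀ + n) → PlanarLT x y → ListLT l x y := fun x y hxy hlt =>
      (ListLT.total (hs x y hxy) (h3 x) (h3 y)).resolve_right fun h => hlt.asymm (h.planarLT h2)
    have hcyc : ∀ x y z, ¬ Agree x y (n₀ + n) → ¬ Agree y z (n₀ + n) → ¬ Agree x z (n₀ + n) →
        Cyc x y z → ListCyc ((starTree l hl).relabel g.1 hg).leaves (g.1 x) (g.1 y) (g.1 z) := by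
      intro x y z a b c d
      refine (listCyc_map g.1).2 ?_
      have c' : ¬ Agree z x (n₀ + n) := fun h => c h.symm
      exact d.imp (And.imp (hlt _ _ a) (hlt _ _ b)) (Or.imp (And.imp (hlt _ _ b) (hlt _ _ c'))
        (And.imp (hlt _ _ c') (hlt _ _ a)))
    refine (cyc_of_isCyclicStratum (by simp [relabel, starTree]) hc).imp
      (fun h x y z a b c d => ?_) fun h x y z a b c d => ?_
    · exact h _ _ _ (hs' _ _ a) (hs' _ _ b) (hs' _ _ c) (hcyc _ _ _ a b c d)
    · exact h _ _ _ (hs' _ _ a) (hs' _ _ b) (hs' _ _ c) (hcyc _ _ _ a b c d)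
  let p : Fin 3 → Bdry := fun i => (i, fun _ => false)
  have hp : Cyc (p 0) (p 1) (p 2) := Or.inl ⟨Or.inl (by decide), Or.inl (by decide)⟩
  have hpa : ∀ i j, i ≠ j → ∀ n, ¬ Agree (p i) (p j) n := fun i j hij n h => hij h.1
  have hsep : ∀ x y z, Cyc x y z → ∃ n, ¬ Agree x y (n₀ + n) ∧ ¬ Agree y z (n₀ + n) ∧
      ¬ Agree x z (n₀ + n) := by
    intro x y z hc
    obtain ⟨n₁, h₁⟩ := exists_not_agree hc.ne
    obtain ⟨n₂, h₂⟩ := exists_not_agree hc.rotate.ne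
    obtain ⟨n₃, h₃⟩ := exists_not_agree hc.rotate.rotate.ne.symm
    exact ⟨n₁ + n₂ + n₃, h₁ _ (by omega), h₂ _ (by omega), h₃ _ (by omega)⟩
  by_cases hg : Cyc (g.1 (p 0)) (g.1 (p 1)) (g.1 (p 2))
  · refine Or.inl (isThompsonT_of_preservesCyc fun x y z hc => ?_)
    obtain ⟨n, a, b, c⟩ := hsep x y z hc
    rcases key n with h | h
    · exact h x y z a b c hc
    · exact (hg.asymm (h _ _ _ (hpa _ _ (by decide) _) (hpa _ _ (by decide) _)
        (hpa _ _ (by decide) _) hp)).elim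
  · refine Or.inr (isThompsonT_of_preservesCyc (g := inversion * g) fun x y z hc => ?_)
    obtain ⟨n, a, b, c⟩ := hsep x y z hc
    rcases key n with h | h
    · exact (hg (h _ _ _ (hpa _ _ (by decide) _) (hpa _ _ (by decide) _)
        (hpa _ _ (by decide) _) hp)).elim
    · exact cyc_invPerm.2 (h x y z a b c hc)

/-- The reflection of a planar tree. -/
def PlanarTree.reflect (T : PlanarTree) : PlanarTree where
  leaves := T.leaves.reverse
  edges := T.edges
  isLeafList := T.isLeafList.perm (List.reverse_perm _).symm
  arc S hS := by
    obtain ⟨a, b, hr, ha, hb, rfl⟩ := T.arc S hS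
    refine ⟨a.reverse, b.reverse, ?_, by simpa using ha, by simpa using hb,
      (support_reverse a).symm⟩
    refine (List.isRotated_reverse_iff.2 hr).trans ?_
    rw [List.reverse_append]
    exact List.isRotated_append
  compl_mem := T.compl_mem
  nested := T.nested

lemma IsCyclicStratum.smul_thompsonT {s : Stratum} (hs : IsCyclicStratum s) {g : Neretin}
    (hg : g ∈ ThompsonT) : IsCyclicStratum (g • s) := by
  obtain ⟨T, rfl, hT⟩ := hs
  obtain ⟨T', he, hgood⟩ := exists_good g T
  refine ⟨_, (act_mk g he hgood).symm, isCyclicList_of_cyc (relabel g.1 T' hgood).isLeafList ?_⟩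
  have hT' : IsCyclicLeafList T'.leaves := ⟨T'.isLeafList, isCyclicList_expansions hT he⟩
  have key : ∀ x y z, ListCyc (T'.leaves.map (g.1 '' ·)) (g.1 x) (g.1 y) (g.1 z) →
      Cyc (g.1 x) (g.1 y) (g.1 z) := fun x y z h =>
    IsThompsonT.preservesCyc hg _ _ _ (hT'.cyc ((listCyc_map g.1).1 h))
  intro x y z h
  have := key (g.1⁻¹ x) (g.1⁻¹ y) (g.1⁻¹ z)
  have e : ∀ w, g.1 (g.1⁻¹ w) = w := fun w => by simp
  rw [e, e, e] at this
  exact this h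

/-- The relabelled leaves run backwards around the plane; the reflected tree labels the same stratum
and runs forwards. -/
lemma IsCyclicStratum.smul_inversion {s : Stratum} (hs : IsCyclicStratum s) :
    IsCyclicStratum (inversion • s) := by
  obtain ⟨T, rfl, hT⟩ := hs
  obtain ⟨T', he, hgood⟩ := exists_good inversion T
  let R := relabel invPerm T' hgood
  have hR : Stratum.mk R = inversion • Stratum.mk T := (act_mk inversion he hgood).symm
  refine ⟨R.reflect, (mk_eq_of_move (.mirror R R.reflect rfl rfl)).symm.trans hR,
    isCyclicList_of_cyc R.reflect.isLeafList ?_⟩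
  have hT' : IsCyclicLeafList T'.leaves := ⟨T'.isLeafList, isCyclicList_expansions hT he⟩
  intro x y z h
  have h1 : ListCyc (T'.leaves.map (invPerm '' ·)) x z y := listCyc_reverse.1 h
  rw [← invPerm_invPerm x, ← invPerm_invPerm y, ← invPerm_invPerm z, listCyc_map] at h1
  rw [← invPerm_invPerm x, ← invPerm_invPerm y, ← invPerm_invPerm z, cyc_invPerm]
  exact hT'.cyc h1

/-! ### From strata to points of the tower. -/

lemma smul_kInfty_subset {g : Neretin} (h : ∀ s, IsCyclicStratum s → IsCyclicStratum (g • s)) :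
    g • KInfty ⊆ KInfty := by
  classical
  rintro _ ⟨p, ⟨s, hs, hp, hp'⟩, rfl⟩
  have hsupp : ((g • p).coord.support : Finset Stratum) = p.coord.support.image (g • ·) :=
    Finsupp.mapDomain_support_of_injective (MulAction.injective g) _
  refine ⟨g • s, h s hs, ?_, fun t ht => ?_⟩
  · change g • s ∈ (g • p).coord.support
    rw [hsupp]
    exact Finset.mem_image_of_mem _ hp
  · change t ∈ (g • p).coord.support at ht
    rw [hsupp] at ht
    obtain ⟨u, hu, rfl⟩ := Finset.mem_image.1 ht
    exact (hp' u hu).smul g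

lemma thompsonT_le_stabilizer : ThompsonT ≤ MulAction.stabilizer Neretin KInfty := by
  intro g hg
  rw [MulAction.mem_stabilizer_iff]
  refine Set.Subset.antisymm (smul_kInfty_subset fun s hs => hs.smul_thompsonT hg) ?_
  rw [Set.subset_smul_set_iff]
  exact smul_kInfty_subset fun s hs => hs.smul_thompsonT (ThompsonT.inv_mem hg)

lemma inversion_mem_stabilizer : inversion ∈ MulAction.stabilizer Neretin KInfty := by
  rw [MulAction.mem_stabilizer_iff]
  refine Set.Subset.antisymm (smul_kInfty_subset fun s hs => hs.smul_inversion) ?_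
  rw [Set.subset_smul_set_iff, inversion_inv]
  exact smul_kInfty_subset fun s hs => hs.smul_inversion

/-- The vertex of the tower in the barycentre of a stratum. -/
noncomputable def Tower.barycentre (s : Stratum) : Tower where
  coord := Finsupp.single s 1
  nonneg t := by
    classical
    rw [Finsupp.single_apply]; split_ifs <;> norm_num
  sum_eq_one := by simp
  isChain := by
    refine Set.Subsingleton.isChain fun a ha b hb => ?_
    simp only [Finset.mem_coe, Finsupp.mem_support_iff, Finsupp.single_apply_ne_zero] at ha hb
    rw [ha.1, hb.1]

lemma isFace_refl (s : Stratum) : IsFace s s := by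
  induction s using Quot.ind with | _ T => ?_
  exact ⟨T, T, rfl, rfl, rfl, subset_rfl⟩

/-- The barycentre of `s` lies in the associahedron, and its image has the single stratum `g • s` in
its support, so this stratum has to be the cyclic one. -/
lemma isCyclicStratum_smul_of_mem_stabilizer {g : Neretin}
    (hg : g ∈ MulAction.stabilizer Neretin KInfty) {s : Stratum} (hs : IsCyclicStratum s) :
    IsCyclicStratum (g • s) := by
  classical
  have hsupp : (Finsupp.single s (1 : ℝ)).support = {s} :=
    Finsupp.support_single _ one_ne_zero
  have hmem : Tower.barycentre s ∈ KInfty := by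
    refine ⟨s, hs, ?_, fun t ht => ?_⟩
    · change s ∈ (Finsupp.single s (1 : ℝ)).support
      simp
    · change t ∈ (Finsupp.single s (1 : ℝ)).support at ht
      rw [hsupp, Finset.mem_singleton] at ht
      exact ht ▸ isFace_refl t
  have hmem' : g • Tower.barycentre s ∈ KInfty := by
    rw [← MulAction.mem_stabilizer_iff.1 hg]
    exact Set.smul_mem_smul_set hmem
  obtain ⟨t, ht, htp, -⟩ := hmem'
  have : t ∈ ((Finsupp.single s (1 : ℝ)).mapDomain (g • ·)).support := htp
  rw [Finsupp.mapDomain_single, Finsupp.support_single _ one_ne_zero, Finset.mem_singleton] at this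
  exact this ▸ ht

lemma mem_stabilizer_iff {g : Neretin} : g ∈ MulAction.stabilizer Neretin KInfty ↔
    g ∈ ThompsonT ∨ inversion * g ∈ ThompsonT := by
  refine ⟨fun h => mem_thompsonT_or fun s hs => isCyclicStratum_smul_of_mem_stabilizer h hs, ?_⟩
  rintro (h | h)
  · exact thompsonT_le_stabilizer h
  · have := mul_mem inversion_mem_stabilizer (thompsonT_le_stabilizer h)
    rwa [← mul_assoc, inversion_mul_self, one_mul] at this

/-! ### Outer automorphisms and the semidirect product -/

/-- A group which consists of `1` and `o ≠ 1` maps to any group with an element of square `1`. -/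
lemma exists_monoidHom_of_forall_eq {Q H : Type*} [Group Q] [Group H] {o : Q} (ho : o ≠ 1)
    (hQ : ∀ c : Q, c = 1 ∨ c = o) {a : H} (ha : a * a = 1) : ∃ f : Q →* H, f o = a := by
  classical
  have hoo : o * o = 1 := (hQ (o * o)).resolve_right fun h => ho (by simpa using h)
  refine ⟨MonoidHom.mk' (fun c => if c = 1 then 1 else a) fun c d => ?_, by simp [ho]⟩
  rcases hQ c with rfl | rfl <;> rcases hQ d with rfl | rfl <;> simp [ho, hoo, ha]

/-- The class of the conjugation by the involution. -/
def outInversion : Out ThompsonT := QuotientGroup.mk inversionAut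

lemma outInversion_ne_one : outInversion ≠ 1 := fun h =>
  inversionAut_notMem_range ((QuotientGroup.eq_one_iff _).1 h)

lemma eq_one_or_eq_outInversion (c : Out ThompsonT) : c = 1 ∨ c = outInversion := by
  obtain ⟨φ, rfl⟩ := QuotientGroup.mk_surjective c
  obtain ⟨k, rfl | rfl⟩ := mulAut_thompsonT φ
  · exact Or.inl ((QuotientGroup.eq_one_iff _).2 ⟨k, rfl⟩)
  · exact Or.inr (QuotientGroup.eq.2 ⟨k⁻¹, by simp⟩)

lemma inversion_notMem_thompsonT : inversion ∉ ThompsonT := fun h => by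
  have hc : Cyc ((0 : Fin 3), fun _ => false) (1, fun _ => false) (2, fun _ => false) :=
    Or.inl ⟨Or.inl (by decide), Or.inl (by decide)⟩
  exact hc.asymm (cyc_invPerm.1 (IsThompsonT.preservesCyc h _ _ _ hc))

end CyclicTower

/-! ### The main theorem. -/

open CyclicTower in
theorem theorem2 :
    Nonempty (CyclicTower.Out CyclicTower.ThompsonT ≃* Multiplicative (ZMod 2)) ∧
    ∃ (ψ : CyclicTower.Out CyclicTower.ThompsonT →* MulAut CyclicTower.ThompsonT)
      (e : CyclicTower.ThompsonT ⋊[ψ] CyclicTower.Out CyclicTower.ThompsonT ≃*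
        MulAction.stabilizer CyclicTower.Neretin CyclicTower.KInfty)
      (o : CyclicTower.Out CyclicTower.ThompsonT),
      (∀ c, (QuotientGroup.mk (ψ c) : CyclicTower.Out CyclicTower.ThompsonT) = c) ∧
      (∀ t : CyclicTower.ThompsonT,
        ((e (SemidirectProduct.inl t)) : CyclicTower.Neretin) = (t : CyclicTower.Neretin)) ∧
      (∀ c, c ∈ Subgroup.zpowers o) ∧
      ((e (SemidirectProduct.inr o)) : CyclicTower.Neretin) = CyclicTower.inversion ∧
      (∀ t : CyclicTower.ThompsonT, ((ψ o t : CyclicTower.ThompsonT) : CyclicTower.Neretin) =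
        CyclicTower.inversion * t * CyclicTower.inversion⁻¹) := by
  have hQ := eq_one_or_eq_outInversion
  have ho := outInversion_ne_one
  obtain ⟨ψ, hψ⟩ := exists_monoidHom_of_forall_eq ho hQ inversionAut_mul_self
  obtain ⟨χ, hχ⟩ := exists_monoidHom_of_forall_eq ho hQ
    (a := (⟨inversion, inversion_mem_stabilizer⟩ : MulAction.stabilizer Neretin KInfty))
    (Subtype.ext inversion_mul_self)
  let f : ThompsonT ⋊[ψ] Out ThompsonT →* MulAction.stabilizer Neretin KInfty :=
    SemidirectProduct.lift (Subgroup.inclusion thompsonT_le_stabilizer) χ fun c => by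
      ext1 t
      rcases hQ c with rfl | rfl
      · simp
      · refine Subtype.ext ?_
        simp only [MonoidHom.comp_apply, hψ, hχ]
        rfl
  have hf₁ : ∀ t, ((f (SemidirectProduct.inl t) : MulAction.stabilizer Neretin KInfty) : Neretin) =
      t := fun t => by
    simp [f]
  have hf₂ : f (SemidirectProduct.inr outInversion) = ⟨inversion, inversion_mem_stabilizer⟩ := by
    simp [f, hχ]
  have hbij : Function.Bijective f := by
    constructor
    · rw [injective_iff_map_eq_one]
      rintro ⟨t, c⟩ h
      rw [SemidirectProduct.mk_eq_inl_mul_inr, map_mul] at h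
      rcases hQ c with rfl | rfl
      · rw [map_one, map_one, mul_one] at h
        have h1 := congrArg Subtype.val h
        rw [hf₁] at h1
        rw [show t = 1 from Subtype.ext h1]
        rfl
      · rw [hf₂] at h
        have h1 := congrArg Subtype.val h
        have h2 : (t : Neretin) * inversion = 1 := by
          rw [← hf₁ t]; exact h1
        -- A kernel element over the nontrivial class would put the involution into Thompson's
        -- group.
        exact absurd (eq_inv_of_mul_eq_one_right h2 ▸ ThompsonT.inv_mem t.2)
          inversion_notMem_thompsonT
    · rintro ⟨g, hg⟩
      rcases mem_stabilizer_iff.1 hg with h | h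
      · exact ⟨SemidirectProduct.inl ⟨g, h⟩, Subtype.ext (hf₁ _)⟩
      -- Here `g` is written as `inversion * (inversion * g)`.
      · refine ⟨SemidirectProduct.inr outInversion * SemidirectProduct.inl ⟨_, h⟩, Subtype.ext ?_⟩
        rw [map_mul, hf₂, Subgroup.coe_mul, hf₁]
        simp only
        rw [← mul_assoc, inversion_mul_self, one_mul]
  refine ⟨⟨?_⟩, ψ, MulEquiv.ofBijective f hbij, outInversion, fun c => ?_, hf₁, fun c => ?_, ?_,
    fun t => ?_⟩
  · have hcard : Nat.card (Out ThompsonT) = 2 := by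
      rw [Nat.card_eq_two_iff]
      exact ⟨1, outInversion, ho.symm, Set.eq_univ_of_forall fun c => by simpa using hQ c⟩
    have : Fact (Nat.Prime 2) := ⟨Nat.prime_two⟩
    exact mulEquivOfPrimeCardEq (p := 2) hcard (by simp)
  · rcases hQ c with rfl | rfl
    · rw [map_one]; rfl
    · rw [hψ]; rfl
  · rcases hQ c with rfl | rfl
    · exact one_mem _
    · exact Subgroup.mem_zpowers _
  · exact congrArg Subtype.val hf₂
  · rw [hψ, coe_inversionAut]
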